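/- Let $d\ge 1$, let $\mathbb{M}$ be the set of Borel simple point measures on $\mathbb{R}^d$ (countable sums of Dirac measures at distinct points) with the $\sigma$-algebra generated by the maps $\mu\mapsto\mu(A)$, $A$ Borel, and let isometries $g$ of $\mathbb{R}^d$ act on $\mathbb{M}$ by $g\mu=\mu\circ g^{-1}$. For $r>0$ let $P_r$ be the law on $\mathbb{M}$ of a Poisson point process on $\mathbb{R}^d$ of intensity $r$: under $P_r$ the number $\mu(A)$ is Poisson of mean $r\,\mathcal{L}(A)$ for every Borel set $A$ of finite Lebesgue measure $\mathcal{L}(A)$, and $\mu(A_1),\dots,\mu(A_\ell)$ are independent for pairwise disjoint Borel sets $A_1,\dots,A_\ell$. A map $\phi:\mathbb{M}\to\mathbb{M}$ is *finitary* with respect to $P_r$ if there is a coding window $w:\mathbb{M}\to\mathbb{N}\cup\{\infty\}$, finite $P_r$-almost surely, such that for all $\mu,\mu'\in\mathbb{M}$, if $\mu$ and $\mu'$ have the same restriction to the open ball $B(0,w(\mu))$, then $\phi(\mu)$ and $\phi(\mu')$ have the same restriction to $B(0,1)$. A map $\zeta:\mathbb{M}\times\mathbb{M}\to\mathbb{M}$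 is finitary with respect to $P_r\times P_s$ if the same holds with $w:\mathbb{M}\times\mathbb{M}\to\mathbb{N}\cup\{\infty\}$ finite $(P_r\times P_s)$-almost surely and restrictions of pairs taken coordinatewise. **Proposition 4.** Fix $s>0$. There are measurable maps $\psi_s:\mathbb{M}\to\mathbb{M}\times\mathbb{M}$ and $\zeta_s:\mathbb{M}\times\mathbb{M}\to\mathbb{M}$, not depending on $r$, such that for every $r>0$: 1. $\psi_s$ is a factor from $r$ to $(r,s)$: if $X$ has law $P_r$, then $\psi_s(X)_1$ and $\psi_s(X)_2$ are independent Poisson point processes of intensities $r$ and $s$, and for $P_r$-almost every $\mu$ we have $\psi_s(g\mu)=(g\psi_s(\mu)_1,g\psi_s(\mu)_2)$ for all isometries $g$ of $\mathbb{R}^d$; 2. both coordinate maps of $\psi_s$ are finitary with respect to $P_r$; 3. $\psi_s$ is a bijection almost surely with inverse $\zeta_s$: it restricts to a bijection from a set of full $P_r$-measure onto a set of full $(P_r\times P_s)$-measure, and $\zeta_s$ is its inverse on these sets; 4. $\zeta_s$ is a factor from $(r,s)$ to $r$: if $(X,Y)$ has law $P_r\times P_s$, then $\zeta_s(X,Y)$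 is a Poisson point process of intensity $r$, and for $(P_r\times P_s)$-almost every $(\mu_1,\mu_2)$ we have $\zeta_s(g\mu_1,g\mu_2)=g\zeta_s(\mu_1,\mu_2)$ for all isometries $g$ of $\mathbb{R}^d$; 5. $\zeta_s$ is finitary with respect to $P_r\times P_s$. -/

import Mathlib

open MeasureTheory ProbabilityTheory
open scoped NNReal ENNReal

noncomputable section

/-- A Borel simple point measure on `ℝ^d`: a countable sum of mutually singular Dirac measures,
that is, the sum of the Dirac measures at the points of a countable set. -/
def IsSimplePointMeasure {d : ℕ} (μ : Measure (EuclideanSpace ℝ (Fin d))) : Prop :=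
  ∃ S : Set (EuclideanSpace ℝ (Fin d)), S.Countable ∧
    μ = Measure.sum (fun x : S => Measure.dirac (x : EuclideanSpace ℝ (Fin d)))

/-- The space of Borel simple point measures on `ℝ^d`. -/
def PointMeasure (d : ℕ) : Type :=
  {μ : Measure (EuclideanSpace ℝ (Fin d)) // IsSimplePointMeasure μ}

namespace PointMeasure

variable {d : ℕ}

/-- The underlying measure. -/
def toMeasure (μ : PointMeasure d) : Measure (EuclideanSpace ℝ (Fin d)) := μ.1

/-- The σ-algebra generated by the counting maps `μ ↦ μ(A)`, `A` Borel. -/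
instance : MeasurableSpace (PointMeasure d) :=
  MeasurableSpace.comap PointMeasure.toMeasure Measure.instMeasurableSpace

/-- The number `μ(A)` of points of `μ` in `A`. -/
def count (A : Set (EuclideanSpace ℝ (Fin d))) (μ : PointMeasure d) : ℝ≥0∞ := μ.toMeasure A

end PointMeasure

theorem IsSimplePointMeasure.map_isometry {d : ℕ} {μ : Measure (EuclideanSpace ℝ (Fin d))}
    (h : IsSimplePointMeasure μ)
    (g : EuclideanSpace ℝ (Fin d) ≃ᵢ EuclideanSpace ℝ (Fin d)) :
    IsSimplePointMeasure (μ.map g) := by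
  obtain ⟨S, hS, rfl⟩ := h
  refine ⟨g '' S, hS.image g, ?_⟩
  have hg : Measurable g := g.continuous.measurable
  rw [Measure.map_sum hg.aemeasurable]
  ext A hA
  rw [Measure.sum_apply _ hA, Measure.sum_apply _ hA]
  rw [← (Equiv.Set.image g S g.injective).tsum_eq]
  refine tsum_congr fun x => ?_
  rw [Measure.map_dirac' hg]
  rfl

namespace PointMeasure

variable {d : ℕ}

/-- The action `g(μ) = μ ∘ g⁻¹` of an isometry of `ℝ^d`. -/
def act (g : EuclideanSpace ℝ (Fin d) ≃ᵢ EuclideanSpace ℝ (Fin d)) (μ : PointMeasure d) :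
    PointMeasure d :=
  ⟨μ.toMeasure.map g, μ.2.map_isometry g⟩

/-- `μ` and `ν` have equal restrictions to the open ball `B(0, R)`; for `R = ∞` the ball is all of
`ℝ^d`. -/
def AgreeOnBall (R : ℕ∞) (μ ν : PointMeasure d) : Prop :=
  μ.toMeasure.restrict (Metric.eball 0 (R : ℝ≥0∞)) =
    ν.toMeasure.restrict (Metric.eball 0 (R : ℝ≥0∞))

end PointMeasure

/-- `P` is the law of a Poisson point process on `ℝ^d` of intensity `r`. -/
structure IsPoissonLaw {d : ℕ} (r : ℝ≥0) (P : Measure (PointMeasure d)) : Prop where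
  isProbabilityMeasure : IsProbabilityMeasure P
  /-- The number of points in a Borel set `A` of finite volume is Poisson of mean `r` times the
  volume of `A`. -/
  map_count : ∀ A : Set (EuclideanSpace ℝ (Fin d)), MeasurableSet A → volume A < ∞ →
    P.map (PointMeasure.count A) =
      (poissonMeasure (r * (volume A).toNNReal)).map (fun n : ℕ => (n : ℝ≥0∞))
  /-- The numbers of points in finitely many pairwise disjoint Borel sets are independent. -/
  indep_count : ∀ (l : ℕ) (A : Fin l → Set (EuclideanSpace ℝ (Fin d))),
    (∀ i, MeasurableSet (A i)) → (∀ i j, i ≠ j → Disjoint (A i) (A j)) →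
    iIndepFun (fun i => PointMeasure.count (A i)) P

/-- `w` is a coding window of `φ`. -/
def IsCodingWindow {d : ℕ} (φ : PointMeasure d → PointMeasure d) (w : PointMeasure d → ℕ∞) :
    Prop :=
  ∀ μ ν, PointMeasure.AgreeOnBall (w μ) μ ν → PointMeasure.AgreeOnBall 1 (φ μ) (φ ν)

/-- `φ` has a coding window that is finite `P`-almost surely. -/
def IsFinitary {d : ℕ} (P : Measure (PointMeasure d)) (φ : PointMeasure d → PointMeasure d) :
    Prop :=
  ∃ w : PointMeasure d → ℕ∞, IsCodingWindow φ w ∧ ∀ᵐ μ ∂P, w μ < ⊤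

/-- Both coordinates of `ψ` are finitary. -/
def IsFinitaryToPair {d : ℕ} (P : Measure (PointMeasure d))
    (ψ : PointMeasure d → PointMeasure d × PointMeasure d) : Prop :=
  IsFinitary P (fun μ => (ψ μ).1) ∧ IsFinitary P (fun μ => (ψ μ).2)

/-- `w` is a coding window of a map `ζ` of two arguments. -/
def IsCodingWindowFromPair {d : ℕ} (ζ : PointMeasure d × PointMeasure d → PointMeasure d)
    (w : PointMeasure d × PointMeasure d → ℕ∞) : Prop :=
  ∀ p q, PointMeasure.AgreeOnBall (w p) p.1 q.1 → PointMeasure.AgreeOnBall (w p) p.2 q.2 →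
    PointMeasure.AgreeOnBall 1 (ζ p) (ζ q)

/-- `ζ` has a coding window that is finite almost surely for the law `PQ` of a pair. -/
def IsFinitaryFromPair {d : ℕ} (PQ : Measure (PointMeasure d × PointMeasure d))
    (ζ : PointMeasure d × PointMeasure d → PointMeasure d) : Prop :=
  ∃ w : PointMeasure d × PointMeasure d → ℕ∞, IsCodingWindowFromPair ζ w ∧ ∀ᵐ p ∂PQ, w p < ⊤

/-- `ψ` is a factor from `r` to `(r, s)`, where `P` is the Poisson law of intensity `r`. -/
structure IsFactorToPair {d : ℕ} (r s : ℝ≥0) (P : Measure (PointMeasure d))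
    (ψ : PointMeasure d → PointMeasure d × PointMeasure d) : Prop where
  measurable : Measurable ψ
  law_fst : IsPoissonLaw r (P.map (fun μ => (ψ μ).1))
  law_snd : IsPoissonLaw s (P.map (fun μ => (ψ μ).2))
  indep : IndepFun (fun μ => (ψ μ).1) (fun μ => (ψ μ).2) P
  equivariant : ∀ᵐ μ ∂P, ∀ g : EuclideanSpace ℝ (Fin d) ≃ᵢ EuclideanSpace ℝ (Fin d),
    ψ (μ.act g) = ((ψ μ).1.act g, (ψ μ).2.act g)

/-- `ζ` is a factor from `(r, s)` to `r`, where `PQ` is the law of a pair of independent Poisson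
processes of intensities `r` and `s`. -/
structure IsFactorFromPair {d : ℕ} (r : ℝ≥0) (PQ : Measure (PointMeasure d × PointMeasure d))
    (ζ : PointMeasure d × PointMeasure d → PointMeasure d) : Prop where
  measurable : Measurable ζ
  law : IsPoissonLaw r (PQ.map ζ)
  equivariant : ∀ᵐ p ∂PQ, ∀ g : EuclideanSpace ℝ (Fin d) ≃ᵢ EuclideanSpace ℝ (Fin d),
    ζ (p.1.act g, p.2.act g) = (ζ p).act g

/-- `ψ` is a bijection almost surely, with inverse `ζ`: it restricts to a bijection between sets of
full measure, on which `ζ` is its two-sided inverse. -/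
def IsAEBijectionWithInverse {d : ℕ} (P : Measure (PointMeasure d))
    (PQ : Measure (PointMeasure d × PointMeasure d))
    (ψ : PointMeasure d → PointMeasure d × PointMeasure d)
    (ζ : PointMeasure d × PointMeasure d → PointMeasure d) : Prop :=
  ∃ A ∈ ae P, ∃ B ∈ ae PQ, Set.BijOn ψ A B ∧ Set.InvOn ζ ψ A B

end

/-! A Poisson process carries spare randomness that can be located by a local, isometry-equivariant
rule and replaced without disturbing that rule. A point m is special when it is the midpoint of two
points closer to m than 1/2 and alone in the ball of radius 6 about m, when no other candidate for a
centre lies within d + 20, and when each of d shells about m contains exactly one point, with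
linearly independent position vectors. Moving the two points radially and symmetrically, with radius
in (0, 1/2), changes neither the set of special centres nor their shell points
(`Perturb.special_iff`). By the bivariate Mecke formula (`IsPoissonLaw.mecke_pairs`) and polar
coordinates, replacing all these radii by independent variables of law `radiusLaw d` leaves the
Poisson law invariant (`IsPoissonLaw.map_resample_univ`).

One real variable without atoms can hold any amount of randomness. The maps α and β of
`exists_radius_code` identify a radius, up to null sets, with a sequence z₀, z₁, … of independent
Poisson processes of intensity s. Gram–Schmidt turns the shell points into a frame, and coordinates
in this frame do not change when an isometry acts on the whole configuration. In the Voronoi cell of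
each special centre, `splitMap` outputs the part of z₀ lying there in local coordinates; inside the
cell it then replaces zₙ by zₙ₊₁ for all n, and it writes the new sequence back into the radius.
`mergeMap` does the opposite: it inserts the part of the second process in the cell in front of the
sequence. As in Hilbert's hotel there is always room, and since the inserted process has the law of
the terms, the law of the sequence does not change (`IsPoissonLaw.map_mergeCode`).

For the laws, P is not disintegrated. Instead, a Poisson process is represented as `encodeSet β μ
w`, where μ is Poisson and w is an independent family of codes
(`IsRadiusCode.measurePreserving_encode`). In these variables `mergeMap` becomes `mergeCode`, so it
maps P × Q to P. It is undone by `splitMap`, because almost surely every point of the second process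
lies in some cell. The law of `splitMap` and the other inverse identity then follow formally from
these two facts. Equivariance is built into the construction, and the code depends on s alone, which
is why the same maps serve for all r.

For finitariness, a pattern that forces a special centre has positive probability and is tried
independently at far apart places, so the probability of seeing no special centre within distance R
decays exponentially. Covering spheres by nets shows that almost surely there is an N such that
every point of the sphere of radius N is within N / 10 of a special centre
(`IsPoissonLaw.ae_special_dense`). Such a sphere confines the cells of centres near the origin to
the ball of radius N (`DenseSphere.cell_subset`), and the ball of radius 2N + d + 30 then determines
the output near the origin. -/

open Filter Topology

noncomputable section

/-! ### Countable sets as counting measures, and local finiteness -/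

/-- Euclidean space of dimension `d`. -/
abbrev Euc (d : ℕ) : Type := EuclideanSpace ℝ (Fin d)

/-- The sum of the Dirac measures at the points of a set. -/
def sumDirac {d : ℕ} (S : Set (Euc d)) : Measure (Euc d) :=
  Measure.sum fun x : S => Measure.dirac (x : Euc d)

/-- The set has finitely many points in every ball. -/
def LocFin {d : ℕ} (S : Set (Euc d)) : Prop := ∀ n : ℕ, (S ∩ Metric.ball 0 n).Finite

/-- The points whose norm has integer part `n`. -/
def annulus (d n : ℕ) : Set (Euc d) := {x | ⌊‖x‖⌋₊ = n}

section Sets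

variable {d : ℕ} {S : Set (Euc d)}

theorem sumDirac_apply {A : Set (Euc d)} (hA : MeasurableSet A) :
    sumDirac S A = ((S ∩ A).encard : ℝ≥0∞) := by
  classical
  rw [sumDirac, Measure.sum_apply _ hA]
  have : ∀ x : S, (Measure.dirac (x : Euc d)) A = A.indicator (fun _ => 1) (x : Euc d) :=
    fun x => Measure.dirac_apply' _ hA
  simp_rw [this]
  rw [← ENNReal.tsum_set_one, tsum_subtype S (A.indicator fun _ => (1 : ℝ≥0∞)),
    tsum_subtype (S ∩ A) (fun _ => (1 : ℝ≥0∞))]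
  refine tsum_congr fun x => ?_
  by_cases h1 : x ∈ S <;> by_cases h2 : x ∈ A <;> simp [h1, h2]

theorem lintegral_sumDirac (f : Euc d → ℝ≥0∞) :
    ∫⁻ x, f x ∂(sumDirac S) = ∑' x : S, f x := by
  rw [sumDirac, lintegral_sum_measure]
  simp

theorem sumDirac_singleton (x : Euc d) : sumDirac S {x} = S.indicator 1 x := by
  rw [sumDirac_apply (measurableSet_singleton x)]
  by_cases h : x ∈ S
  · simp [h]
  · simp [h]

theorem sumDirac_singleton_ne_zero {x : Euc d} : sumDirac S {x} ≠ 0 ↔ x ∈ S := by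
  rw [sumDirac_singleton]
  by_cases h : x ∈ S <;> simp [h]

theorem measurableSet_annulus (n : ℕ) : MeasurableSet (annulus d n) :=
  (Nat.measurable_floor.comp measurable_norm) (measurableSet_singleton n)

theorem annulus_subset_ball {n k : ℕ} (h : n < k) : annulus d n ⊆ Metric.ball 0 k := by
  intro x hx
  have h1 : ‖x‖ < (⌊‖x‖⌋₊ : ℝ) + 1 := Nat.lt_floor_add_one _
  have hx' : ⌊‖x‖⌋₊ = n := hx
  rw [hx'] at h1
  have : ((n + 1 : ℕ) : ℝ) ≤ k := by exact_mod_cast h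
  push_cast at this
  simp only [mem_ball_zero_iff]
  linarith

theorem floor_norm_lt {x : Euc d} {k : ℕ} (h : x ∈ Metric.ball (0 : Euc d) k) :
    ⌊‖x‖⌋₊ < k := by
  rw [Nat.floor_lt (norm_nonneg x)]
  simpa using h

theorem LocFin.subset {T : Set (Euc d)} (h : LocFin S) (hT : T ⊆ S) : LocFin T :=
  fun n => (h n).subset (Set.inter_subset_inter_left _ hT)

theorem LocFin.union {T : Set (Euc d)} (h : LocFin S) (hT : LocFin T) : LocFin (S ∪ T) := by
  intro n
  rw [Set.union_inter_distrib_right]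
  exact (h n).union (hT n)

theorem LocFin.finite_inter_ball (h : LocFin S) (x : Euc d) (r : ℝ) :
    (S ∩ Metric.ball x r).Finite := by
  obtain ⟨n, hn⟩ := exists_nat_gt (‖x‖ + r)
  refine (h n).subset (Set.inter_subset_inter_right _ fun y hy => ?_)
  rw [Metric.mem_ball, dist_eq_norm] at hy
  rw [mem_ball_zero_iff]
  have := norm_sub_norm_le y x
  linarith

theorem LocFin.countable (h : LocFin S) : S.Countable := by
  have : S = ⋃ n : ℕ, S ∩ Metric.ball 0 n := by
    rw [← Set.inter_iUnion, Metric.iUnion_ball_nat, Set.inter_univ]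
  rw [this]
  exact Set.countable_iUnion fun n => (h n).countable

theorem LocFin.image_isometry (h : LocFin S) (g : Euc d ≃ᵢ Euc d) : LocFin (g '' S) := by
  intro n
  have h1 := (h.finite_inter_ball (g.symm 0) n).image g
  refine h1.subset ?_
  rintro _ ⟨⟨x, hx, rfl⟩, hy⟩
  refine ⟨x, ⟨hx, ?_⟩, rfl⟩
  rw [Metric.mem_ball] at *
  rwa [← g.dist_eq, g.apply_symm_apply]

end Sets

/-! ### Point measures and their locally finite part -/

namespace PointMeasure

variable {d : ℕ}

/-- The point measure of a countable set, and the zero measure if the set is not countable. -/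
def ofSet (S : Set (Euc d)) : PointMeasure d :=
  open Classical in
  if h : S.Countable then ⟨sumDirac S, S, h, rfl⟩ else ⟨0, ∅, Set.countable_empty, by simp⟩

theorem toMeasure_ofSet {S : Set (Euc d)} (h : S.Countable) :
    (ofSet S).toMeasure = sumDirac S := by
  simp [ofSet, h, toMeasure]

/-- The set of atoms. -/
def supp (μ : PointMeasure d) : Set (Euc d) := {x | μ.toMeasure {x} ≠ 0}

theorem ext_toMeasure {μ ν : PointMeasure d} (h : μ.toMeasure = ν.toMeasure) : μ = ν :=
  Subtype.ext h

theorem supp_ofSet {S : Set (Euc d)} (h : S.Countable) : (ofSet S).supp = S := by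
  ext x
  simp only [supp, toMeasure_ofSet h, Set.mem_ofPred_eq]
  exact sumDirac_singleton_ne_zero

theorem exists_eq_ofSet (μ : PointMeasure d) : ∃ S : Set (Euc d), S.Countable ∧ μ = ofSet S := by
  obtain ⟨S, hS, h⟩ := μ.2
  exact ⟨S, hS, ext_toMeasure (by rw [toMeasure_ofSet hS]; exact h)⟩

theorem countable_supp (μ : PointMeasure d) : μ.supp.Countable := by
  obtain ⟨S, hS, rfl⟩ := μ.exists_eq_ofSet
  rwa [supp_ofSet hS]

theorem ofSet_supp (μ : PointMeasure d) : ofSet μ.supp = μ := by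
  obtain ⟨S, hS, rfl⟩ := μ.exists_eq_ofSet
  rw [supp_ofSet hS]

theorem toMeasure_eq (μ : PointMeasure d) : μ.toMeasure = sumDirac μ.supp := by
  conv_lhs => rw [← μ.ofSet_supp, toMeasure_ofSet μ.countable_supp]

theorem ext_supp {μ ν : PointMeasure d} (h : μ.supp = ν.supp) : μ = ν := by
  rw [← μ.ofSet_supp, h, ofSet_supp]

theorem measurable_toMeasure : Measurable (toMeasure : PointMeasure d → _) :=
  comap_measurable _

theorem measurable_count {A : Set (Euc d)} (hA : MeasurableSet A) : Measurable (count A) :=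
  (Measure.measurable_coe hA).comp measurable_toMeasure

theorem measurable_of_count {Ω : Type*} [MeasurableSpace Ω] {f : Ω → PointMeasure d}
    (h : ∀ A, MeasurableSet A → Measurable fun ω => (f ω).toMeasure A) : Measurable f := by
  rw [measurable_comap_iff]
  exact Measure.measurable_of_measurable_coe _ h

/-- The atoms in those annuli that carry finite mass. -/
def pts (μ : PointMeasure d) : Set (Euc d) :=
  {x | x ∈ μ.supp ∧ μ.toMeasure (annulus d ⌊‖x‖⌋₊) < ∞}

theorem pts_subset_supp (μ : PointMeasure d) : μ.pts ⊆ μ.supp := fun _ hx => hx.1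

theorem countable_pts (μ : PointMeasure d) : μ.pts.Countable :=
  μ.countable_supp.mono μ.pts_subset_supp

theorem finite_supp_inter {μ : PointMeasure d} {A : Set (Euc d)} (hA : MeasurableSet A) :
    (μ.supp ∩ A).Finite ↔ μ.toMeasure A < ∞ := by
  rw [toMeasure_eq, sumDirac_apply hA]
  rw [← Set.encard_lt_top_iff]
  exact ENat.toENNReal_lt_top.symm

/-- Point measures may have accumulation points, which the geometry below cannot handle; passing to
`pts` makes every construction total. Whether an atom is kept is decided by its own annulus alone,
so a ball of integer radius still determines `pts` inside it, as coding windows require. -/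
theorem locFin_pts (μ : PointMeasure d) : LocFin μ.pts := by
  intro n
  have : μ.pts ∩ Metric.ball 0 n ⊆
      ⋃ k ∈ {k | k < n ∧ μ.toMeasure (annulus d k) < ∞}, μ.supp ∩ annulus d k := by
    rintro x ⟨⟨hx, hx'⟩, hxn⟩
    simp only [Set.mem_iUnion]
    exact ⟨_, ⟨floor_norm_lt hxn, hx'⟩, hx, rfl⟩
  refine Set.Finite.subset (Set.Finite.biUnion ((Set.finite_lt_nat n).subset fun k hk => hk.1) ?_) this
  intro k hk
  exact (finite_supp_inter (measurableSet_annulus k)).2 hk.2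

theorem pts_eq_supp {μ : PointMeasure d} (h : LocFin μ.supp) : μ.pts = μ.supp := by
  refine Set.Subset.antisymm μ.pts_subset_supp fun x hx => ⟨hx, ?_⟩
  rw [← finite_supp_inter (measurableSet_annulus _)]
  exact (h (⌊‖x‖⌋₊ + 1)).subset (Set.inter_subset_inter_right _ (annulus_subset_ball (by simp)))

theorem pts_ofSet {S : Set (Euc d)} (h : LocFin S) : (ofSet S).pts = S := by
  rw [pts_eq_supp, supp_ofSet h.countable]
  rwa [supp_ofSet h.countable]

theorem locFin_supp_iff {μ : PointMeasure d} :
    LocFin μ.supp ↔ ∀ n : ℕ, μ.toMeasure (Metric.ball 0 n) < ∞ := by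
  refine forall_congr' fun n => ?_
  rw [finite_supp_inter measurableSet_ball]

theorem measurableSet_locFin : MeasurableSet {μ : PointMeasure d | LocFin μ.supp} := by
  have : {μ : PointMeasure d | LocFin μ.supp} =
      ⋂ n : ℕ, {μ | μ.toMeasure (Metric.ball 0 n) < ∞} := by
    ext μ
    simp [locFin_supp_iff]
  rw [this]
  exact MeasurableSet.iInter fun n =>
    measurableSet_lt (measurable_count measurableSet_ball) measurable_const

theorem measurableSet_count_annulus (n k : ℕ) :
    MeasurableSet {μ : PointMeasure d | μ.toMeasure (annulus d n) = k} :=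
  measurable_count (measurableSet_annulus n) (measurableSet_singleton _)

/-- The kernel that sends a point measure to its locally finite part. -/
def ptsKernel (d : ℕ) : Kernel (PointMeasure d) (Euc d) :=
  open Classical in
  Kernel.sum fun p : ℕ × ℕ =>
    Kernel.piecewise (s := {μ : PointMeasure d | μ.toMeasure (annulus d p.1) = p.2})
      (measurableSet_count_annulus p.1 p.2)
      (Kernel.restrict ⟨toMeasure, measurable_toMeasure⟩ (measurableSet_annulus p.1)) 0

/-- Splitting by the value `p.2` of the mass bounds each piece by a constant, so the kernel is a
countable sum of finite kernels. This is what makes integrals of jointly measurable functions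
against it measurable. -/
instance : IsSFiniteKernel (ptsKernel d) := by
  classical
  have : ∀ p : ℕ × ℕ, IsSFiniteKernel
    (Kernel.piecewise (s := {μ : PointMeasure d | μ.toMeasure (annulus d p.1) = p.2})
      (measurableSet_count_annulus p.1 p.2)
      (Kernel.restrict ⟨toMeasure, measurable_toMeasure⟩ (measurableSet_annulus p.1)) 0) := by
    intro p
    have : IsFiniteKernel
      (Kernel.piecewise (s := {μ : PointMeasure d | μ.toMeasure (annulus d p.1) = p.2})
        (measurableSet_count_annulus p.1 p.2)
        (Kernel.restrict ⟨toMeasure, measurable_toMeasure⟩ (measurableSet_annulus p.1)) 0) := by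
      refine ⟨p.2, ENNReal.natCast_lt_top _, fun μ => ?_⟩
      rw [Kernel.piecewise_apply]
      split_ifs with h
      · rw [Kernel.restrict_apply, Measure.restrict_apply_univ]
        exact le_of_eq h
      · simp
    infer_instance
  unfold ptsKernel
  infer_instance

/-- An atom x contributes to the single index formed by ⌊‖x‖⌋ and the mass of its annulus, and to no
index if that mass is infinite. -/
theorem ptsKernel_apply (μ : PointMeasure d) : ptsKernel d μ = sumDirac μ.pts := by
  classical
  ext A hA
  rw [ptsKernel, Kernel.sum_apply, Measure.sum_apply _ hA, sumDirac_apply hA]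
  rw [← ENNReal.tsum_set_one, tsum_subtype (μ.pts ∩ A) (fun _ => (1 : ℝ≥0∞))]
  have h1 : ∀ p : ℕ × ℕ, (Kernel.piecewise
      (s := {μ : PointMeasure d | μ.toMeasure (annulus d p.1) = p.2})
      (measurableSet_count_annulus p.1 p.2)
      (Kernel.restrict ⟨toMeasure, measurable_toMeasure⟩ (measurableSet_annulus p.1)) 0) μ A
      = ∑' x : Euc d, if (μ.toMeasure (annulus d p.1) = p.2 ∧ x ∈ μ.supp ∩ (A ∩ annulus d p.1))
          then 1 else 0 := by
    intro p
    rw [Kernel.piecewise_apply]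
    simp only [Set.mem_ofPred_eq]
    by_cases h : μ.toMeasure (annulus d p.1) = p.2
    · rw [if_pos h, Kernel.restrict_apply, Measure.restrict_apply hA]
      change μ.toMeasure _ = _
      conv_lhs => rw [toMeasure_eq, sumDirac_apply (hA.inter (measurableSet_annulus _)),
        ← ENNReal.tsum_set_one, tsum_subtype _ (fun _ => (1 : ℝ≥0∞))]
      refine tsum_congr fun x => ?_
      by_cases hx : x ∈ μ.supp ∩ (A ∩ annulus d p.1) <;> simp [hx, h]
    · rw [if_neg h]
      simp [h]
  simp_rw [h1]
  rw [ENNReal.tsum_comm]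
  refine tsum_congr fun x => ?_
  by_cases hx : x ∈ μ.pts ∩ A
  · have hfin := (μ.finite_supp_inter (measurableSet_annulus ⌊‖x‖⌋₊)).2 hx.1.2
    obtain ⟨k, hk⟩ : ∃ k : ℕ, μ.toMeasure (annulus d ⌊‖x‖⌋₊) = k := by
      refine ⟨(μ.supp ∩ annulus d ⌊‖x‖⌋₊).ncard, ?_⟩
      conv_lhs => rw [toMeasure_eq, sumDirac_apply (measurableSet_annulus _),
        ← hfin.cast_ncard_eq]
      simp
    rw [tsum_eq_single (⌊‖x‖⌋₊, k)]
    · have : x ∈ annulus d ⌊‖x‖⌋₊ := rfl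
      simp [hk, hx.1.1, hx.2, this, hx]
    · rintro ⟨n, j⟩ hne
      rw [if_neg]
      rintro ⟨h2, h3⟩
      have h4 : ⌊‖x‖⌋₊ = n := h3.2.2
      subst h4
      apply hne
      simp only at h2
      rw [hk] at h2
      have : k = j := by exact_mod_cast h2
      rw [this]
  · rw [Set.indicator_of_notMem hx, ENNReal.tsum_eq_zero]
    rintro ⟨n, j⟩
    rw [if_neg]
    rintro ⟨h2, h3⟩
    apply hx
    have h4 : ⌊‖x‖⌋₊ = n := h3.2.2
    refine ⟨⟨h3.1, ?_⟩, h3.2.1⟩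
    rw [h4]
    simp only at h2
    rw [h2]
    exact ENNReal.natCast_lt_top _

section Measurability

variable {Ω : Type*} [MeasurableSpace Ω] {Z : Ω → PointMeasure d}

/-- Measurability of the geometric constructions is reduced to this: a quantifier over points
becomes the vanishing or not of such a sum. -/
theorem measurable_tsum_pts (hZ : Measurable Z) {f : Ω → Euc d → ℝ≥0∞}
    (hf : Measurable fun p : Ω × Euc d => f p.1 p.2) :
    Measurable fun ω => ∑' x : (Z ω).pts, f ω x := by
  have h := Measurable.lintegral_kernel_prod_right' (κ := (ptsKernel d).comap Z hZ) hf
  simpa only [Kernel.comap_apply, ptsKernel_apply, lintegral_sumDirac] using h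

theorem measurableSet_exists_pts (hZ : Measurable Z) {p : Ω → Euc d → Prop}
    (hp : MeasurableSet {q : Ω × Euc d | p q.1 q.2}) :
    MeasurableSet {ω | ∃ x ∈ (Z ω).pts, p ω x} := by
  classical
  have h := measurable_tsum_pts hZ (f := fun ω x => if p ω x then 1 else 0)
    (Measurable.ite hp measurable_const measurable_const)
  have h2 : {ω | ∃ x ∈ (Z ω).pts, p ω x} =
      {ω | (∑' x : (Z ω).pts, if p ω x then (1 : ℝ≥0∞) else 0) = 0}ᶜ := by
    ext ω
    simp [ENNReal.tsum_eq_zero]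
  rw [h2]
  exact (h (measurableSet_singleton 0)).compl

theorem measurableSet_forall_pts (hZ : Measurable Z) {p : Ω → Euc d → Prop}
    (hp : MeasurableSet {q : Ω × Euc d | p q.1 q.2}) :
    MeasurableSet {ω | ∀ x ∈ (Z ω).pts, p ω x} := by
  have h := (measurableSet_exists_pts hZ (p := fun ω x => ¬ p ω x) hp.compl).compl
  convert h using 1
  ext ω
  simp

end Measurability

end PointMeasure

/-! ### Measurable selection of a value attached to the points -/

/-- Some element that satisfies `P`, if there is one. -/
def chooseOrDefault {β : Type*} [Inhabited β] (P : β → Prop) : β :=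
  open Classical in if h : ∃ b, P b then h.choose else default

/-- The common value of `f` at the points of `S` that satisfy `p`, if there is one. -/
def pickVal {α β : Type*} [Inhabited β] (S : Set α) (p : α → Prop) (f : α → β) : β :=
  chooseOrDefault fun b => (∃ x ∈ S, p x) ∧ ∀ x ∈ S, p x → f x = b

theorem pickVal_eq {α β : Type*} [Inhabited β] {S : Set α} {p : α → Prop} {f : α → β} {x : α}
    (hx : x ∈ S) (hp : p x) (h : ∀ y ∈ S, p y → f y = f x) : pickVal S p f = f x := by
  have h' : ∃ b, (∃ x ∈ S, p x) ∧ ∀ x ∈ S, p x → f x = b := ⟨f x, ⟨x, hx, hp⟩, h⟩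
  rw [pickVal, chooseOrDefault, dif_pos h']
  exact (h'.choose_spec.2 x hx hp).symm

theorem pickVal_congr {α β : Type*} [Inhabited β] {S T : Set α} {p q : α → Prop} {f g : α → β}
    (h : ∀ x, (x ∈ S ∧ p x) ↔ (x ∈ T ∧ q x)) (hf : ∀ x ∈ S, p x → f x = g x) :
    pickVal S p f = pickVal T q g := by
  have : (fun b => (∃ x ∈ S, p x) ∧ ∀ x ∈ S, p x → f x = b) =
      fun b => (∃ x ∈ T, q x) ∧ ∀ x ∈ T, q x → g x = b := by
    funext b
    simp only [eq_iff_iff]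
    refine and_congr (exists_congr fun x => h x) ⟨fun H x hx hq => ?_, fun H x hx hp => ?_⟩
    · have := (h x).2 ⟨hx, hq⟩
      rw [← hf x this.1 this.2]
      exact H x this.1 this.2
    · have := (h x).1 ⟨hx, hp⟩
      rw [hf x hx hp]
      exact H x this.1 this.2
  rw [pickVal, pickVal, this]

/-- Although `pickVal` is defined by choice, nothing is left to choose: on the measurable event `G`
the predicate determines the value, and off `G` the value is constant. -/
theorem PointMeasure.measurable_pickVal {d : ℕ} {Ω : Type*} [MeasurableSpace Ω]
    {Z : Ω → PointMeasure d} (hZ : Measurable Z) {β : Type*} [Inhabited β] [MeasurableSpace β]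
    [MeasurableEq β]
    {p : Ω → Euc d → Prop} (hp : MeasurableSet {q : Ω × Euc d | p q.1 q.2})
    {f : Ω → Euc d → β} (hf : Measurable fun q : Ω × Euc d => f q.1 q.2) :
    Measurable fun ω => pickVal (Z ω).pts (p ω) (f ω) := by
  classical
  set G : Set Ω := {ω | (∃ x ∈ (Z ω).pts, p ω x) ∧
    ∀ x ∈ (Z ω).pts, ∀ y ∈ (Z ω).pts, p ω x → p ω y → f ω x = f ω y} with hG
  have hp1 : MeasurableSet {q : (Ω × Euc d) × Euc d | p q.1.1 q.1.2} :=
    measurable_fst hp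
  have hp2 : MeasurableSet {q : (Ω × Euc d) × Euc d | p q.1.1 q.2} :=
    (measurable_fst.fst.prodMk measurable_snd : Measurable
      fun q : (Ω × Euc d) × Euc d => (q.1.1, q.2)) hp
  have hf1 : Measurable fun q : (Ω × Euc d) × Euc d => f q.1.1 q.1.2 := hf.comp measurable_fst
  have hf2 : Measurable fun q : (Ω × Euc d) × Euc d => f q.1.1 q.2 :=
    hf.comp (measurable_fst.fst.prodMk measurable_snd : Measurable
      fun q : (Ω × Euc d) × Euc d => (q.1.1, q.2))
  have hGm : MeasurableSet G := by
    refine (measurableSet_exists_pts hZ hp).inter ?_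
    refine measurableSet_forall_pts hZ (p := fun ω x => ∀ y ∈ (Z ω).pts, p ω x → p ω y →
      f ω x = f ω y) ?_
    refine measurableSet_forall_pts (Z := fun q : Ω × Euc d => Z q.1) (hZ.comp measurable_fst)
      (p := fun q y => p q.1 q.2 → p q.1 y → f q.1 q.2 = f q.1 y) ?_
    exact hp1.imp (hp2.imp (measurableSet_eq_fun hf1 hf2))
  have key : (fun ω => pickVal (Z ω).pts (p ω) (f ω)) = fun ω =>
      if ω ∈ G then pickVal (Z ω).pts (p ω) (f ω) else default := by
    funext ω
    split_ifs with h
    · rfl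
    · rw [pickVal, chooseOrDefault, dif_neg]
      rintro ⟨b, h1, h2⟩
      exact h ⟨h1, fun x hx y hy px py => (h2 x hx px).trans (h2 y hy py).symm⟩
  intro B hB
  have h3 : (fun ω => pickVal (Z ω).pts (p ω) (f ω)) ⁻¹' B =
      (G ∩ {ω | ∃ x ∈ (Z ω).pts, p ω x ∧ f ω x ∈ B}) ∪ (Gᶜ ∩ {_ω | default ∈ B}) := by
    ext ω
    by_cases h : ω ∈ G
    · obtain ⟨⟨x, hx, px⟩, h2⟩ := id h
      have h4 : pickVal (Z ω).pts (p ω) (f ω) = f ω x :=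
        pickVal_eq hx px fun y hy py => h2 y hy x hx py px
      simp only [Set.mem_preimage, h4, Set.mem_union, Set.mem_inter_iff, h, true_and,
        Set.mem_compl_iff, not_true, false_and, or_false]
      constructor
      · exact fun hB => ⟨x, hx, px, hB⟩
      · rintro ⟨y, hy, py, hB⟩
        rwa [h2 x hx y hy px py]
    · have h5 := congrFun key ω
      simp only [h, if_false] at h5
      simp [h, h5]
  rw [h3]
  refine (hGm.inter ?_).union (hGm.compl.inter (MeasurableSet.const _))
  exact measurableSet_exists_pts hZ (hp.inter (hf hB))

/-! ### Laplace transforms determine finite measures -/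

/-- The function `x ↦ e⁻ˣ` on `[0, ∞]`. -/
def expNeg (x : ℝ≥0∞) : ℝ≥0∞ := EReal.exp (-(x : EReal))

@[simp] theorem expNeg_zero : expNeg 0 = 1 := by simp [expNeg]

@[simp] theorem expNeg_top : expNeg ∞ = 0 := by simp [expNeg]

theorem expNeg_coe (x : ℝ≥0) : expNeg x = ENNReal.ofReal (Real.exp (-x)) := by
  have : (((x : ℝ≥0∞) : EReal)) = ((x : ℝ) : EReal) := rfl
  rw [expNeg, this, ← EReal.coe_neg, EReal.exp_coe]

theorem expNeg_add (x y : ℝ≥0∞) : expNeg (x + y) = expNeg x * expNeg y := by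
  rw [expNeg, expNeg, expNeg, ← EReal.exp_add, EReal.coe_ennreal_add, EReal.neg_add]
  · rfl
  · left; simp
  · right; simp

theorem expNeg_le_one (x : ℝ≥0∞) : expNeg x ≤ 1 := by
  rw [expNeg, EReal.exp_le_one_iff, EReal.neg_le_zero]
  exact EReal.coe_ennreal_nonneg x

theorem expNeg_ne_top (x : ℝ≥0∞) : expNeg x ≠ ∞ :=
  ne_top_of_le_ne_top ENNReal.one_ne_top (expNeg_le_one x)

theorem expNeg_sum {ι : Type*} (s : Finset ι) (f : ι → ℝ≥0∞) :
    expNeg (∑ i ∈ s, f i) = ∏ i ∈ s, expNeg (f i) := by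
  classical
  induction s using Finset.induction_on with
  | empty => simp
  | insert a s ha ih => rw [Finset.sum_insert ha, Finset.prod_insert ha, expNeg_add, ih]

theorem expNeg_nsmul (n : ℕ) (x : ℝ≥0∞) : expNeg (n • x) = expNeg x ^ n := by
  have := expNeg_sum (Finset.range n) (fun _ => x)
  simpa using this

theorem continuous_expNeg : Continuous expNeg :=
  ENNReal.continuous_exp.comp (continuous_neg.comp continuous_coe_ennreal_ereal)

theorem measurable_expNeg : Measurable expNeg := continuous_expNeg.measurable

theorem expNeg_injective : Function.Injective expNeg := by
  intro x y h
  have := EReal.exp_strictMono.injective h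
  simpa using this

theorem expNeg_strictAnti : StrictAnti expNeg := by
  intro x y h
  apply EReal.exp_strictMono
  simpa using h

theorem expNeg_antitone : Antitone expNeg := expNeg_strictAnti.antitone

/-- `e⁻ˣ` as a point of the unit interval. -/
def expNegUnit (x : ℝ≥0∞) : unitInterval :=
  ⟨(expNeg x).toReal, ENNReal.toReal_nonneg, by
    simpa using ENNReal.toReal_mono ENNReal.one_ne_top (expNeg_le_one x)⟩

theorem measurable_expNegUnit : Measurable expNegUnit :=
  Measurable.subtype_mk measurable_expNeg.ennreal_toReal

theorem measurableEmbedding_expNegUnit : MeasurableEmbedding expNegUnit := by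
  refine measurable_expNegUnit.measurableEmbedding fun x y h => ?_
  have h' : (expNeg x).toReal = (expNeg y).toReal := congrArg (Subtype.val : unitInterval → ℝ) h
  exact expNeg_injective
    ((ENNReal.toReal_eq_toReal_iff' (expNeg_ne_top x) (expNeg_ne_top y)).1 h')

section Laplace

open BoundedContinuousFunction

/-- Finite measures on a finite power of the unit interval with equal moments are equal. -/
theorem MeasureTheory.Measure.ext_of_moments {ι : Type*} [Fintype ι]
    {P P' : Measure (ι → unitInterval)} [IsFiniteMeasure P] [IsFiniteMeasure P']
    (h : ∀ k : ι → ℕ, ∫ x, ∏ i, (x i : ℝ) ^ k i ∂P = ∫ x, ∏ i, (x i : ℝ) ^ k i ∂P') : P = P' := by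
  classical
  let coord : ι → ((ι → unitInterval) →ᵇ ℝ) := fun i =>
    BoundedContinuousFunction.mkOfCompact ⟨fun x => (x i : ℝ), by fun_prop⟩
  let A₀ : Subalgebra ℝ ((ι → unitInterval) →ᵇ ℝ) := (MvPolynomial.aeval coord).range
  let A : StarSubalgebra ℝ ((ι → unitInterval) →ᵇ ℝ) :=
    { A₀ with
      star_mem' := by
        intro a ha
        have : star a = a := by ext x; simp
        rw [this]; exact ha }
  -- Polynomials in the coordinates form an algebra that separates points, and their integrals are
  -- linear combinations of moments.
  refine ext_of_forall_mem_subalgebra_integral_eq_of_polish (A := A) ?_ ?_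
  · intro x y hxy
    obtain ⟨i, hi⟩ := Function.ne_iff.1 hxy
    refine ⟨_, ⟨(coord i).toContinuousMapStarₐ ℝ, ⟨coord i, ⟨MvPolynomial.X i, ?_⟩, rfl⟩, rfl⟩, ?_⟩
    · exact MvPolynomial.aeval_X _ _
    · intro h'
      exact hi (Subtype.ext h')
  · rintro _ ⟨p, rfl⟩
    have hinteg : ∀ (R : Measure (ι → unitInterval)) [IsFiniteMeasure R]
        (g : (ι → unitInterval) →ᵇ ℝ), Integrable g R := fun R _ g => g.integrable R
    induction p using MvPolynomial.induction_on' with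
    | monomial u a =>
      have : ∀ x, (MvPolynomial.aeval coord (MvPolynomial.monomial u a)) x =
          a * ∏ i, (x i : ℝ) ^ u i := by
        intro x
        rw [MvPolynomial.aeval_monomial, Finsupp.prod_fintype _ _ (by simp)]
        simp only [coe_mul, Pi.mul_apply, coe_prod, Finset.prod_apply, coe_pow, Pi.pow_apply]
        rfl
      change ∫ x, (MvPolynomial.aeval coord (MvPolynomial.monomial u a)) x ∂P =
        ∫ x, (MvPolynomial.aeval coord (MvPolynomial.monomial u a)) x ∂P'
      simp_rw [this, integral_const_mul]
      rw [h]
    | add p q hp hq =>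
      change ∫ x, (MvPolynomial.aeval coord (p + q)) x ∂P =
        ∫ x, (MvPolynomial.aeval coord (p + q)) x ∂P'
      have hadd : ∀ x, (MvPolynomial.aeval coord (p + q)) x =
          MvPolynomial.aeval coord p x + MvPolynomial.aeval coord q x := by
        intro x
        rw [map_add]
        rfl
      simp_rw [hadd]
      rw [integral_add (hinteg P _) (hinteg P _), integral_add (hinteg P' _) (hinteg P' _)]
      exact congrArg₂ _ hp hq

/-- Finite measures are equal if the integrals of `e⁻ᶠ` agree for all `f` in a class of functions
that is closed under addition and generates the σ-algebra. -/
theorem MeasureTheory.Measure.ext_of_laplace {Ω : Type*} [m : MeasurableSpace Ω]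
    (F : Set (Ω → ℝ≥0∞)) (hF : ∀ f ∈ F, Measurable f) (h0 : (0 : Ω → ℝ≥0∞) ∈ F)
    (hadd : ∀ f ∈ F, ∀ g ∈ F, f + g ∈ F)
    (hgen : m ≤ ⨆ f : F, MeasurableSpace.comap (f : Ω → ℝ≥0∞) inferInstance)
    {P P' : Measure Ω} [IsFiniteMeasure P] [IsFiniteMeasure P']
    (h : ∀ f ∈ F, ∫⁻ ω, expNeg (f ω) ∂P = ∫⁻ ω, expNeg (f ω) ∂P') : P = P' := by
  classical
  let Φ : Ω → (F → unitInterval) := fun ω f => expNegUnit (f.1 ω)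
  have hΦ : Measurable Φ :=
    measurable_pi_lambda _ fun f => measurable_expNegUnit.comp (hF f.1 f.2)
  have hsum : ∀ (s : Finset F) (k : s → ℕ), (fun ω => ∑ i : s, k i • i.1.1 ω) ∈ F := by
    intro s k
    have : ∀ t : Finset s, (fun ω => ∑ i ∈ t, k i • i.1.1 ω) ∈ F := by
      intro t
      induction t using Finset.induction_on with
      | empty => simpa [Pi.zero_def] using h0
      | insert a t ha ih =>
        have hk : ∀ n : ℕ, (fun ω => n • a.1.1 ω) ∈ F := by
          intro n
          induction n with
          | zero => simpa [Pi.zero_def] using h0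
          | succ n ihn =>
            have := hadd _ ihn _ a.1.2
            simpa only [succ_nsmul, Pi.add_def] using this
        have := hadd _ (hk (k a)) _ ih
        simpa [Finset.sum_insert ha, Pi.add_def] using this
    exact this Finset.univ
  have hmap : P.map Φ = P'.map Φ := by
    -- A measure on the product is determined by its finite-dimensional marginals. Their mixed
    -- moments are integrals of exp(-∑ kᵢ fᵢ), and `hsum` says that these sums stay in `F`.
    have hu : IsProjectiveLimit (P.map Φ) fun s : Finset F => (P.map Φ).map s.restrict :=
      fun s => rfl
    refine hu.unique fun s => ?_
    symm
    change (P.map Φ).map s.restrict = _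
    rw [Measure.map_map (Finset.measurable_restrict s) hΦ,
      Measure.map_map (Finset.measurable_restrict s) hΦ]
    have hm : Measurable (s.restrict ∘ Φ) := (Finset.measurable_restrict s).comp hΦ
    refine Measure.ext_of_moments fun k => ?_
    rw [integral_map hm.aemeasurable, integral_map hm.aemeasurable]
    · have hcalc : ∀ ω, ∏ i, (((s.restrict ∘ Φ) ω i : unitInterval) : ℝ) ^ k i =
          (expNeg (∑ i : s, k i • i.1.1 ω)).toReal := by
        intro ω
        rw [expNeg_sum, ENNReal.toReal_prod]
        refine Finset.prod_congr rfl fun i _ => ?_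
        rw [expNeg_nsmul, ENNReal.toReal_pow]
        rfl
      simp_rw [hcalc]
      have hm2 : Measurable fun ω => expNeg (∑ i : s, k i • i.1.1 ω) :=
        measurable_expNeg.comp (hF _ (hsum s k))
      rw [integral_toReal hm2.aemeasurable (ae_of_all _ fun ω => (expNeg_ne_top _).lt_top),
        integral_toReal hm2.aemeasurable (ae_of_all _ fun ω => (expNeg_ne_top _).lt_top),
        h _ (hsum s k)]
    · exact (Continuous.aestronglyMeasurable (by fun_prop))
    · exact (Continuous.aestronglyMeasurable (by fun_prop))
  -- Passing from `f` to e⁻ᶠ loses no information, because `expNegUnit` is a measurable embedding.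
  have hle : m ≤ MeasurableSpace.comap Φ inferInstance := by
    refine hgen.trans (iSup_le fun f => ?_)
    rw [← measurableEmbedding_expNegUnit.comap_eq, MeasurableSpace.comap_comp]
    have : expNegUnit ∘ (f : Ω → ℝ≥0∞) = (fun x => x f) ∘ Φ := rfl
    rw [this, ← MeasurableSpace.comap_comp]
    exact MeasurableSpace.comap_mono (measurable_pi_apply f).comap_le
  ext A hA
  obtain ⟨B, hB, rfl⟩ := hle A hA
  rw [← Measure.map_apply hΦ hB, hmap, Measure.map_apply hΦ hB]

end Laplace

/-! ### The Laplace functional of a Poisson process -/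

theorem one_sub_expNeg_mono : Monotone fun x => 1 - expNeg x :=
  fun _ _ h => tsub_le_tsub_left (expNeg_antitone h) 1

theorem continuous_one_sub_expNeg : Continuous fun x => 1 - expNeg x :=
  (ENNReal.continuous_sub_left ENNReal.one_ne_top).comp continuous_expNeg

/-- With t = e⁻ʸ this is the generating function ∑ e⁻ˡ (l t)ⁿ / n! = exp(-l (1 - t)). The case y = ∞
is covered by t = 0, as ∞ * 0 = 0 matches t ^ 0 = 1. -/
theorem lintegral_expNeg_poissonMeasure (l : ℝ≥0) (y : ℝ≥0∞) :
    ∫⁻ n : ℕ, expNeg (y * n) ∂(poissonMeasure l) = expNeg (l * (1 - expNeg y)) := by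
  obtain ⟨t, ht⟩ : ∃ t : ℝ≥0, expNeg y = t := ⟨(expNeg y).toNNReal, by
    rw [ENNReal.coe_toNNReal (expNeg_ne_top y)]⟩
  have ht1 : t ≤ 1 := by
    have := expNeg_le_one y
    rw [ht] at this
    exact_mod_cast this
  have hn : ∀ n : ℕ, expNeg (y * n) = ENNReal.ofReal ((t : ℝ) ^ n) := by
    intro n
    rw [mul_comm, ← nsmul_eq_mul, expNeg_nsmul, ht, ENNReal.ofReal_pow t.coe_nonneg]
    simp
  have h1 : ((l : ℝ≥0∞) * (1 - expNeg y)) = ((l * (1 - t) : ℝ≥0) : ℝ≥0∞) := by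
    rw [ht]; push_cast; rfl
  rw [h1, expNeg_coe, poissonMeasure, lintegral_sum_measure]
  simp_rw [lintegral_smul_measure, lintegral_dirac, hn, smul_eq_mul]
  have h2 : ∀ n : ℕ, ENNReal.ofReal (Real.exp (-l) * (l : ℝ) ^ n / n.factorial) *
      ENNReal.ofReal ((t : ℝ) ^ n) =
      ENNReal.ofReal (Real.exp (-l) * (((l : ℝ) * t) ^ n / n.factorial)) := by
    intro n
    rw [← ENNReal.ofReal_mul (by positivity)]
    congr 1
    rw [mul_pow]; ring
  simp_rw [h2]
  have h3 := (NormedSpace.expSeries_div_hasSum_exp ((l : ℝ) * t)).mul_left (Real.exp (-l))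
  rw [← ENNReal.ofReal_tsum_of_nonneg (fun n => by positivity) h3.summable, h3.tsum_eq,
    ← Real.exp_eq_exp_ℝ, ← Real.exp_add]
  congr 2
  push_cast [NNReal.coe_sub ht1]
  ring

namespace IsPoissonLaw

variable {d : ℕ} {r : ℝ≥0} {P : Measure (PointMeasure d)}

theorem lintegral_expNeg_count (h : IsPoissonLaw r P) {A : Set (Euc d)} (hA : MeasurableSet A)
    (hfin : volume A < ∞) (y : ℝ≥0∞) :
    ∫⁻ μ, expNeg (y * μ.toMeasure A) ∂P = expNeg (r * ((1 - expNeg y) * volume A)) := by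
  have h1 := h.map_count A hA hfin
  have hm : Measurable fun x : ℝ≥0∞ => expNeg (y * x) :=
    measurable_expNeg.comp (measurable_const.mul measurable_id)
  have h2 := congrArg (fun ρ => ∫⁻ x, expNeg (y * x) ∂ρ) h1
  rw [lintegral_map hm (PointMeasure.measurable_count hA),
    lintegral_map hm (measurable_of_countable _), lintegral_expNeg_poissonMeasure] at h2
  refine h2.trans (congrArg _ ?_)
  push_cast
  rw [ENNReal.coe_toNNReal hfin.ne]
  ring

theorem iIndepFun_count {ι : Type*} [Finite ι] (h : IsPoissonLaw r P) (A : ι → Set (Euc d))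
    (hA : ∀ i, MeasurableSet (A i)) (hd : ∀ i j, i ≠ j → Disjoint (A i) (A j)) :
    iIndepFun (fun i => PointMeasure.count (A i)) P := by
  obtain ⟨n, ⟨e⟩⟩ := Finite.exists_equiv_fin ι
  have := h.indep_count n (fun i => A (e.symm i)) (fun i => hA _)
    (fun i j hij => hd _ _ (fun h => hij (e.symm.injective h)))
  have h2 := this.precomp e.injective
  simpa using h2

theorem laplace_simpleFunc (h : IsPoissonLaw r P) (g : SimpleFunc (Euc d) ℝ≥0∞)
    (hg : ∀ y ≠ 0, volume (g ⁻¹' {y}) < ∞) :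
    ∫⁻ μ, expNeg (∫⁻ x, g x ∂μ.toMeasure) ∂P = expNeg (r * ∫⁻ x, (1 - expNeg (g x))) := by
  have := h.isProbabilityMeasure
  -- The value 0 is left out, since its level set has infinite volume; the integrands in question
  -- vanish there.
  have hsum : ∀ (k : ℝ≥0∞ → ℝ≥0∞) (ρ : Measure (Euc d)), k 0 = 0 →
      ∫⁻ x, k (g x) ∂ρ = ∑ y : (g.range.filter (· ≠ 0) : Finset ℝ≥0∞), k y * ρ (g ⁻¹' {y.1}) := by
    intro k ρ hk
    have h1 : ∫⁻ x, k (g x) ∂ρ = (g.map k).lintegral ρ := by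
      rw [← SimpleFunc.lintegral_eq_lintegral]; rfl
    rw [h1, SimpleFunc.map_lintegral]
    rw [Finset.univ_eq_attach, Finset.sum_attach _ (fun y => k y * ρ (g ⁻¹' {y}))]
    rw [Finset.sum_filter_of_ne]
    intro y _ hy hy0
    rw [hy0, hk, zero_mul] at hy
    exact hy rfl
  have h1 : ∀ μ : PointMeasure d, ∫⁻ x, g x ∂μ.toMeasure =
      ∑ y : (g.range.filter (· ≠ 0) : Finset ℝ≥0∞), y.1 * μ.toMeasure (g ⁻¹' {y.1}) :=
    fun μ => hsum id μ.toMeasure rfl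
  rw [hsum (fun y => 1 - expNeg y) volume (by simp)]
  simp_rw [h1, expNeg_sum, Finset.mul_sum, expNeg_sum]
  have hind := h.iIndepFun_count (fun y : (g.range.filter (· ≠ 0) : Finset ℝ≥0∞) => g ⁻¹' {y.1})
    (fun y => g.measurableSet_preimage _) (by
      intro i j hij
      refine Disjoint.preimage _ ?_
      rw [Set.disjoint_singleton]
      exact fun h => hij (Subtype.ext h))
  have hind2 := hind.comp (fun y x => expNeg (y.1 * x))
    (fun y => measurable_expNeg.comp (measurable_const.mul measurable_id))
  have h3 := lintegral_prod_eq_prod_lintegral_of_indepFun Finset.univ _ hind2 (fun y =>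
    (measurable_expNeg.comp (measurable_const.mul measurable_id)).comp
      (PointMeasure.measurable_count (g.measurableSet_preimage _)))
  refine h3.trans (Finset.prod_congr rfl fun y _ => ?_)
  exact h.lintegral_expNeg_count (g.measurableSet_preimage _)
    (hg _ (Finset.mem_filter.1 y.2).2) y.1

theorem measurable_lintegral {f : Euc d → ℝ≥0∞} (hf : Measurable f) :
    Measurable fun μ : PointMeasure d => ∫⁻ x, f x ∂μ.toMeasure :=
  (Measure.measurable_lintegral hf).comp PointMeasure.measurable_toMeasure

/-- The Laplace functional of a Poisson point process. -/
theorem laplace (h : IsPoissonLaw r P) {f : Euc d → ℝ≥0∞} (hf : Measurable f) :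
    ∫⁻ μ, expNeg (∫⁻ x, f x ∂μ.toMeasure) ∂P = expNeg (r * ∫⁻ x, (1 - expNeg (f x))) := by
  have := h.isProbabilityMeasure
  -- Cutting off at the ball of radius `n` gives nonzero values level sets of finite volume, and
  -- both sides converge monotonically in `n`.
  let g : ℕ → SimpleFunc (Euc d) ℝ≥0∞ := fun n =>
    (SimpleFunc.eapprox f n).restrict (Metric.ball 0 n)
  have hgapp : ∀ n x, g n x = (Metric.ball (0 : Euc d) n).indicator (SimpleFunc.eapprox f n) x :=
    fun n x => SimpleFunc.restrict_apply _ measurableSet_ball x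
  have hmono : ∀ x, Monotone fun n => g n x := by
    intro x m n hmn
    simp only [hgapp]
    refine (Set.indicator_le_indicator_of_subset
      (Metric.ball_subset_ball (by exact_mod_cast hmn)) (fun _ => zero_le) x).trans
      (Set.indicator_le_indicator (SimpleFunc.monotone_eapprox f hmn x))
  have hlim : ∀ x, Tendsto (fun n => g n x) atTop (𝓝 (f x)) := by
    intro x
    refine (SimpleFunc.tendsto_eapprox hf x).congr' ?_
    obtain ⟨N, hN⟩ := exists_nat_gt ‖x‖
    filter_upwards [eventually_ge_atTop N] with n hn
    rw [hgapp, Set.indicator_of_mem]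
    rw [mem_ball_zero_iff]
    exact hN.trans_le (by exact_mod_cast hn)
  have hg : ∀ n, ∀ y ≠ 0, volume (g n ⁻¹' {y}) < ∞ := by
    intro n y hy
    refine lt_of_le_of_lt (measure_mono ?_) (measure_ball_lt_top (x := (0 : Euc d)) (r := n))
    intro x hx
    by_contra hx'
    have : g n x = y := hx
    rw [hgapp, Set.indicator_of_notMem hx'] at this
    exact hy this.symm
  have h1 : ∀ n, _ := fun n => h.laplace_simpleFunc (g n) (hg n)
  have hL : Tendsto (fun n => ∫⁻ μ, expNeg (∫⁻ x, g n x ∂μ.toMeasure) ∂P) atTop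
      (𝓝 (∫⁻ μ, expNeg (∫⁻ x, f x ∂μ.toMeasure) ∂P)) := by
    refine lintegral_tendsto_of_tendsto_of_antitone
      (fun n => (measurable_expNeg.comp (measurable_lintegral (g n).measurable)).aemeasurable)
      (ae_of_all _ fun μ m n hmn => ?_) ?_ (ae_of_all _ fun μ => ?_)
    · exact expNeg_antitone (lintegral_mono fun x => hmono x hmn)
    · refine ne_top_of_le_ne_top ENNReal.one_ne_top ?_
      refine (lintegral_mono fun μ => expNeg_le_one _).trans ?_
      simp
    · refine (continuous_expNeg.tendsto _).comp ?_
      exact lintegral_tendsto_of_tendsto_of_monotone (fun n => (g n).measurable.aemeasurable)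
        (ae_of_all _ hmono) (ae_of_all _ hlim)
  have hR : Tendsto (fun n => expNeg (r * ∫⁻ x, (1 - expNeg (g n x)))) atTop
      (𝓝 (expNeg (r * ∫⁻ x, (1 - expNeg (f x))))) := by
    refine (continuous_expNeg.tendsto _).comp ?_
    refine ENNReal.Tendsto.const_mul ?_ (Or.inr ENNReal.coe_ne_top)
    refine lintegral_tendsto_of_tendsto_of_monotone
      (fun n => (continuous_one_sub_expNeg.measurable.comp (g n).measurable).aemeasurable)
      (ae_of_all _ fun x m n hmn => one_sub_expNeg_mono (hmono x hmn))
      (ae_of_all _ fun x => (continuous_one_sub_expNeg.tendsto _).comp (hlim x))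
  simp_rw [h1] at hL
  exact tendsto_nhds_unique hL hR

end IsPoissonLaw

/-- The class of the functions `μ ↦ ∫ f dμ`. -/
def linearFunctionals (d : ℕ) : Set (PointMeasure d → ℝ≥0∞) :=
  {F | ∃ f : Euc d → ℝ≥0∞, Measurable f ∧ F = fun μ => ∫⁻ x, f x ∂μ.toMeasure}

namespace PointMeasure

variable {d : ℕ}

theorem le_iSup_comap_linearFunctionals :
    (inferInstance : MeasurableSpace (PointMeasure d)) ≤
      ⨆ F : linearFunctionals d, MeasurableSpace.comap (F : PointMeasure d → ℝ≥0∞) inferInstance := by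
  have h : @Measurable _ _ (⨆ F : linearFunctionals d, MeasurableSpace.comap
      (F : PointMeasure d → ℝ≥0∞) inferInstance) inferInstance (id : PointMeasure d → _) := by
    refine @measurable_of_count d _ (⨆ F : linearFunctionals d, MeasurableSpace.comap
      (F : PointMeasure d → ℝ≥0∞) inferInstance) _ fun A hA => ?_
    refine Measurable.mono (comap_measurable _) (le_iSup (fun F : linearFunctionals d =>
      MeasurableSpace.comap (F : PointMeasure d → ℝ≥0∞) inferInstance)
      ⟨fun μ => μ.toMeasure A, A.indicator 1, measurable_one.indicator hA, ?_⟩) le_rfl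
    funext μ
    rw [lintegral_indicator_one hA]
  exact measurable_iff_le_map.1 h

/-- A finite measure on the space of point measures is determined by its Laplace functional. -/
theorem ext_of_laplace {P P' : Measure (PointMeasure d)} [IsFiniteMeasure P] [IsFiniteMeasure P']
    (h : ∀ f : Euc d → ℝ≥0∞, Measurable f →
      ∫⁻ μ, expNeg (∫⁻ x, f x ∂μ.toMeasure) ∂P = ∫⁻ μ, expNeg (∫⁻ x, f x ∂μ.toMeasure) ∂P') :
    P = P' := by
  refine Measure.ext_of_laplace (linearFunctionals d) ?_ ⟨0, measurable_zero, by
    funext μ; simp⟩ ?_ le_iSup_comap_linearFunctionals ?_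
  · rintro _ ⟨f, hf, rfl⟩
    exact IsPoissonLaw.measurable_lintegral hf
  · rintro _ ⟨f, hf, rfl⟩ _ ⟨g, hg, rfl⟩
    refine ⟨f + g, hf.add hg, ?_⟩
    funext μ
    exact (lintegral_add_left hf g).symm
  · rintro _ ⟨f, hf, rfl⟩
    exact h f hf

end PointMeasure

namespace IsPoissonLaw

variable {d : ℕ} {r : ℝ≥0} {P : Measure (PointMeasure d)}

theorem unique {P' : Measure (PointMeasure d)} (h : IsPoissonLaw r P) (h' : IsPoissonLaw r P') :
    P = P' := by
  have := h.isProbabilityMeasure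
  have := h'.isProbabilityMeasure
  refine PointMeasure.ext_of_laplace fun f hf => ?_
  rw [h.laplace hf, h'.laplace hf]

theorem ae_locFin (h : IsPoissonLaw r P) : ∀ᵐ μ ∂P, LocFin μ.supp := by
  simp_rw [PointMeasure.locFin_supp_iff]
  rw [ae_all_iff]
  intro n
  have h1 := h.map_count _ (measurableSet_ball (x := (0 : Euc d)) (ε := n)) measure_ball_lt_top
  have h2 : ∀ᵐ x ∂(P.map (PointMeasure.count (Metric.ball (0 : Euc d) n))), x < ∞ := by
    rw [h1, ae_map_iff (measurable_of_countable _).aemeasurable measurableSet_Iio]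
    exact ae_of_all _ fun n => ENNReal.natCast_lt_top n
  exact ae_of_ae_map (PointMeasure.measurable_count measurableSet_ball).aemeasurable h2

theorem ae_notMem (h : IsPoissonLaw r P) (hd : 1 ≤ d) (x : Euc d) : ∀ᵐ μ ∂P, x ∉ μ.supp := by
  have : Nonempty (Fin d) := ⟨⟨0, hd⟩⟩
  have h0 : volume ({x} : Set (Euc d)) = 0 := measure_singleton x
  have h1 := h.map_count {x} (measurableSet_singleton x) (by simp [h0])
  have h2 : ∀ᵐ y ∂(P.map (PointMeasure.count {x})), y = 0 := by
    rw [h1, ae_map_iff (p := fun y : ℝ≥0∞ => y = 0) (measurable_of_countable _).aemeasurable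
      (measurableSet_singleton 0), h0]
    rw [ae_iff, poissonMeasure]
    simp only [Nat.cast_eq_zero, ENNReal.toNNReal_zero, mul_zero]
    rw [Measure.sum_apply _ (by measurability), ENNReal.tsum_eq_zero]
    intro n
    rcases n with _ | n <;> simp
  have h3 := ae_of_ae_map (PointMeasure.measurable_count (measurableSet_singleton x)).aemeasurable h2
  filter_upwards [h3] with μ hμ hx
  exact hx hμ

end IsPoissonLaw

/-! ### Measurability of images, unions and added points -/

namespace PointMeasure

variable {d : ℕ} {Ω : Type*} [MeasurableSpace Ω]

theorem measurable_ofSet_of_encard {T : Ω → Set (Euc d)} (hc : ∀ ω, (T ω).Countable)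
    (h : ∀ A, MeasurableSet A → Measurable fun ω => ((T ω ∩ A).encard : ℝ≥0∞)) :
    Measurable fun ω => ofSet (T ω) := by
  refine measurable_of_count fun A hA => ?_
  simp_rw [toMeasure_ofSet (hc _), sumDirac_apply hA]
  exact h A hA

/-- Injectivity turns the number of image points in `A` into a sum over the original points. -/
theorem measurable_encard_image {Z : Ω → PointMeasure d} (hZ : Measurable Z)
    {p : Ω → Euc d → Prop} (hp : MeasurableSet {q : Ω × Euc d | p q.1 q.2})
    {f : Ω → Euc d → Euc d} (hf : Measurable fun q : Ω × Euc d => f q.1 q.2)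
    (hinj : ∀ ω, Set.InjOn (f ω) {x | x ∈ (Z ω).pts ∧ p ω x})
    {A : Set (Euc d)} (hA : MeasurableSet A) :
    Measurable fun ω => ((f ω '' {x | x ∈ (Z ω).pts ∧ p ω x} ∩ A).encard : ℝ≥0∞) := by
  classical
  have h := measurable_tsum_pts hZ (f := fun ω x => if p ω x ∧ f ω x ∈ A then 1 else 0)
    (Measurable.ite (hp.inter (hf hA)) measurable_const measurable_const)
  convert h using 2 with ω
  have h1 : f ω '' {x | x ∈ (Z ω).pts ∧ p ω x} ∩ A =
      f ω '' {x | x ∈ (Z ω).pts ∧ p ω x ∧ f ω x ∈ A} := by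
    ext z
    constructor
    · rintro ⟨⟨x, hx, rfl⟩, hz⟩
      exact ⟨x, ⟨hx.1, hx.2, hz⟩, rfl⟩
    · rintro ⟨x, hx, rfl⟩
      exact ⟨⟨x, ⟨hx.1, hx.2.1⟩, rfl⟩, hx.2.2⟩
  have hs : {x | x ∈ (Z ω).pts ∧ p ω x ∧ f ω x ∈ A} ⊆ {x | x ∈ (Z ω).pts ∧ p ω x} :=
    fun x hx => ⟨hx.1, hx.2.1⟩
  rw [h1, Set.InjOn.encard_image ((hinj ω).mono hs),
    ← ENNReal.tsum_set_one, tsum_subtype _ (fun _ => (1 : ℝ≥0∞)),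
    tsum_subtype (Z ω).pts (fun x => if p ω x ∧ f ω x ∈ A then (1 : ℝ≥0∞) else 0)]
  refine tsum_congr fun x => ?_
  by_cases h1 : x ∈ (Z ω).pts <;> by_cases h2 : p ω x ∧ f ω x ∈ A <;>
    simp [Set.indicator, h1, h2]

theorem measurable_ofSet_image {Z : Ω → PointMeasure d} (hZ : Measurable Z)
    {p : Ω → Euc d → Prop} (hp : MeasurableSet {q : Ω × Euc d | p q.1 q.2})
    {f : Ω → Euc d → Euc d} (hf : Measurable fun q : Ω × Euc d => f q.1 q.2)
    (hinj : ∀ ω, Set.InjOn (f ω) {x | x ∈ (Z ω).pts ∧ p ω x}) :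
    Measurable fun ω => ofSet (f ω '' {x | x ∈ (Z ω).pts ∧ p ω x}) :=
  measurable_ofSet_of_encard
    (fun ω => ((Z ω).countable_pts.mono fun _ hx => hx.1).image _)
    fun _ hA => measurable_encard_image hZ hp hf hinj hA

theorem measurable_ofSet_union {T U : Ω → Set (Euc d)} (hTc : ∀ ω, (T ω).Countable)
    (hUc : ∀ ω, (U ω).Countable) (hd : ∀ ω, Disjoint (T ω) (U ω))
    (hT : Measurable fun ω => ofSet (T ω)) (hU : Measurable fun ω => ofSet (U ω)) :
    Measurable fun ω => ofSet (T ω ∪ U ω) := by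
  refine measurable_ofSet_of_encard (fun ω => (hTc ω).union (hUc ω)) fun A hA => ?_
  have h1 := ((measurable_count hA).comp hT).add ((measurable_count hA).comp hU)
  convert h1 using 2 with ω
  simp only [Pi.add_apply, Function.comp_apply, count, toMeasure_ofSet (hTc ω),
    toMeasure_ofSet (hUc ω), sumDirac_apply hA]
  rw [Set.union_inter_distrib_right, Set.encard_union_eq]
  · simp
  · exact (hd ω).mono Set.inter_subset_left Set.inter_subset_left

theorem measurable_ofSet_const (S : Ω → Euc d) (hS : Measurable S) :
    Measurable fun ω => ofSet ({S ω} : Set (Euc d)) := by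
  classical
  refine measurable_of_count fun A hA => ?_
  simp_rw [toMeasure_ofSet (Set.countable_singleton _)]
  have : ∀ ω, sumDirac {S ω} A = if S ω ∈ A then 1 else 0 := by
    intro ω
    rw [sumDirac_apply hA]
    by_cases h : S ω ∈ A
    · have : {S ω} ∩ A = {S ω} := by simpa using h
      simp [h, this]
    · have : {S ω} ∩ A = ∅ := by simpa using h
      simp [h, this]
  simp_rw [this]
  exact Measurable.ite (hS hA) measurable_const measurable_const

/-- Add a point to (the locally finite part of) a point measure. -/
def addPt (x : Euc d) (μ : PointMeasure d) : PointMeasure d := ofSet (insert x μ.pts)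

theorem locFin_insert {S : Set (Euc d)} (h : LocFin S) (x : Euc d) : LocFin (insert x S) := by
  intro n
  refine ((h n).insert x).subset ?_
  rintro y ⟨rfl | hy, hy'⟩
  · exact Set.mem_insert _ _
  · exact Set.mem_insert_of_mem _ ⟨hy, hy'⟩

theorem pts_addPt (x : Euc d) (μ : PointMeasure d) : (addPt x μ).pts = insert x μ.pts :=
  pts_ofSet (locFin_insert μ.locFin_pts x)

theorem measurableSet_mem_pts {Z : Ω → PointMeasure d} (hZ : Measurable Z) {f : Ω → Euc d}
    (hf : Measurable f) : MeasurableSet {ω | f ω ∈ (Z ω).pts} := by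
  have := measurableSet_exists_pts hZ (p := fun ω x => x = f ω)
    (measurableSet_eq_fun measurable_snd (hf.comp measurable_fst))
  simpa using this

theorem measurable_addPt : Measurable fun q : Euc d × PointMeasure d => addPt q.1 q.2 := by
  have h : ∀ q : Euc d × PointMeasure d, insert q.1 q.2.pts =
      {q.1} ∪ (fun x => x) '' {x | x ∈ q.2.pts ∧ x ≠ q.1} := by
    intro q
    ext x
    by_cases h : x = q.1 <;> simp [h]
  unfold addPt
  simp_rw [h]
  refine measurable_ofSet_union (fun _ => Set.countable_singleton _)
    (fun q => (q.2.countable_pts.mono fun x hx => hx.1).image _) ?_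
    (measurable_ofSet_const _ measurable_fst) ?_
  · intro q
    simp
  · exact measurable_ofSet_image (Z := fun q : Euc d × PointMeasure d => q.2) measurable_snd
      (p := fun q x => x ≠ q.1) (f := fun _ x => x)
      (measurableSet_eq_fun measurable_snd (measurable_fst.comp measurable_fst)).compl
      measurable_snd (fun q => fun x _ y _ h => h)

end PointMeasure

/-! ### Palm measures and the Mecke formula -/

theorem tendsto_two_pow_mul {φ : ℝ → ℝ} {b : ℝ} (hφ : HasDerivAt φ b 0) (h0 : φ 0 = 0) :
    Tendsto (fun n : ℕ => (2 : ℝ) ^ n * φ ((2 ^ n)⁻¹)) atTop (𝓝 b) := by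
  have h1 := hφ.tendsto_slope_zero
  have h2 : Tendsto (fun n : ℕ => ((2 : ℝ) ^ n)⁻¹) atTop (𝓝[≠] 0) := by
    refine tendsto_nhdsWithin_iff.2 ⟨?_, ?_⟩
    · exact tendsto_inv_atTop_zero.comp (tendsto_pow_atTop_atTop_of_one_lt (by norm_num))
    · filter_upwards with n
      simp
  have := h1.comp h2
  simpa [Function.comp_def, h0] using this

theorem one_sub_expNeg_coe (x : ℝ≥0) : 1 - expNeg x = ENNReal.ofReal (1 - Real.exp (-x)) := by
  rw [expNeg_coe, ENNReal.ofReal_sub _ (Real.exp_pos _).le, ENNReal.ofReal_one]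

/-- Difference quotients at 0 are taken along the dyadic steps 2⁻ⁿ because halving reduces
monotonicity to 1 - e² ≤ 2 (1 - e). Monotone convergence then differentiates under the integral
without any integrability assumption. -/
theorem monotone_two_pow_mul_one_sub_expNeg (a : ℝ≥0∞) :
    Monotone fun n : ℕ => (2 : ℝ≥0∞) ^ n * (1 - expNeg (a / 2 ^ n)) := by
  refine monotone_nat_of_le_succ fun n => ?_
  set e := expNeg (a / 2 ^ (n + 1)) with he
  have h1 : expNeg (a / 2 ^ n) = e * e := by
    rw [he, ← expNeg_add]
    congr 1
    have h3 : a / 2 ^ (n + 1) = a / 2 ^ n / 2 := by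
      rw [pow_succ, div_eq_mul_inv, div_eq_mul_inv, div_eq_mul_inv,
        ENNReal.mul_inv (Or.inr (by simp)) (Or.inr (by simp)), mul_assoc]
    rw [h3, ENNReal.add_halves]
  have h2 : 1 - e * e ≤ 2 * (1 - e) := by
    have he1 : e ≤ 1 := expNeg_le_one _
    rw [tsub_le_iff_right]
    calc (1 : ℝ≥0∞) = (1 - e) + e * 1 := by rw [mul_one, tsub_add_cancel_of_le he1]
      _ = (1 - e) + e * ((1 - e) + e) := by rw [tsub_add_cancel_of_le he1]
      _ = (1 - e) + e * (1 - e) + e * e := by ring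
      _ ≤ (1 - e) + 1 * (1 - e) + e * e := by gcongr
      _ = 2 * (1 - e) + e * e := by ring
  rw [h1, pow_succ, mul_assoc]
  gcongr

theorem tendsto_two_pow_mul_one_sub_expNeg (a : ℝ≥0∞) :
    Tendsto (fun n : ℕ => (2 : ℝ≥0∞) ^ n * (1 - expNeg (a / 2 ^ n))) atTop (𝓝 a) := by
  by_cases ha : a = ∞
  · subst ha
    have : ∀ n : ℕ, (2 : ℝ≥0∞) ^ n * (1 - expNeg (∞ / 2 ^ n)) = 2 ^ n := by
      intro n
      rw [ENNReal.top_div_of_ne_top (by simp)]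
      simp
    simp_rw [this]
    exact ENNReal.tendsto_pow_atTop_nhds_top_iff.2 (by norm_num)
  lift a to ℝ≥0 using ha
  have hd : HasDerivAt (fun t : ℝ => 1 - Real.exp (-(a * t))) a 0 := by
    have := (((hasDerivAt_id (0 : ℝ)).const_mul (a : ℝ)).neg.exp).const_sub 1
    simpa using this
  have h1 := tendsto_two_pow_mul hd (by simp)
  have h2 := ENNReal.tendsto_ofReal h1
  rw [ENNReal.ofReal_coe_nnreal] at h2
  refine h2.congr fun n => ?_
  rw [ENNReal.ofReal_mul (by positivity), ENNReal.ofReal_pow (by norm_num)]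
  have : (a : ℝ≥0∞) / 2 ^ n = ((a / 2 ^ n : ℝ≥0) : ℝ≥0∞) := by
    rw [ENNReal.coe_div (by positivity)]; simp
  rw [this, one_sub_expNeg_coe]
  simp [div_eq_mul_inv]

theorem tendsto_two_pow_mul_one_sub_expNeg_mul (b : ℝ≥0) :
    Tendsto (fun n : ℕ => (2 : ℝ≥0∞) ^ n * (1 - expNeg (b * (1 - expNeg (1 / 2 ^ n)))))
      atTop (𝓝 b) := by
  have hd : HasDerivAt (fun t : ℝ => 1 - Real.exp (-(b * (1 - Real.exp (-t))))) b 0 := by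
    have := ((((hasDerivAt_id (0 : ℝ)).neg.exp).const_sub 1).const_mul (b : ℝ)).neg.exp.const_sub 1
    simpa using this
  have h1 := tendsto_two_pow_mul hd (by simp)
  have h2 := ENNReal.tendsto_ofReal h1
  rw [ENNReal.ofReal_coe_nnreal] at h2
  refine h2.congr fun n => ?_
  rw [ENNReal.ofReal_mul (by positivity), ENNReal.ofReal_pow (by norm_num)]
  have h3 : (1 : ℝ≥0∞) / 2 ^ n = ((1 / 2 ^ n : ℝ≥0) : ℝ≥0∞) := by
    rw [ENNReal.coe_div (by positivity)]; simp
  have h5 : (0 : ℝ) ≤ 1 - Real.exp (-((1 / 2 ^ n : ℝ≥0) : ℝ)) := by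
    rw [sub_nonneg, Real.exp_le_one_iff]; simp
  have h4 : (b : ℝ≥0∞) * (1 - expNeg (1 / 2 ^ n)) =
      ((b * (1 - Real.exp (-((1 / 2 ^ n : ℝ≥0) : ℝ))).toNNReal : ℝ≥0) : ℝ≥0∞) := by
    rw [h3, one_sub_expNeg_coe]; push_cast; rfl
  rw [h4, one_sub_expNeg_coe]
  rw [NNReal.coe_mul, Real.coe_toNNReal _ h5]
  simp

namespace IsPoissonLaw

open PointMeasure

variable {d : ℕ} {r : ℝ≥0} {P : Measure (PointMeasure d)}

theorem lintegral_toMeasure_of_locFin {μ : PointMeasure d} (h : LocFin μ.supp)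
    (f : Euc d → ℝ≥0∞) : ∫⁻ x, f x ∂μ.toMeasure = ∑' x : μ.pts, f x := by
  rw [toMeasure_eq, lintegral_sumDirac, pts_eq_supp h]

theorem lintegral_addPt {μ : PointMeasure d} (h : LocFin μ.supp) {x : Euc d} (hx : x ∉ μ.supp)
    (f : Euc d → ℝ≥0∞) :
    ∫⁻ y, f y ∂(addPt x μ).toMeasure = f x + ∫⁻ y, f y ∂μ.toMeasure := by
  have h1 : (addPt x μ).toMeasure = Measure.dirac x + μ.toMeasure := by
    rw [addPt, toMeasure_ofSet (locFin_insert μ.locFin_pts x).countable, pts_eq_supp h]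
    ext A hA
    rw [sumDirac_apply hA, Measure.add_apply, toMeasure_eq, sumDirac_apply hA,
      Measure.dirac_apply' _ hA]
    by_cases hxA : x ∈ A
    · rw [Set.insert_inter_of_mem hxA, Set.encard_insert_of_notMem (fun h => hx h.1)]
      simp [hxA, add_comm]
    · rw [Set.insert_inter_of_notMem hxA]
      simp [hxA]
  rw [h1, lintegral_add_measure, lintegral_dirac]

/-- The Laplace functional of the Palm measure of a bounded set. -/
theorem lintegral_count_mul_expNeg (h : IsPoissonLaw r P) {A : Set (Euc d)} (hA : MeasurableSet A)
    (hfin : volume A < ∞) {f : Euc d → ℝ≥0∞} (hf : Measurable f) :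
    ∫⁻ μ, μ.toMeasure A * expNeg (∫⁻ x, f x ∂μ.toMeasure) ∂P =
      (∫⁻ μ, expNeg (∫⁻ x, f x ∂μ.toMeasure) ∂P) * (r * ∫⁻ x in A, expNeg (f x)) := by
  have := h.isProbabilityMeasure
  set L := ∫⁻ μ, expNeg (∫⁻ x, f x ∂μ.toMeasure) ∂P with hL
  have hLtop : L ≠ ∞ := by
    refine ne_top_of_le_ne_top ENNReal.one_ne_top ?_
    refine (lintegral_mono fun μ => expNeg_le_one _).trans ?_
    simp
  have hmf : Measurable fun μ : PointMeasure d => expNeg (∫⁻ x, f x ∂μ.toMeasure) :=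
    measurable_expNeg.comp (measurable_lintegral hf)
  set I := ∫⁻ x in A, expNeg (f x) with hI
  have hItop : I ≠ ∞ := by
    refine ne_top_of_le_ne_top hfin.ne ?_
    refine (lintegral_mono fun x => expNeg_le_one _).trans ?_
    simp
  -- The Laplace functional is evaluated at `f` plus `t` times the indicator of `A`; its derivative
  -- at t = 0 brings down the factor `μ.toMeasure A`.
  have hstep : ∀ t : ℝ≥0∞, t ≠ ∞ →
      ∫⁻ μ, expNeg (μ.toMeasure A * t) * expNeg (∫⁻ x, f x ∂μ.toMeasure) ∂P =
      L * expNeg (r * I * (1 - expNeg t)) := by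
    intro t ht
    have hft : Measurable fun x => A.indicator (fun _ => t) x + f x :=
      (measurable_const.indicator hA).add hf
    have h1 := h.laplace hft
    have h2 : ∀ μ : PointMeasure d, expNeg (∫⁻ x, (A.indicator (fun _ => t) x + f x) ∂μ.toMeasure) =
        expNeg (μ.toMeasure A * t) * expNeg (∫⁻ x, f x ∂μ.toMeasure) := by
      intro μ
      rw [lintegral_add_left (measurable_const.indicator hA), lintegral_indicator_const hA,
        expNeg_add, mul_comm t]
    simp_rw [h2] at h1
    rw [h1]
    have h3 : ∀ x, 1 - expNeg (A.indicator (fun _ => t) x + f x) =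
        (1 - expNeg (f x)) + A.indicator (fun x => expNeg (f x) * (1 - expNeg t)) x := by
      intro x
      by_cases hx : x ∈ A
      · rw [Set.indicator_of_mem hx, Set.indicator_of_mem hx, expNeg_add]
        have he := expNeg_le_one (f x)
        have he' := expNeg_le_one t
        have h4 : expNeg t * expNeg (f x) ≤ 1 := mul_le_one' he' he
        refine ENNReal.sub_eq_of_eq_add (ENNReal.mul_ne_top (expNeg_ne_top _) (expNeg_ne_top _)) ?_
        rw [add_assoc, mul_comm (expNeg t), ← mul_add, tsub_add_cancel_of_le he', mul_one,
          tsub_add_cancel_of_le he]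
      · simp [hx]
    have h5 : ∫⁻ x, (1 - expNeg (A.indicator (fun _ => t) x + f x)) =
        (∫⁻ x, (1 - expNeg (f x))) + I * (1 - expNeg t) := by
      simp_rw [h3]
      have hm1 : Measurable fun x => 1 - expNeg (f x) :=
        continuous_one_sub_expNeg.measurable.comp hf
      have hm2 : Measurable fun x => expNeg (f x) := measurable_expNeg.comp hf
      rw [lintegral_add_left hm1, lintegral_indicator hA, lintegral_mul_const _ hm2]
    rw [h5, mul_add, expNeg_add, ← h.laplace hf, ← mul_assoc]
  have hcount := measurable_count hA
  have hlim1 : Tendsto (fun n : ℕ => ∫⁻ μ, ((2 : ℝ≥0∞) ^ n *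
      (1 - expNeg (μ.toMeasure A / 2 ^ n))) * expNeg (∫⁻ x, f x ∂μ.toMeasure) ∂P) atTop
      (𝓝 (∫⁻ μ, μ.toMeasure A * expNeg (∫⁻ x, f x ∂μ.toMeasure) ∂P)) := by
    refine lintegral_tendsto_of_tendsto_of_monotone (fun n => Measurable.aemeasurable ?_)
      (ae_of_all _ fun μ m n hmn => ?_) (ae_of_all _ fun μ => ?_)
    · refine (measurable_const.mul ?_).mul hmf
      exact continuous_one_sub_expNeg.measurable.comp (hcount.div_const _)
    · exact mul_le_mul_left (monotone_two_pow_mul_one_sub_expNeg _ hmn) _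
    · exact ENNReal.Tendsto.mul_const (tendsto_two_pow_mul_one_sub_expNeg _)
        (Or.inr (expNeg_ne_top _))
  have hlim2 : Tendsto (fun n : ℕ => L * ((2 : ℝ≥0∞) ^ n *
      (1 - expNeg (((r * I.toNNReal : ℝ≥0) : ℝ≥0∞) * (1 - expNeg (1 / 2 ^ n)))))) atTop
      (𝓝 (L * ((r * I.toNNReal : ℝ≥0) : ℝ≥0∞))) :=
    ENNReal.Tendsto.const_mul (tendsto_two_pow_mul_one_sub_expNeg_mul _) (Or.inr hLtop)
  have hrI : ((r * I.toNNReal : ℝ≥0) : ℝ≥0∞) = r * I := by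
    rw [ENNReal.coe_mul, ENNReal.coe_toNNReal hItop]
  rw [hrI] at hlim2
  -- The two limits are the derivatives at 0 of the two sides of `hstep`, taken along t = 2⁻ⁿ.
  refine tendsto_nhds_unique hlim1 (hlim2.congr fun n => ?_)
  have hsub : ∀ μ : PointMeasure d, ((2 : ℝ≥0∞) ^ n *
      (1 - expNeg (μ.toMeasure A / 2 ^ n))) * expNeg (∫⁻ x, f x ∂μ.toMeasure) =
      2 ^ n * (expNeg (∫⁻ x, f x ∂μ.toMeasure) - expNeg (μ.toMeasure A * (1 / 2 ^ n)) *
        expNeg (∫⁻ x, f x ∂μ.toMeasure)) := by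
    intro μ
    rw [mul_assoc, ENNReal.sub_mul (fun _ _ => expNeg_ne_top _), one_mul, mul_one_div]
  simp_rw [hsub]
  have hm2 : Measurable fun μ : PointMeasure d => expNeg (μ.toMeasure A * (1 / 2 ^ n)) :=
    measurable_expNeg.comp (hcount.mul_const _)
  have hle : ∀ μ : PointMeasure d, expNeg (μ.toMeasure A * (1 / 2 ^ n)) *
      expNeg (∫⁻ x, f x ∂μ.toMeasure) ≤ expNeg (∫⁻ x, f x ∂μ.toMeasure) := by
    intro μ
    calc _ ≤ 1 * expNeg (∫⁻ x, f x ∂μ.toMeasure) := by gcongr; exact expNeg_le_one _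
      _ = _ := one_mul _
  have hm3 : Measurable fun μ : PointMeasure d => expNeg (μ.toMeasure A * (1 / 2 ^ n)) *
      expNeg (∫⁻ x, f x ∂μ.toMeasure) := hm2.mul hmf
  have hm4 : Measurable fun μ : PointMeasure d => expNeg (∫⁻ x, f x ∂μ.toMeasure) -
      expNeg (μ.toMeasure A * (1 / 2 ^ n)) * expNeg (∫⁻ x, f x ∂μ.toMeasure) := hmf.sub hm3
  rw [lintegral_const_mul _ hm4, lintegral_sub hm3 ?_ (ae_of_all _ hle), hstep _ (by simp), ← hL]
  · rw [mul_left_comm, ENNReal.mul_sub (fun _ _ => hLtop), mul_one]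
  · exact ne_top_of_le_ne_top hLtop (lintegral_mono hle)

/-- The Mecke formula. -/
theorem mecke (h : IsPoissonLaw r P) (hd : 1 ≤ d) {f : Euc d → PointMeasure d → ℝ≥0∞}
    (hf : Measurable fun q : Euc d × PointMeasure d => f q.1 q.2) :
    ∫⁻ μ, ∑' x : μ.pts, f x μ ∂P = r * ∫⁻ x, ∫⁻ μ, f x (addPt x μ) ∂P := by
  have := h.isProbabilityMeasure
  have hadd : Measurable fun q : Euc d × PointMeasure d => (q.1, addPt q.1 q.2) :=
    measurable_fst.prodMk measurable_addPt
  -- Both sides are integrals against measures on pairs of a point and a configuration. These are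
  -- compared on rectangles `A ×ˢ B`: for fixed `A` of finite volume their traces `K₁` and `K₂` are
  -- finite measures with equal Laplace functionals.
  let C₁ : Measure (Euc d × PointMeasure d) := (P ⊗ₘ ptsKernel d).map Prod.swap
  let C₂ : Measure (Euc d × PointMeasure d) :=
    (r : ℝ≥0∞) • ((volume : Measure (Euc d)).prod P).map fun q => (q.1, addPt q.1 q.2)
  have hC₁ : ∀ g : Euc d × PointMeasure d → ℝ≥0∞, Measurable g →
      ∫⁻ q, g q ∂C₁ = ∫⁻ μ, ∑' x : μ.pts, g (x, μ) ∂P := by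
    intro g hg
    have hg' : Measurable fun q : PointMeasure d × Euc d => g q.swap := hg.comp measurable_swap
    rw [lintegral_map hg measurable_swap, Measure.lintegral_compProd hg']
    simp_rw [ptsKernel_apply, lintegral_sumDirac]
    rfl
  have hC₂ : ∀ g : Euc d × PointMeasure d → ℝ≥0∞, Measurable g →
      ∫⁻ q, g q ∂C₂ = r * ∫⁻ x, ∫⁻ μ, g (x, addPt x μ) ∂P := by
    intro g hg
    have hg' : Measurable fun q : Euc d × PointMeasure d => g (q.1, addPt q.1 q.2) := hg.comp hadd
    rw [lintegral_smul_measure, lintegral_map hg hadd, lintegral_prod _ hg'.aemeasurable]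
    rfl
  have key : ∀ A : Set (Euc d), MeasurableSet A → volume A < ∞ → ∀ B : Set (PointMeasure d),
      MeasurableSet B → C₁ (A ×ˢ B) = C₂ (A ×ˢ B) ∧ C₁ (A ×ˢ B) ≠ ∞ := by
    intro A hA hfin
    let K₁ : Measure (PointMeasure d) := P.withDensity fun μ => μ.toMeasure A
    let K₂ : Measure (PointMeasure d) :=
      (((r : ℝ≥0∞) • (volume : Measure (Euc d)).restrict A).prod P).map fun q => addPt q.1 q.2
    have hcount := measurable_count hA
    have hK₁ : ∀ f : Euc d → ℝ≥0∞, Measurable f → ∫⁻ μ, expNeg (∫⁻ x, f x ∂μ.toMeasure) ∂K₁ =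
        (∫⁻ μ, expNeg (∫⁻ x, f x ∂μ.toMeasure) ∂P) * (r * ∫⁻ x in A, expNeg (f x)) := by
      intro f hf
      have hmf : Measurable fun μ : PointMeasure d => expNeg (∫⁻ x, f x ∂μ.toMeasure) :=
        measurable_expNeg.comp (measurable_lintegral hf)
      have h1 := lintegral_withDensity_eq_lintegral_mul P hcount hmf
      rw [← h.lintegral_count_mul_expNeg hA hfin hf]
      exact h1
    have hK₂ : ∀ f : Euc d → ℝ≥0∞, Measurable f → ∫⁻ μ, expNeg (∫⁻ x, f x ∂μ.toMeasure) ∂K₂ =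
        (∫⁻ μ, expNeg (∫⁻ x, f x ∂μ.toMeasure) ∂P) * (r * ∫⁻ x in A, expNeg (f x)) := by
      intro f hf
      have hmf : Measurable fun μ : PointMeasure d => expNeg (∫⁻ x, f x ∂μ.toMeasure) :=
        measurable_expNeg.comp (measurable_lintegral hf)
      have h0 := lintegral_map (μ := (((r : ℝ≥0∞) • (volume : Measure (Euc d)).restrict A).prod P))
        hmf measurable_addPt
      refine h0.trans ?_
      have hmf' : Measurable fun q : Euc d × PointMeasure d =>
          expNeg (∫⁻ x, f x ∂(addPt q.1 q.2).toMeasure) := hmf.comp measurable_addPt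
      have hmf'' : Measurable fun x => expNeg (f x) := measurable_expNeg.comp hf
      rw [lintegral_prod _ hmf'.aemeasurable, lintegral_smul_measure]
      have h1 : ∀ x, ∫⁻ μ, expNeg (∫⁻ x, f x ∂(addPt x μ).toMeasure) ∂P =
          expNeg (f x) * ∫⁻ μ, expNeg (∫⁻ x, f x ∂μ.toMeasure) ∂P := by
        intro x
        rw [← lintegral_const_mul _ hmf]
        refine lintegral_congr_ae ?_
        -- An added point contributes the factor exp(-f x) unless `x` is an atom already, which has
        -- probability zero.
        filter_upwards [h.ae_locFin, h.ae_notMem hd x] with μ hμ hx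
        simp only [lintegral_addPt hμ hx f, expNeg_add]
      simp only [h1]
      rw [lintegral_mul_const _ hmf'', smul_eq_mul]
      ring
    have hK₁fin : IsFiniteMeasure K₁ := by
      constructor
      have h1 := hK₁ 0 measurable_zero
      simp only [Pi.zero_apply, lintegral_zero, expNeg_zero, lintegral_one, measure_univ,
        one_mul, Measure.restrict_apply, MeasurableSet.univ, Set.univ_inter] at h1
      rw [h1]
      exact ENNReal.mul_lt_top ENNReal.coe_lt_top hfin
    have hfin' : IsFiniteMeasure ((volume : Measure (Euc d)).restrict A) := ⟨by simpa using hfin⟩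
    have hfin'' : IsFiniteMeasure ((r : ℝ≥0∞) • (volume : Measure (Euc d)).restrict A) :=
      Measure.smul_finite _ ENNReal.coe_ne_top
    have hK : K₁ = K₂ := by
      refine PointMeasure.ext_of_laplace fun f hf => ?_
      rw [hK₁ f hf, hK₂ f hf]
    intro B hB
    have e1 : C₁ (A ×ˢ B) = K₁ B := by
      rw [← lintegral_indicator_one (hA.prod hB), hC₁ _ (measurable_one.indicator (hA.prod hB)),
        withDensity_apply _ hB, ← lintegral_indicator hB]
      refine lintegral_congr_ae ?_
      filter_upwards [h.ae_locFin] with μ hμ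
      by_cases hμB : μ ∈ B
      · rw [Set.indicator_of_mem hμB, ← lintegral_indicator_one hA,
          lintegral_toMeasure_of_locFin hμ]
        refine tsum_congr fun x => ?_
        by_cases hx : (x : Euc d) ∈ A <;> simp [hx, hμB]
      · rw [Set.indicator_of_notMem hμB, ENNReal.tsum_eq_zero]
        intro x
        simp [hμB]
    have e2 : C₂ (A ×ˢ B) = K₂ B := by
      have h1 : K₂ B = ∫⁻ μ, B.indicator 1 μ ∂K₂ := (lintegral_indicator_one hB).symm
      rw [h1, ← lintegral_indicator_one (hA.prod hB), hC₂ _ (measurable_one.indicator (hA.prod hB))]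
      have hmB : Measurable (B.indicator (1 : PointMeasure d → ℝ≥0∞)) := measurable_one.indicator hB
      have h0 := lintegral_map (μ := (((r : ℝ≥0∞) • (volume : Measure (Euc d)).restrict A).prod P))
        hmB measurable_addPt
      refine Eq.trans ?_ h0.symm
      have hmB' : Measurable fun q : Euc d × PointMeasure d =>
          B.indicator (1 : PointMeasure d → ℝ≥0∞) (addPt q.1 q.2) := hmB.comp measurable_addPt
      rw [lintegral_prod _ hmB'.aemeasurable, lintegral_smul_measure,
        ← lintegral_indicator hA, smul_eq_mul]
      congr 1
      refine lintegral_congr fun x => ?_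
      by_cases hx : x ∈ A
      · rw [Set.indicator_of_mem hx]
        refine lintegral_congr fun μ => ?_
        by_cases hB' : addPt x μ ∈ B <;> simp [hx, hB']
      · rw [Set.indicator_of_notMem hx]
        simp [hx]
    rw [e1, e2, hK]
    exact ⟨rfl, by rw [← hK]; exact measure_ne_top _ _⟩
  have hC : C₁ = C₂ := by
    refine Measure.ext_of_iUnion_eq_univ
      (s := fun n : ℕ => (Metric.ball (0 : Euc d) n) ×ˢ (Set.univ : Set (PointMeasure d))) ?_ ?_
    · rw [← Set.iUnion_prod_const, Metric.iUnion_ball_nat, Set.univ_prod_univ]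
    · intro n
      have hfin : IsFiniteMeasure (C₁.restrict
          ((Metric.ball (0 : Euc d) n) ×ˢ (Set.univ : Set (PointMeasure d)))) := by
        constructor
        rw [Measure.restrict_apply_univ]
        exact (key _ measurableSet_ball measure_ball_lt_top _ MeasurableSet.univ).2.lt_top
      refine Measure.ext_prod fun {s t} hs ht => ?_
      rw [Measure.restrict_apply (hs.prod ht), Measure.restrict_apply (hs.prod ht),
        Set.prod_inter_prod, Set.inter_univ]
      exact (key _ (hs.inter measurableSet_ball) ((measure_mono Set.inter_subset_right).trans_lt
        measure_ball_lt_top) _ ht).1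
  have h1 := hC₁ _ hf
  rw [hC, hC₂ _ hf] at h1
  exact h1.symm

end IsPoissonLaw

/-! ### Pairs of points and almost sure properties -/

namespace IsPoissonLaw

open PointMeasure

variable {d : ℕ} {r : ℝ≥0} {P : Measure (PointMeasure d)}

open Classical in
/-- The bivariate Mecke formula. -/
theorem mecke_pairs (h : IsPoissonLaw r P) (hd : 1 ≤ d)
    {f : Euc d → Euc d → PointMeasure d → ℝ≥0∞}
    (hf : Measurable fun q : (Euc d × Euc d) × PointMeasure d => f q.1.1 q.1.2 q.2) :
    ∫⁻ μ, ∑' x : μ.pts, ∑' y : μ.pts, (if (x : Euc d) ≠ y then f x y μ else 0) ∂P =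
      r * (r * ∫⁻ x, ∫⁻ y, ∫⁻ μ, f x y (addPt x (addPt y μ)) ∂P) := by
  have := h.isProbabilityMeasure
  have : Nonempty (Fin d) := ⟨⟨0, hd⟩⟩
  have hm1 : Measurable fun q : Euc d × PointMeasure d =>
      ∑' y : q.2.pts, (if q.1 ≠ (y : Euc d) then f q.1 y q.2 else 0) := by
    refine measurable_tsum_pts (Z := fun q : Euc d × PointMeasure d => q.2) measurable_snd
      (f := fun q y => if q.1 ≠ y then f q.1 y q.2 else 0) ?_
    refine Measurable.ite ?_ ?_ measurable_const
    · exact (measurableSet_eq_fun (measurable_fst.comp measurable_fst) measurable_snd).compl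
    · exact hf.comp (((measurable_fst.comp measurable_fst).prodMk measurable_snd).prodMk
        (measurable_snd.comp measurable_fst))
  rw [h.mecke hd (f := fun x μ => ∑' y : μ.pts, (if x ≠ (y : Euc d) then f x y μ else 0)) hm1]
  congr 1
  rw [← lintegral_const_mul' _ _ ENNReal.coe_ne_top]
  refine lintegral_congr fun x => ?_
  have h1 : ∀ μ : PointMeasure d, ∑' y : (addPt x μ).pts,
      (if x ≠ (y : Euc d) then f x y (addPt x μ) else 0) =
      ∑' y : μ.pts, (if x ≠ (y : Euc d) then f x y (addPt x μ) else 0) := by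
    intro μ
    rw [tsum_subtype (addPt x μ).pts (fun y => if x ≠ y then f x y (addPt x μ) else 0),
      tsum_subtype μ.pts (fun y => if x ≠ y then f x y (addPt x μ) else 0)]
    refine tsum_congr fun y => ?_
    by_cases hxy : x = y
    · simp [Set.indicator, hxy]
    · simp only [Set.indicator, pts_addPt, Set.mem_insert_iff, Ne.symm hxy, false_or]
  simp_rw [h1]
  have hm2 : Measurable fun q : Euc d × PointMeasure d =>
      if x ≠ q.1 then f x q.1 (addPt x q.2) else 0 := by
    refine Measurable.ite ?_ ?_ measurable_const
    · exact (measurableSet_eq_fun measurable_const measurable_fst).compl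
    · exact hf.comp ((measurable_const.prodMk measurable_fst).prodMk
        (measurable_addPt.comp (measurable_const.prodMk measurable_snd)))
  rw [h.mecke hd (f := fun y μ => if x ≠ y then f x y (addPt x μ) else 0) hm2]
  congr 1
  refine lintegral_congr_ae ?_
  -- The diagonal is null, so the condition `x ≠ y` disappears under the integral.
  filter_upwards [Measure.ae_ne volume x] with y hy
  simp [Ne.symm hy]

/-- Almost surely no two points are in a given null relation. -/
theorem ae_pairs (h : IsPoissonLaw r P) (hd : 1 ≤ d) {N : Euc d → Set (Euc d)}
    (hN : MeasurableSet {q : Euc d × Euc d | q.2 ∈ N q.1}) (h0 : ∀ x, volume (N x) = 0) :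
    ∀ᵐ μ ∂P, ∀ x ∈ μ.pts, ∀ y ∈ μ.pts, x ≠ y → y ∉ N x := by
  classical
  have := h.isProbabilityMeasure
  have hNx : ∀ x, MeasurableSet (N x) := fun x => measurable_prodMk_left hN
  have hm : Measurable fun q : (Euc d × Euc d) × PointMeasure d =>
      (N q.1.1).indicator (1 : Euc d → ℝ≥0∞) q.1.2 := by
    have : Measurable ({q : Euc d × Euc d | q.2 ∈ N q.1}.indicator (1 : Euc d × Euc d → ℝ≥0∞)) :=
      measurable_one.indicator hN
    exact this.comp measurable_fst
  have h1 := h.mecke_pairs hd (f := fun x y _ => (N x).indicator 1 y) hm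
  have h2 : ∀ x : Euc d, ∫⁻ y, ∫⁻ _, (N x).indicator (1 : Euc d → ℝ≥0∞) y ∂P = 0 := by
    intro x
    simp [lintegral_indicator_one (hNx x), h0 x]
  simp only [h2, lintegral_zero, mul_zero] at h1
  rw [lintegral_eq_zero_iff] at h1
  · filter_upwards [h1] with μ hμ x hx y hy hxy hyN
    simp only [Pi.zero_apply, ENNReal.tsum_eq_zero] at hμ
    have := hμ ⟨x, hx⟩ ⟨y, hy⟩
    simp [hxy, hyN] at this
  · refine measurable_tsum_pts (Z := fun μ => μ) measurable_id
      (f := fun μ x => ∑' y : μ.pts, (if x ≠ (y : Euc d) then (N x).indicator 1 (y : Euc d) else 0)) ?_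
    refine measurable_tsum_pts (Z := fun q : PointMeasure d × Euc d => q.1) measurable_fst
      (f := fun q y => if q.2 ≠ y then (N q.2).indicator 1 y else 0) ?_
    refine Measurable.ite ?_ ?_ measurable_const
    · exact (measurableSet_eq_fun (measurable_snd.comp measurable_fst) measurable_snd).compl
    · exact hm.comp (((measurable_snd.comp measurable_fst).prodMk measurable_snd).prodMk
        (measurable_fst.comp measurable_fst))

/-- Spheres about the origin are null sets. Distinct norms allow the points to be listed by their
distance from the origin in `ofSeq_enum`. -/
theorem ae_norm_ne (h : IsPoissonLaw r P) (hd : 1 ≤ d) :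
    ∀ᵐ μ ∂P, ∀ x ∈ μ.pts, ∀ y ∈ μ.pts, x ≠ y → ‖x‖ ≠ ‖y‖ := by
  have : Nonempty (Fin d) := ⟨⟨0, hd⟩⟩
  have := h.ae_pairs hd (N := fun x => {y | ‖x‖ = ‖y‖})
    (measurableSet_eq_fun measurable_fst.norm measurable_snd.norm) (fun x => by
      have : {y : Euc d | ‖x‖ = ‖y‖} = Metric.sphere 0 ‖x‖ := by
        ext y; simp [eq_comm]
      rw [this, Measure.addHaar_sphere])
  exact this

/-- The Laplace functional at the constant function ∞ is the probability of the empty configuration,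
here e to the power -r · ∞. -/
theorem ae_pts_nonempty (h : IsPoissonLaw r P) (hd : 1 ≤ d) (hr : 0 < r) :
    ∀ᵐ μ ∂P, μ.pts.Nonempty := by
  have := h.isProbabilityMeasure
  have : Nonempty (Fin d) := ⟨⟨0, hd⟩⟩
  have h1 := h.laplace (f := fun _ => ∞) measurable_const
  have hv : volume (Set.univ : Set (Euc d)) = ∞ := measure_univ_of_isAddLeftInvariant _
  simp only [expNeg_top, tsub_zero, lintegral_const, one_mul, hv] at h1
  rw [ENNReal.mul_top (by exact_mod_cast hr.ne'), expNeg_top, lintegral_eq_zero_iff] at h1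
  · filter_upwards [h1, h.ae_locFin] with μ hμ hlf
    by_contra hne
    rw [Set.not_nonempty_iff_eq_empty, pts_eq_supp hlf] at hne
    have h2 : μ.toMeasure Set.univ = 0 := by
      rw [toMeasure_eq, sumDirac_apply MeasurableSet.univ, hne]
      simp
    simp [h2] at hμ
  · refine measurable_expNeg.comp ?_
    exact measurable_const.mul (measurable_count MeasurableSet.univ)

end IsPoissonLaw

/-! ### Special centres and their stability under moving the pairs -/

section Geometry

variable {d : ℕ}

/-- The points `x`, `y` of `S` have midpoint `m`, are closer than `1`, and are the only points of
`S` in the ball of radius `R` about `m`. -/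
structure IsolatedPair (R : ℝ) (S : Set (Euc d)) (m x y : Euc d) : Prop where
  left_mem : x ∈ S
  right_mem : y ∈ S
  ne : x ≠ y
  mid : midpoint ℝ x y = m
  dist_lt : dist x m < 1 / 2
  isolated : ∀ z ∈ S, dist z m < R → z = x ∨ z = y

/-- `m` is the midpoint of an isolated pair. -/
def PairCenter (R : ℝ) (S : Set (Euc d)) (m : Euc d) : Prop :=
  ∃ x ∈ S, ∃ y ∈ S, IsolatedPair R S m x y

/-- Spherical shells of width one. -/
def shell (i : Fin d) (m : Euc d) : Set (Euc d) := {z | 6 + i ≤ dist z m ∧ dist z m < 7 + i}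

/-- The position of the point of `S` in the `i`-th shell, relative to the centre. -/
def frameVec (S : Set (Euc d)) (m : Euc d) (i : Fin d) : Euc d :=
  pickVal S (fun z => z ∈ shell i m) (fun z => z - m)

/-- Each shell contains exactly one point, and these points are in general position. -/
def HasFrame (S : Set (Euc d)) (m : Euc d) : Prop :=
  (∀ i, ∃ z ∈ S, z ∈ shell i m ∧ ∀ w ∈ S, w ∈ shell i m → w = z) ∧
    LinearIndependent ℝ (frameVec S m)

/-- The centres at which the configuration is going to be changed. -/
structure Special (S : Set (Euc d)) (m : Euc d) : Prop where
  center : PairCenter 6 S m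
  separated : ∀ m', PairCenter 2 S m' → m' ≠ m → (d : ℝ) + 20 ≤ dist m' m
  frame : HasFrame S m

theorem IsolatedPair.dist_right {R : ℝ} {S : Set (Euc d)} {m x y : Euc d}
    (h : IsolatedPair R S m x y) : dist y m = dist x m := by
  rw [← h.mid, dist_right_midpoint, dist_left_midpoint]

theorem IsolatedPair.mono {R R' : ℝ} (hR : R' ≤ R) {S : Set (Euc d)} {m x y : Euc d}
    (h : IsolatedPair R S m x y) : IsolatedPair R' S m x y :=
  ⟨h.left_mem, h.right_mem, h.ne, h.mid, h.dist_lt, fun z hz hz' => h.isolated z hz (hz'.trans_le hR)⟩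

theorem IsolatedPair.symm {R : ℝ} {S : Set (Euc d)} {m x y : Euc d}
    (h : IsolatedPair R S m x y) : IsolatedPair R S m y x :=
  ⟨h.right_mem, h.left_mem, h.ne.symm, by rw [midpoint_comm, h.mid], by
    rw [h.dist_right]; exact h.dist_lt, fun z hz hz' => (h.isolated z hz hz').symm⟩

theorem IsolatedPair.left_ne {R : ℝ} {S : Set (Euc d)} {m x y : Euc d}
    (h : IsolatedPair R S m x y) : x ≠ m := by
  intro hx
  have h1 := h.dist_right
  rw [hx, dist_self, dist_eq_zero] at h1
  exact h.ne (hx.trans h1.symm)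

theorem PairCenter.mono {R R' : ℝ} (hR : R' ≤ R) {S : Set (Euc d)} {m : Euc d}
    (h : PairCenter R S m) : PairCenter R' S m := by
  obtain ⟨x, hx, y, hy, h⟩ := h
  exact ⟨x, hx, y, hy, h.mono hR⟩

theorem Special.center_two {S : Set (Euc d)} {m : Euc d} (h : Special S m) : PairCenter 2 S m :=
  h.center.mono (by norm_num)

theorem PairCenter.congr {R : ℝ} (hR : 1 / 2 ≤ R) {S S' : Set (Euc d)} {m : Euc d}
    (h : ∀ z, dist z m < R → (z ∈ S ↔ z ∈ S')) (hc : PairCenter R S m) : PairCenter R S' m := by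
  obtain ⟨x, hx, y, hy, hp⟩ := hc
  have h1 := (h x (hp.dist_lt.trans_le hR)).1 hx
  have h2 := (h y ((hp.dist_right ▸ hp.dist_lt).trans_le hR)).1 hy
  exact ⟨x, h1, y, h2, h1, h2, hp.ne, hp.mid, hp.dist_lt, fun z hz hz' =>
    hp.isolated z ((h z hz').2 hz) hz'⟩

/-- A pair centre near a well isolated pair centre coincides with it. -/
theorem PairCenter.eq_of_dist_lt {S : Set (Euc d)} {m c : Euc d} (hm : PairCenter 6 S m)
    (hc : PairCenter 2 S c) (h : dist c m < 5 / 2) : c = m := by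
  obtain ⟨x, hx, y, hy, hp⟩ := hm
  obtain ⟨a, ha, b, hb, hq⟩ := hc
  have ha' : dist a m < 6 := by
    have := dist_triangle a c m; have := hq.dist_lt; linarith
  have hb' : dist b m < 6 := by
    have := dist_triangle b c m; have := hq.dist_lt; have := hq.dist_right; linarith
  rw [← hq.mid, ← hp.mid]
  rcases hp.isolated a ha ha' with rfl | rfl <;> rcases hp.isolated b hb hb' with rfl | rfl
  · exact absurd rfl hq.ne
  · rfl
  · exact midpoint_comm _ _
  · exact absurd rfl hq.ne

theorem Special.eq_of_dist_lt {S : Set (Euc d)} {m c : Euc d} (hm : Special S m)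
    (hc : PairCenter 2 S c) (h : dist c m < d + 20) : c = m := by
  by_contra hne
  exact absurd (hm.separated c hc hne) (not_le.2 h)

theorem shell_lower {i : Fin d} {m z : Euc d} (h : z ∈ shell i m) : 6 ≤ dist z m := by
  have := h.1
  have : (0 : ℝ) ≤ (i : ℕ) := Nat.cast_nonneg _
  linarith

theorem shell_upper {i : Fin d} {m z : Euc d} (h : z ∈ shell i m) : dist z m < d + 6 := by
  have h1 := h.2
  have : ((i : ℕ) : ℝ) + 1 ≤ d := by exact_mod_cast i.2
  linarith

theorem frameVec_congr {S S' : Set (Euc d)} {m : Euc d}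
    (h : ∀ z, 6 ≤ dist z m → dist z m < d + 6 → (z ∈ S ↔ z ∈ S')) :
    frameVec S m = frameVec S' m := by
  funext i
  refine pickVal_congr (fun z => ?_) fun _ _ _ => rfl
  refine and_congr_left fun hz => h z (shell_lower hz) (shell_upper hz)

theorem HasFrame.congr {S S' : Set (Euc d)} {m : Euc d}
    (h : ∀ z, 6 ≤ dist z m → dist z m < d + 6 → (z ∈ S ↔ z ∈ S')) (hf : HasFrame S m) :
    HasFrame S' m := by
  refine ⟨fun i => ?_, by rw [← frameVec_congr h]; exact hf.2⟩
  obtain ⟨z, hz, hz', hu⟩ := hf.1 i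
  exact ⟨z, (h z (shell_lower hz') (shell_upper hz')).1 hz, hz', fun w hw hw' =>
    hu w ((h w (shell_lower hw') (shell_upper hw')).2 hw) hw'⟩

/-- `S'` arises from `S` by moving the pairs with centres in `A`. -/
structure Perturb (A S S' : Set (Euc d)) : Prop where
  left : ∀ m ∈ A, PairCenter 6 S m
  right : ∀ m ∈ A, PairCenter 6 S' m
  separated : ∀ m ∈ A, ∀ m', PairCenter 2 S m' → m' ≠ m → (d : ℝ) + 20 ≤ dist m' m
  agree : ∀ x, (∀ m ∈ A, 1 / 2 ≤ dist x m) → (x ∈ S ↔ x ∈ S')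

namespace Perturb

variable {A S S' : Set (Euc d)}

/-- This is the reason for two isolation radii. A centre `c` of the weak kind within 5 / 2 of a
moved pair is the centre of that pair, because the pair is alone in a ball of radius 6. If `c` is
farther from all moved pairs, its ball of radius 2 misses the balls of radius 1 / 2 in which changes
occur. So a move creates no new competitor that could spoil the separation of a special centre. -/
theorem pairCenter_imp' (h : Perturb A S S') {c : Euc d} (hc : PairCenter 2 S' c) :
    PairCenter 2 S c := by
  by_cases hA : ∃ m ∈ A, dist c m < 5 / 2
  · obtain ⟨m, hm, hcm⟩ := hA
    rw [(h.right m hm).eq_of_dist_lt hc hcm]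
    exact (h.left m hm).mono (by norm_num)
  · push Not at hA
    refine hc.congr (by norm_num) fun z hz => (h.agree z fun m hm => ?_).symm
    have := hA m hm
    have := dist_triangle_left c m z
    linarith

theorem symm (h : Perturb A S S') : Perturb A S' S :=
  ⟨h.right, h.left, fun m hm m' hm' hne => h.separated m hm m' (h.pairCenter_imp' hm') hne,
    fun x hx => (h.agree x hx).symm⟩

/-- Every other moved pair has its centre at distance at least d + 20 from `m`, hence at distance
greater than 1 from `z`. -/
theorem mem_iff (h : Perturb A S S') {m z : Euc d} (hm : PairCenter 2 S m)
    (hz : dist z m < d + 19) (hz' : 1 / 2 ≤ dist z m ∨ m ∉ A) : z ∈ S ↔ z ∈ S' := by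
  refine h.agree z fun m' hm' => ?_
  by_cases hne : m = m'
  · subst hne
    rcases hz' with hz' | hz'
    · exact hz'
    · exact absurd hm' hz'
  · have h1 := h.separated m' hm' m hm hne
    have h2 := dist_triangle_left m m' z
    linarith

/-- The shells lie between the radii 6 and d + 6, so `mem_iff` shows that they are never touched:
not by the pair at `m`, which stays within 1 / 2, nor by any other pair. -/
theorem special_imp (h : Perturb A S S') {m : Euc d} (hm : Special S m) : Special S' m := by
  refine ⟨?_, fun m' hm' hne => hm.separated m' (h.pairCenter_imp' hm') hne, ?_⟩
  · by_cases hA : m ∈ A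
    · exact h.right m hA
    · refine hm.center.congr (by norm_num) fun z hz => h.mem_iff hm.center_two ?_ (Or.inr hA)
      have : (0 : ℝ) ≤ d := Nat.cast_nonneg _
      linarith
  · refine hm.frame.congr fun z hz hz' => h.mem_iff hm.center_two (by linarith) (Or.inl ?_)
    linarith

theorem special_iff (h : Perturb A S S') {m : Euc d} : Special S m ↔ Special S' m :=
  ⟨h.special_imp, h.symm.special_imp⟩

theorem frameVec_eq (h : Perturb A S S') {m : Euc d} (hm : Special S m) :
    frameVec S m = frameVec S' m :=
  frameVec_congr fun z hz hz' => h.mem_iff hm.center_two (by linarith) (Or.inl (by linarith))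

end Perturb

/-! ### Prescribing the radii of the special pairs -/

/-- The centre of the special pair to which `x` belongs. -/
def centerOf (S : Set (Euc d)) (x : Euc d) : Euc d :=
  pickVal S (fun y => Special S (midpoint ℝ x y) ∧ dist x (midpoint ℝ x y) < 1 / 2)
    (fun y => midpoint ℝ x y)

/-- `x` belongs to a special pair. -/
def InSpecialPair (S : Set (Euc d)) (x : Euc d) : Prop :=
  ∃ y ∈ S, Special S (midpoint ℝ x y) ∧ dist x (midpoint ℝ x y) < 1 / 2

/-- Move the points of special pairs radially, to distance `ρ m` from the centre `m`. -/
def movePt (S : Set (Euc d)) (ρ : Euc d → ℝ) (x : Euc d) : Euc d :=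
  open Classical in
  if InSpecialPair S x then
    centerOf S x + (ρ (centerOf S x) / dist x (centerOf S x)) • (x - centerOf S x)
  else x

/-- Give the pair with centre `m` the radius `ρ m`, for all special centres `m`. -/
def setRadius (S : Set (Euc d)) (ρ : Euc d → ℝ) : Set (Euc d) := Set.image (movePt S ρ) S

/-- The distance of the points of the pair with centre `m` from the centre. -/
def radius (S : Set (Euc d)) (m : Euc d) : ℝ :=
  pickVal S (fun x => dist x m < 1 / 2) (fun x => dist x m)

section Radius

variable {S : Set (Euc d)} {ρ : Euc d → ℝ} {m x y : Euc d}

theorem Special.partner (hm : Special S m) (hx : x ∈ S) (hxm : dist x m < 1 / 2) :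
    ∃ y ∈ S, IsolatedPair 6 S m x y := by
  obtain ⟨a, ha, b, hb, h⟩ := hm.center
  rcases h.isolated x hx (by linarith) with rfl | rfl
  · exact ⟨b, hb, h⟩
  · exact ⟨a, ha, h.symm⟩

theorem Special.unique {m' : Euc d} (hm : Special S m) (hm' : Special S m')
    (h : dist m' m < d + 20) : m' = m :=
  hm.eq_of_dist_lt hm'.center_two h

theorem Special.unique_of_near {m' : Euc d} (hm : Special S m) (hm' : Special S m')
    (h : dist x m < 1 / 2) (h' : dist x m' < 1 / 2) : m' = m := by
  refine hm.unique hm' ?_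
  have := dist_triangle_left m' m x
  have : (0 : ℝ) ≤ d := Nat.cast_nonneg _
  linarith

theorem Special.inSpecialPair (hm : Special S m) (hx : x ∈ S) (hxm : dist x m < 1 / 2) :
    InSpecialPair S x := by
  obtain ⟨y, hy, h⟩ := hm.partner hx hxm
  exact ⟨y, hy, by rw [h.mid]; exact ⟨hm, hxm⟩⟩

theorem Special.centerOf_eq (hm : Special S m) (hx : x ∈ S) (hxm : dist x m < 1 / 2) :
    centerOf S x = m := by
  obtain ⟨y, hy, h⟩ := hm.partner hx hxm
  have h1 : centerOf S x = midpoint ℝ x y := by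
    refine pickVal_eq hy (by rw [h.mid]; exact ⟨hm, hxm⟩) fun z _ hz' => ?_
    rw [h.mid]
    exact hm.unique_of_near hz'.1 hxm hz'.2
  rw [h1, h.mid]

theorem Special.movePt_eq (hm : Special S m) (hx : x ∈ S) (hxm : dist x m < 1 / 2) :
    movePt S ρ x = m + (ρ m / dist x m) • (x - m) := by
  rw [movePt, if_pos (hm.inSpecialPair hx hxm), hm.centerOf_eq hx hxm]

theorem movePt_of_far (h : ∀ m, Special S m → 1 / 2 ≤ dist x m) : movePt S ρ x = x := by
  rw [movePt, if_neg]
  rintro ⟨y, _, hs, hy⟩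
  exact absurd hy (not_lt.2 (h _ hs))

theorem far_or_near (S : Set (Euc d)) (x : Euc d) :
    (∀ m, Special S m → 1 / 2 ≤ dist x m) ∨ ∃ m, Special S m ∧ dist x m < 1 / 2 := by
  by_cases h : ∃ m, Special S m ∧ dist x m < 1 / 2
  · exact Or.inr h
  · push Not at h
    exact Or.inl h

theorem Special.dist_movePt (hm : Special S m) (hx : x ∈ S) (hxm : dist x m < 1 / 2)
    (hρ : 0 < ρ m) : dist (movePt S ρ x) m = ρ m := by
  obtain ⟨y, hy, h⟩ := hm.partner hx hxm
  have h0 : 0 < dist x m := dist_pos.2 h.left_ne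
  rw [hm.movePt_eq hx hxm, dist_eq_norm, add_sub_cancel_left, norm_smul, ← dist_eq_norm,
    Real.norm_of_nonneg (by positivity), div_mul_cancel₀ _ h0.ne']

/-- The prescribed radii are admissible. -/
def GoodRadii (S : Set (Euc d)) (ρ : Euc d → ℝ) : Prop :=
  ∀ m, Special S m → ρ m ∈ Set.Ioo (0 : ℝ) (1 / 2)

theorem Special.movePt_partner (hm : Special S m) (h : IsolatedPair 6 S m x y) :
    midpoint ℝ (movePt S ρ x) (movePt S ρ y) = m := by
  rw [hm.movePt_eq h.left_mem h.dist_lt, hm.movePt_eq h.right_mem (h.dist_right ▸ h.dist_lt),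
    h.dist_right]
  have h1 : y - m = -(x - m) := by
    rw [← h.mid, midpoint_eq_smul_add, invOf_eq_inv]
    module
  rw [h1, midpoint_eq_smul_add, invOf_eq_inv]
  module

theorem GoodRadii.dist_movePt_lt (hρ : GoodRadii S ρ) (hx : x ∈ S) : dist (movePt S ρ x) x < 1 := by
  rcases far_or_near S x with h | ⟨m, hm, hxm⟩
  · rw [movePt_of_far h, dist_self]; norm_num
  · have h1 := hm.dist_movePt hx hxm (hρ m hm).1
    have h2 := (hρ m hm).2
    have := dist_triangle_right (movePt S ρ x) x m
    linarith

/-- Points move by less than 1, so a point with the same image as a member of a special pair is that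
member or its partner. Partners have images symmetric about the centre, and these could only
coincide at the centre itself, at radius 0. -/
theorem GoodRadii.injOn_movePt (hρ : GoodRadii S ρ) : Set.InjOn (movePt S ρ) S := by
  have key : ∀ x ∈ S, ∀ y ∈ S, ∀ m, Special S m → dist x m < 1 / 2 →
      movePt S ρ x = movePt S ρ y → x = y := by
    intro x hx y hy m hm hxm he
    have h1 := hm.dist_movePt hx hxm (hρ m hm).1
    obtain ⟨x', _, hp⟩ := hm.partner hx hxm
    have hy1 : dist y m < 2 := by
      have := hρ.dist_movePt_lt hy
      rw [← he] at this
      have h2 := (hρ m hm).2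
      have := dist_triangle_left y m (movePt S ρ x)
      linarith
    rcases hp.isolated y hy (by linarith) with rfl | rfl
    · rfl
    · have h3 := hm.movePt_partner (ρ := ρ) hp
      rw [← he, midpoint_self] at h3
      rw [h3, dist_self] at h1
      exact absurd h1 (hρ m hm).1.ne
  intro x hx y hy he
  rcases far_or_near S x with h | ⟨m, hm, hxm⟩
  · rcases far_or_near S y with h' | ⟨m, hm, hym⟩
    · rwa [movePt_of_far h, movePt_of_far h'] at he
    · exact (key y hy x hx m hm hym he.symm).symm
  · exact key x hx y hy m hm hxm he

theorem LocFin.setRadius (h : LocFin S) (hρ : GoodRadii S ρ) : LocFin (setRadius S ρ) := by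
  intro n
  refine ((h (n + 1)).image (movePt S ρ)).subset ?_
  rintro _ ⟨⟨x, hx, rfl⟩, hn⟩
  refine ⟨x, ⟨hx, ?_⟩, rfl⟩
  have h1 := hρ.dist_movePt_lt hx
  rw [Metric.mem_ball] at *
  have := dist_triangle_left x 0 (movePt S ρ x)
  push_cast
  linarith

/-- Through this, special centres, frames and cells can be read equally well before and after the
radii are changed; this is what makes decoding possible. -/
theorem GoodRadii.perturb (hρ : GoodRadii S ρ) : Perturb {m | Special S m} S (setRadius S ρ) := by
  refine ⟨fun m hm => hm.center, fun m hm => ?_, fun m hm => hm.separated, fun x hx => ?_⟩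
  · obtain ⟨a, ha, b, hb, h⟩ := hm.center
    have hb' : dist b m < 1 / 2 := h.dist_right ▸ h.dist_lt
    refine ⟨_, ⟨a, ha, rfl⟩, _, ⟨b, hb, rfl⟩, ⟨a, ha, rfl⟩, ⟨b, hb, rfl⟩, fun he =>
      h.ne (hρ.injOn_movePt ha hb he), hm.movePt_partner h, ?_, ?_⟩
    · rw [hm.dist_movePt ha h.dist_lt (hρ m hm).1]
      exact (hρ m hm).2
    · rintro _ ⟨z, hz, rfl⟩ hzm
      rcases far_or_near S z with h' | ⟨m', hm', hzm'⟩
      · rw [movePt_of_far h'] at hzm ⊢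
        rcases h.isolated z hz hzm with rfl | rfl
        · exact absurd h.dist_lt (not_lt.2 (h' m hm))
        · exact absurd hb' (not_lt.2 (h' m hm))
      · have h1 := hm'.dist_movePt hz hzm' (hρ m' hm').1
        have h2 := (hρ m' hm').2
        have h3 : m' = m := by
          refine hm.unique hm' ?_
          have := dist_triangle_left m' m (movePt S ρ z)
          have : (0 : ℝ) ≤ d := Nat.cast_nonneg _
          linarith
        subst h3
        rcases h.isolated z hz (by linarith) with rfl | rfl
        · exact Or.inl rfl
        · exact Or.inr rfl
  · constructor
    · exact fun h => ⟨x, h, movePt_of_far hx⟩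
    · rintro ⟨z, hz, rfl⟩
      rcases far_or_near S z with h' | ⟨m', hm', hzm'⟩
      · rwa [movePt_of_far h']
      · have h1 := hm'.dist_movePt hz hzm' (hρ m' hm').1
        have h2 := hx m' hm'
        have h3 := (hρ m' hm').2
        linarith

theorem GoodRadii.special_iff (hρ : GoodRadii S ρ) : Special (setRadius S ρ) m ↔ Special S m :=
  hρ.perturb.special_iff.symm

theorem GoodRadii.frameVec_eq (hρ : GoodRadii S ρ) (hm : Special S m) :
    frameVec (setRadius S ρ) m = frameVec S m :=
  (hρ.perturb.frameVec_eq hm).symm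

theorem Special.radius_eq (hm : Special S m) (hx : x ∈ S) (hxm : dist x m < 1 / 2) :
    radius S m = dist x m := by
  obtain ⟨y, hy, h⟩ := hm.partner hx hxm
  refine pickVal_eq (f := fun x => dist x m) hx hxm fun z hz hz' => ?_
  rcases h.isolated z hz (by linarith) with rfl | rfl
  · rfl
  · exact h.dist_right

theorem goodRadii_radius (S : Set (Euc d)) : GoodRadii S (radius S) := by
  intro m hm
  obtain ⟨a, ha, b, hb, h⟩ := hm.center
  rw [hm.radius_eq ha h.dist_lt]
  exact ⟨dist_pos.2 h.left_ne, h.dist_lt⟩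

theorem GoodRadii.radius_setRadius (hρ : GoodRadii S ρ) (hm : Special S m) :
    radius (setRadius S ρ) m = ρ m := by
  obtain ⟨a, ha, b, hb, h⟩ := hm.center
  have h1 := hm.dist_movePt ha h.dist_lt (hρ m hm).1
  rw [(hρ.special_iff.2 hm).radius_eq ⟨a, ha, rfl⟩ (by rw [h1]; exact (hρ m hm).2), h1]

theorem setRadius_congr {ρ' : Euc d → ℝ} (h : ∀ m, Special S m → ρ m = ρ' m) :
    setRadius S ρ = setRadius S ρ' := by
  refine Set.image_congr fun x hx => ?_
  rcases far_or_near S x with h' | ⟨m, hm, hxm⟩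
  · rw [movePt_of_far h', movePt_of_far h']
  · rw [hm.movePt_eq hx hxm, hm.movePt_eq hx hxm, h m hm]

theorem GoodRadii.movePt_movePt {ρ' : Euc d → ℝ} (hρ : GoodRadii S ρ) (hx : x ∈ S) :
    movePt (setRadius S ρ) ρ' (movePt S ρ x) = movePt S ρ' x := by
  have hmem : movePt S ρ x ∈ _root_.setRadius S ρ := ⟨x, hx, rfl⟩
  rcases far_or_near S x with h | ⟨m, hm, hxm⟩
  · rw [movePt_of_far h, movePt_of_far h, movePt_of_far]
    intro m hm
    exact h m (hρ.special_iff.1 hm)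
  · have h1 := hm.dist_movePt hx hxm (hρ m hm).1
    obtain ⟨y, hy, hp⟩ := hm.partner hx hxm
    rw [(hρ.special_iff.2 hm).movePt_eq hmem (by rw [h1]; exact (hρ m hm).2), h1,
      hm.movePt_eq hx hxm, hm.movePt_eq hx hxm, add_sub_cancel_left, smul_smul, ← mul_div_assoc,
      div_mul_cancel₀ _ (hρ m hm).1.ne']

/-- A move keeps the centre and the direction of each point, so the second prescription of radii
overwrites the first. -/
theorem GoodRadii.setRadius_setRadius {ρ' : Euc d → ℝ} (hρ : GoodRadii S ρ) :
    setRadius (setRadius S ρ) ρ' = setRadius S ρ' := by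
  unfold _root_.setRadius
  rw [Set.image_image]
  exact Set.image_congr fun x hx => hρ.movePt_movePt hx

end Radius

end Geometry

/-! ### Frames, local coordinates and Voronoi cells -/

section Frames

open InnerProductSpace

variable {d : ℕ}

/-- The orthonormal frame attached to a special centre. -/
def basisVec (S : Set (Euc d)) (m : Euc d) (i : Fin d) : Euc d :=
  gramSchmidtNormed ℝ (frameVec S m) i

/-- The isometry from the standard space to the space centred at `m`. -/
def toWorld (S : Set (Euc d)) (m x : Euc d) : Euc d := m + ∑ i, x i • basisVec S m i

/-- The coordinates of `y` in the frame attached to `m`. -/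
def toLocal (S : Set (Euc d)) (m y : Euc d) : Euc d :=
  WithLp.toLp 2 fun i => inner ℝ (basisVec S m i) (y - m)

/-- The Voronoi cell of a special centre. -/
def cell (S : Set (Euc d)) (m : Euc d) : Set (Euc d) :=
  {x | ∀ m', Special S m' → m' ≠ m → dist x m < dist x m'}

variable {S : Set (Euc d)} {m : Euc d}

theorem exists_linearIsometryEquiv_frame (h : LinearIndependent ℝ (frameVec S m)) :
    ∃ L : Euc d ≃ₗᵢ[ℝ] Euc d, (∀ x, toWorld S m x = m + L x) ∧
      ∀ y, toLocal S m y = L.symm (y - m) := by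
  have hcard : Module.finrank ℝ (Euc d) = Fintype.card (Fin d) := by simp
  let b := gramSchmidtOrthonormalBasis hcard (frameVec S m)
  have hb : ∀ i, b i = basisVec S m i := by
    intro i
    refine gramSchmidtOrthonormalBasis_apply hcard ?_
    intro h0
    have := gramSchmidtNormed_unit_length i h
    rw [h0] at this
    simp at this
  refine ⟨b.repr.symm, fun x => ?_, fun y => ?_⟩
  · rw [toWorld, ← b.sum_repr_symm]
    simp only [hb]
  · rw [LinearIsometryEquiv.symm_symm]
    ext i
    rw [b.repr_apply_apply, hb]
    rfl

theorem Special.toWorld_toLocal (h : Special S m) (y : Euc d) :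
    toWorld S m (toLocal S m y) = y := by
  obtain ⟨L, h1, h2⟩ := exists_linearIsometryEquiv_frame h.frame.2
  rw [h1, h2]; simp

theorem Special.toLocal_toWorld (h : Special S m) (x : Euc d) :
    toLocal S m (toWorld S m x) = x := by
  obtain ⟨L, h1, h2⟩ := exists_linearIsometryEquiv_frame h.frame.2
  rw [h1, h2]; simp

theorem Special.injective_toWorld (h : Special S m) : Function.Injective (toWorld S m) :=
  Function.LeftInverse.injective h.toLocal_toWorld

theorem toWorld_congr {S' : Set (Euc d)} (h : frameVec S m = frameVec S' m) :
    toWorld S m = toWorld S' m := by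
  funext x
  simp only [toWorld, basisVec, h]

theorem toLocal_congr {S' : Set (Euc d)} (h : frameVec S m = frameVec S' m) :
    toLocal S m = toLocal S' m := by
  funext x
  simp only [toLocal, basisVec, h]

theorem cell_congr {S' : Set (Euc d)} (h : ∀ m, Special S m ↔ Special S' m) :
    cell S m = cell S' m := by
  ext x
  simp only [cell, h]

theorem cell_disjoint {m' x : Euc d} (h : Special S m) (h' : Special S m') (hx : x ∈ cell S m)
    (hx' : x ∈ cell S m') : m = m' := by
  by_contra hne
  exact lt_asymm (hx m' h' (Ne.symm hne)) (hx' m h hne)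

theorem LocFin.finite_special (hS : LocFin S) (c : Euc d) (R : ℝ) :
    {m | Special S m ∧ dist m c < R}.Finite := by
  have h1 := hS.finite_inter_ball c (R + 1)
  refine (h1.image2 (fun x y => midpoint ℝ x y) h1).subset ?_
  rintro m ⟨hm, hmc⟩
  obtain ⟨x, hx, y, hy, h⟩ := hm.center
  have h2 := h.dist_lt
  have h3 := h.dist_right
  refine ⟨x, ⟨hx, ?_⟩, y, ⟨hy, ?_⟩, h.mid⟩
  · have := dist_triangle x m c
    rw [Metric.mem_ball]; linarith
  · have := dist_triangle y m c
    rw [Metric.mem_ball]; linarith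

theorem LocFin.countable_special (hS : LocFin S) : {m | Special S m}.Countable := by
  have : {m | Special S m} = ⋃ n : ℕ, {m | Special S m ∧ dist m 0 < n} := by
    ext m
    simp only [Set.mem_iUnion, Set.mem_ofPred_eq]
    refine ⟨fun h => ?_, fun ⟨_, h⟩ => h.1⟩
    obtain ⟨n, hn⟩ := exists_nat_gt (dist m 0)
    exact ⟨n, h, hn⟩
  rw [this]
  exact Set.countable_iUnion fun n => (hS.finite_special 0 n).countable

/-- If there is a special centre then the cells cover almost all of space. -/
theorem LocFin.ae_mem_cell (hS : LocFin S) (hne : ∃ m, Special S m) :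
    ∀ᵐ x : Euc d, ∃ m, Special S m ∧ x ∈ cell S m := by
  -- Ties occur only on the bisecting hyperplanes of countably many pairs of centres.
  have h1 : ∀ᵐ x : Euc d, ∀ m ∈ {m | Special S m}, ∀ m' ∈ {m | Special S m}, m ≠ m' →
      dist x m ≠ dist x m' := by
    rw [ae_ball_iff hS.countable_special]
    intro m _
    rw [ae_ball_iff hS.countable_special]
    intro m' _
    by_cases hmm : m = m'
    · simp [hmm]
    · have h2 : volume (AffineSubspace.perpBisector m m' : Set (Euc d)) = 0 :=
        Measure.addHaar_affineSubspace _ _ (by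
          rw [Ne, AffineSubspace.perpBisector_eq_top]; exact hmm)
      have h3 : ∀ᵐ x : Euc d, x ∉ (AffineSubspace.perpBisector m m' : Set (Euc d)) :=
        measure_eq_zero_iff_ae_notMem.1 h2
      filter_upwards [h3] with x hx _ he
      exact hx (AffineSubspace.mem_perpBisector_iff_dist_eq.2 he)
  filter_upwards [h1] with x hx
  obtain ⟨m₀, hm₀⟩ := hne
  -- Only finitely many centres compete with `m₀`, so a nearest one exists.
  have hfin := hS.finite_special x (dist m₀ x + 1)
  obtain ⟨m, hm, hmin⟩ := Set.exists_min_image _ (fun m => dist m x) hfin ⟨m₀, hm₀, by linarith⟩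
  refine ⟨m, hm.1, fun m' hm' hne => ?_⟩
  have hle : dist m x ≤ dist m' x := by
    by_cases hd : dist m' x < dist m₀ x + 1
    · exact hmin m' ⟨hm', hd⟩
    · have := hm.2
      linarith
  rw [dist_comm m, dist_comm m'] at hle
  exact lt_of_le_of_ne hle (hx m hm.1 m' hm' hne.symm)

end Frames

/-! ### Behaviour of the geometry under isometries -/

section Equivariance

open InnerProductSpace

variable {d : ℕ} (G : Euc d ≃ᵃⁱ[ℝ] Euc d) {S : Set (Euc d)} {m x : Euc d}

theorem image_symm_image : G.symm '' (G '' S) = S := by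
  rw [Set.image_image]; simp

theorem PairCenter.image {R : ℝ} (h : PairCenter R S m) : PairCenter R (G '' S) (G m) := by
  obtain ⟨x, hx, y, hy, h⟩ := h
  refine ⟨G x, ⟨x, hx, rfl⟩, G y, ⟨y, hy, rfl⟩, ⟨x, hx, rfl⟩, ⟨y, hy, rfl⟩, G.injective.ne h.ne,
    ?_, ?_, ?_⟩
  · rw [← h.mid]
    exact (G.toAffineEquiv.map_midpoint x y).symm
  · rw [G.dist_map]; exact h.dist_lt
  · rintro _ ⟨z, hz, rfl⟩ hzm
    rw [G.dist_map] at hzm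
    rcases h.isolated z hz hzm with rfl | rfl
    · exact Or.inl rfl
    · exact Or.inr rfl

theorem pickVal_image {α β γ : Type*} [Inhabited γ] {S : Set α} (g : α → β) (p : β → Prop)
    (f : β → γ) : pickVal (g '' S) p f = pickVal S (p ∘ g) (f ∘ g) := by
  unfold pickVal
  congr 1
  funext b
  simp

theorem mem_shell_image {i : Fin d} : G x ∈ shell i (G m) ↔ x ∈ shell i m := by
  simp [shell]

theorem HasFrame.frameVec_image (h : HasFrame S m) :
    frameVec (G '' S) (G m) = fun i => G.linearIsometryEquiv (frameVec S m i) := by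
  funext i
  obtain ⟨z, hz, hz', hu⟩ := h.1 i
  have h1 : frameVec S m i = z - m := by
    refine pickVal_eq (f := fun z => z - m) hz hz' fun w hw hw' => ?_
    rw [hu w hw hw']
  have h2 : frameVec (G '' S) (G m) i = G z - G m := by
    refine pickVal_eq (f := fun z => z - G m) ⟨z, hz, rfl⟩ ((mem_shell_image G).2 hz') ?_
    rintro _ ⟨w, hw, rfl⟩ hw'
    rw [hu w hw ((mem_shell_image G).1 hw')]
  rw [h1, h2]
  exact (G.map_vsub z m).symm

theorem HasFrame.image (h : HasFrame S m) : HasFrame (G '' S) (G m) := by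
  refine ⟨fun i => ?_, ?_⟩
  · obtain ⟨z, hz, hz', hu⟩ := h.1 i
    refine ⟨G z, ⟨z, hz, rfl⟩, (mem_shell_image G).2 hz', ?_⟩
    rintro _ ⟨w, hw, rfl⟩ hw'
    rw [hu w hw ((mem_shell_image G).1 hw')]
  · rw [h.frameVec_image G]
    exact h.2.map' G.linearIsometryEquiv.toLinearEquiv.toLinearMap
      (LinearMap.ker_eq_bot.2 G.linearIsometryEquiv.injective)

theorem Special.image (h : Special S m) : Special (G '' S) (G m) := by
  refine ⟨h.center.image G, fun m' hm' hne => ?_, h.frame.image G⟩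
  have h1 := hm'.image G.symm
  rw [image_symm_image] at h1
  have h2 := h.separated _ h1 (fun he => hne (by rw [← he, G.apply_symm_apply]))
  rwa [← G.dist_map, G.apply_symm_apply] at h2

theorem special_image_iff : Special (G '' S) (G m) ↔ Special S m := by
  refine ⟨fun h => ?_, fun h => h.image G⟩
  have := h.image G.symm
  rwa [image_symm_image, G.symm_apply_apply] at this

theorem special_image_iff' {m' : Euc d} : Special (G '' S) m' ↔ ∃ m, Special S m ∧ G m = m' := by
  refine ⟨fun h => ⟨G.symm m', ?_, by simp⟩, fun ⟨m, h, e⟩ => e ▸ h.image G⟩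
  rw [← special_image_iff G]
  simpa using h

/-- Gram–Schmidt uses only inner products and linear combinations, so it commutes with all linear
isometries, including those that reverse orientation. -/
theorem gramSchmidt_map_linearIsometryEquiv (L : Euc d ≃ₗᵢ[ℝ] Euc d) (f : Fin d → Euc d) (n : Fin d) :
    gramSchmidt ℝ (fun i => L (f i)) n = L (gramSchmidt ℝ f n) := by
  induction n using WellFoundedLT.induction with
  | ind n ih =>
    have h1 := gramSchmidt_def'' ℝ (fun i => L (f i)) n
    have h2 := congrArg L (gramSchmidt_def'' ℝ f n)
    have h3 : ∑ i ∈ Finset.Iio n, ((inner ℝ (gramSchmidt ℝ (fun i => L (f i)) i) (L (f n)) : ℝ) /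
          (‖gramSchmidt ℝ (fun i => L (f i)) i‖ : ℝ) ^ 2) • gramSchmidt ℝ (fun i => L (f i)) i =
        L (∑ i ∈ Finset.Iio n, ((inner ℝ (gramSchmidt ℝ f i) (f n) : ℝ) /
          (‖gramSchmidt ℝ f i‖ : ℝ) ^ 2) • gramSchmidt ℝ f i) := by
      rw [map_sum]
      refine Finset.sum_congr rfl fun i hi => ?_
      rw [ih i (Finset.mem_Iio.1 hi), L.inner_map_map, L.norm_map, map_smul]
    rw [map_add] at h2
    have h4 := h1.symm.trans h2
    exact add_right_cancel (h4.trans (congrArg (L (gramSchmidt ℝ f n) + ·) h3.symm))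

theorem Special.basisVec_image (h : Special S m) (i : Fin d) :
    basisVec (G '' S) (G m) i = G.linearIsometryEquiv (basisVec S m i) := by
  rw [basisVec, basisVec, h.frame.frameVec_image G]
  simp only [gramSchmidtNormed]
  rw [gramSchmidt_map_linearIsometryEquiv, LinearIsometryEquiv.norm_map, map_smul]

theorem Special.toWorld_image (h : Special S m) :
    toWorld (G '' S) (G m) x = G (toWorld S m x) := by
  have h1 : G (toWorld S m x) - G m = G.linearIsometryEquiv (toWorld S m x - m) :=
    (G.map_vsub (toWorld S m x) m).symm
  rw [← sub_left_inj (a := G m), h1]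
  simp only [toWorld, add_sub_cancel_left, map_sum, map_smul, h.basisVec_image G]

/-- Local coordinates do not see the isometry, so a code that is read in them is the same before and
after it acts. -/
theorem Special.toLocal_image (h : Special S m) :
    toLocal (G '' S) (G m) (G x) = toLocal S m x := by
  have h1 : G x - G m = G.linearIsometryEquiv (x - m) := (G.map_vsub x m).symm
  simp only [toLocal, h.basisVec_image G, h1, LinearIsometryEquiv.inner_map_map]

theorem mem_cell_image : G x ∈ cell (G '' S) (G m) ↔ x ∈ cell S m := by
  constructor
  · intro h m' hm' hne
    have := h (G m') (hm'.image G) (G.injective.ne hne)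
    simpa using this
  · intro h m' hm' hne
    obtain ⟨m'', h2, rfl⟩ := (special_image_iff' G).1 hm'
    have := h m'' h2 (fun he => hne (by rw [he]))
    simpa using this

theorem radius_image : radius (G '' S) (G m) = radius S m := by
  rw [radius, pickVal_image]
  simp [radius, Function.comp_def]

theorem movePt_image {ρ ρ' : Euc d → ℝ} (hρ : ∀ m, Special S m → ρ' (G m) = ρ m) (hx : x ∈ S) :
    movePt (G '' S) ρ' (G x) = G (movePt S ρ x) := by
  rcases far_or_near S x with h | ⟨m, hm, hxm⟩
  · rw [movePt_of_far h, movePt_of_far]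
    intro m' hm'
    obtain ⟨m'', h2, rfl⟩ := (special_image_iff' G).1 hm'
    rw [G.dist_map]
    exact h m'' h2
  · rw [hm.movePt_eq hx hxm, (hm.image G).movePt_eq ⟨x, hx, rfl⟩ (by rwa [G.dist_map]), hρ m hm,
      G.dist_map]
    have h1 : G x - G m = G.linearIsometryEquiv (x - m) := (G.map_vsub x m).symm
    have h2 : G (m + (ρ m / dist x m) • (x - m)) - G m =
        G.linearIsometryEquiv ((m + (ρ m / dist x m) • (x - m)) - m) := (G.map_vsub _ m).symm
    rw [← sub_left_inj (a := G m), h2, h1, add_sub_cancel_left, add_sub_cancel_left, map_smul]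

theorem setRadius_image {ρ ρ' : Euc d → ℝ} (hρ : ∀ m, Special S m → ρ' (G m) = ρ m) :
    setRadius (G '' S) ρ' = G '' setRadius S ρ := by
  rw [setRadius, setRadius, Set.image_image, Set.image_image]
  exact Set.image_congr fun x hx => movePt_image G hρ hx

end Equivariance

/-! ### Measurability of the geometric constructions -/

namespace PointMeasure

open InnerProductSpace

variable {d : ℕ} {Ω : Type*} [MeasurableSpace Ω] {Z : Ω → PointMeasure d}

theorem measurable_midpoint {x y : Ω → Euc d} (hx : Measurable x) (hy : Measurable y) :
    Measurable fun ω => midpoint ℝ (x ω) (y ω) := by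
  simp only [midpoint_eq_smul_add]
  exact (hx.add hy).const_smul (⅟2 : ℝ)

theorem measurableSet_isolatedPair (hZ : Measurable Z) (R : ℝ) {m x y : Ω → Euc d}
    (hm : Measurable m) (hx : Measurable x) (hy : Measurable y) :
    MeasurableSet {ω | IsolatedPair R (Z ω).pts (m ω) (x ω) (y ω)} := by
  have : {ω | IsolatedPair R (Z ω).pts (m ω) (x ω) (y ω)} =
      {ω | x ω ∈ (Z ω).pts} ∩ ({ω | y ω ∈ (Z ω).pts} ∩ ({ω | x ω = y ω}ᶜ ∩
        ({ω | midpoint ℝ (x ω) (y ω) = m ω} ∩ ({ω | dist (x ω) (m ω) < 1 / 2} ∩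
          {ω | ∀ z ∈ (Z ω).pts, dist z (m ω) < R → z = x ω ∨ z = y ω})))) := by
    ext ω
    exact ⟨fun h => ⟨h.left_mem, h.right_mem, h.ne, h.mid, h.dist_lt, h.isolated⟩,
      fun ⟨h1, h2, h3, h4, h5, h6⟩ => ⟨h1, h2, h3, h4, h5, h6⟩⟩
  rw [this]
  refine (measurableSet_mem_pts hZ hx).inter ((measurableSet_mem_pts hZ hy).inter
    ((measurableSet_eq_fun hx hy).compl.inter ((measurableSet_eq_fun (measurable_midpoint hx hy)
    hm).inter ((measurableSet_lt (hx.dist hm) measurable_const).inter ?_))))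
  refine measurableSet_forall_pts hZ (p := fun ω z => dist z (m ω) < R → z = x ω ∨ z = y ω) ?_
  refine MeasurableSet.imp ?_ ?_
  · exact measurableSet_lt (measurable_snd.dist (hm.comp measurable_fst)) measurable_const
  · exact (measurableSet_eq_fun measurable_snd (hx.comp measurable_fst)).union
      (measurableSet_eq_fun measurable_snd (hy.comp measurable_fst))

/-- A measurable condition holds for some pair of points. -/
theorem measurableSet_exists_pts_pair (hZ : Measurable Z) {p : Ω → Euc d → Euc d → Prop}
    (hp : MeasurableSet {q : (Ω × Euc d) × Euc d | p q.1.1 q.1.2 q.2}) :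
    MeasurableSet {ω | ∃ x ∈ (Z ω).pts, ∃ y ∈ (Z ω).pts, p ω x y} :=
  measurableSet_exists_pts hZ (p := fun ω x => ∃ y ∈ (Z ω).pts, p ω x y)
    (measurableSet_exists_pts (Z := fun q : Ω × Euc d => Z q.1) (hZ.comp measurable_fst)
      (p := fun q y => p q.1 q.2 y) hp)

theorem measurableSet_forall_pts_pair (hZ : Measurable Z) {p : Ω → Euc d → Euc d → Prop}
    (hp : MeasurableSet {q : (Ω × Euc d) × Euc d | p q.1.1 q.1.2 q.2}) :
    MeasurableSet {ω | ∀ x ∈ (Z ω).pts, ∀ y ∈ (Z ω).pts, p ω x y} :=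
  measurableSet_forall_pts hZ (p := fun ω x => ∀ y ∈ (Z ω).pts, p ω x y)
    (measurableSet_forall_pts (Z := fun q : Ω × Euc d => Z q.1) (hZ.comp measurable_fst)
      (p := fun q y => p q.1 q.2 y) hp)

theorem measurableSet_pairCenter (hZ : Measurable Z) (R : ℝ) {m : Ω → Euc d} (hm : Measurable m) :
    MeasurableSet {ω | PairCenter R (Z ω).pts (m ω)} :=
  measurableSet_exists_pts_pair hZ (measurableSet_isolatedPair
    (Z := fun q : (Ω × Euc d) × Euc d => Z q.1.1) (hZ.comp measurable_fst.fst) R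
    (hm.comp measurable_fst.fst) measurable_fst.snd measurable_snd)

theorem measurableSet_shell (i : Fin d) {m z : Ω → Euc d} (hm : Measurable m) (hz : Measurable z) :
    MeasurableSet {ω | z ω ∈ shell i (m ω)} :=
  (measurableSet_le measurable_const (hz.dist hm)).inter
    (measurableSet_lt (hz.dist hm) measurable_const)

theorem measurable_frameVec (hZ : Measurable Z) {m : Ω → Euc d} (hm : Measurable m) (i : Fin d) :
    Measurable fun ω => frameVec (Z ω).pts (m ω) i :=
  measurable_pickVal hZ (p := fun ω z => z ∈ shell i (m ω))
    (measurableSet_shell i (hm.comp measurable_fst) measurable_snd)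
    (f := fun ω z => z - m ω) (measurable_snd.sub (hm.comp measurable_fst))

theorem measurableSet_hasFrame (hZ : Measurable Z) {m : Ω → Euc d} (hm : Measurable m) :
    MeasurableSet {ω | HasFrame (Z ω).pts (m ω)} := by
  have hsplit : {ω | HasFrame (Z ω).pts (m ω)} = {ω | ∀ i, ∃ z ∈ (Z ω).pts, z ∈ shell i (m ω) ∧
      ∀ w ∈ (Z ω).pts, w ∈ shell i (m ω) → w = z} ∩
      {ω | LinearIndependent ℝ (frameVec (Z ω).pts (m ω))} := rfl
  rw [hsplit]
  refine MeasurableSet.inter ?_ ?_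
  · have : ∀ i : Fin d, MeasurableSet {ω | ∃ z ∈ (Z ω).pts, z ∈ shell i (m ω) ∧
        ∀ w ∈ (Z ω).pts, w ∈ shell i (m ω) → w = z} := by
      intro i
      refine measurableSet_exists_pts hZ (p := fun ω z => z ∈ shell i (m ω) ∧
        ∀ w ∈ (Z ω).pts, w ∈ shell i (m ω) → w = z) ?_
      refine (measurableSet_shell i (hm.comp measurable_fst) measurable_snd).inter ?_
      refine measurableSet_forall_pts (Z := fun q : Ω × Euc d => Z q.1) (hZ.comp measurable_fst)
        (p := fun q w => w ∈ shell i (m q.1) → w = q.2) ?_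
      exact (measurableSet_shell i (hm.comp measurable_fst.fst) measurable_snd).imp
        (measurableSet_eq_fun measurable_snd measurable_fst.snd)
    rw [Set.ofPred_forall]
    exact MeasurableSet.iInter this
  · have h1 : IsOpen {f : Fin d → Euc d | LinearIndependent ℝ f} :=
      isOpen_setOfPred_linearIndependent
    exact (measurable_pi_lambda (fun ω => frameVec (Z ω).pts (m ω))
      fun i => measurable_frameVec hZ hm i) h1.measurableSet

/-- The competitors range over an uncountable set, but all of them are midpoints of pairs of points,
so the quantifier runs over pairs instead. The same device serves for cells. -/
theorem measurableSet_special (hZ : Measurable Z) {m : Ω → Euc d} (hm : Measurable m) :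
    MeasurableSet {ω | Special (Z ω).pts (m ω)} := by
  have : {ω | Special (Z ω).pts (m ω)} = {ω | PairCenter 6 (Z ω).pts (m ω)} ∩
      ({ω | ∀ x ∈ (Z ω).pts, ∀ y ∈ (Z ω).pts, PairCenter 2 (Z ω).pts (midpoint ℝ x y) →
        ¬ midpoint ℝ x y = m ω → (d : ℝ) + 20 ≤ dist (midpoint ℝ x y) (m ω)} ∩
        {ω | HasFrame (Z ω).pts (m ω)}) := by
    ext ω
    constructor
    · exact fun h => ⟨h.center, fun x _ y _ h1 h2 => h.separated _ h1 h2, h.frame⟩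
    · rintro ⟨h1, h2, h3⟩
      refine ⟨h1, fun m' hm' hne => ?_, h3⟩
      obtain ⟨x, hx, y, hy, h⟩ := id hm'
      have := h2 x hx y hy
      rw [h.mid] at this
      exact this hm' hne
  rw [this]
  refine (measurableSet_pairCenter hZ 6 hm).inter (MeasurableSet.inter ?_
    (measurableSet_hasFrame hZ hm))
  refine measurableSet_forall_pts_pair hZ (p := fun ω x y =>
    PairCenter 2 (Z ω).pts (midpoint ℝ x y) → ¬ midpoint ℝ x y = m ω →
      (d : ℝ) + 20 ≤ dist (midpoint ℝ x y) (m ω)) ?_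
  have hmid : Measurable fun q : (Ω × Euc d) × Euc d => midpoint ℝ q.1.2 q.2 :=
    measurable_midpoint measurable_fst.snd measurable_snd
  have hm' : Measurable fun q : (Ω × Euc d) × Euc d => m q.1.1 := hm.comp measurable_fst.fst
  exact (measurableSet_pairCenter (hZ.comp measurable_fst.fst) 2 hmid).imp
    ((measurableSet_eq_fun hmid hm').compl.imp (measurableSet_le measurable_const (hmid.dist hm')))

theorem measurableSet_near_special (hZ : Measurable Z) {x : Ω → Euc d} (hx : Measurable x) :
    MeasurableSet {q : Ω × Euc d | Special (Z q.1).pts (midpoint ℝ (x q.1) q.2) ∧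
      dist (x q.1) (midpoint ℝ (x q.1) q.2) < 1 / 2} := by
  have hmid : Measurable fun q : Ω × Euc d => midpoint ℝ (x q.1) q.2 :=
    measurable_midpoint (hx.comp measurable_fst) measurable_snd
  exact (measurableSet_special (hZ.comp measurable_fst) hmid).inter
    (measurableSet_lt ((hx.comp measurable_fst).dist hmid) measurable_const)

theorem measurableSet_inSpecialPair (hZ : Measurable Z) {x : Ω → Euc d} (hx : Measurable x) :
    MeasurableSet {ω | InSpecialPair (Z ω).pts (x ω)} :=
  measurableSet_exists_pts hZ (measurableSet_near_special hZ hx)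

theorem measurable_centerOf (hZ : Measurable Z) {x : Ω → Euc d} (hx : Measurable x) :
    Measurable fun ω => centerOf (Z ω).pts (x ω) :=
  measurable_pickVal hZ (p := fun ω y => Special (Z ω).pts (midpoint ℝ (x ω) y) ∧
    dist (x ω) (midpoint ℝ (x ω) y) < 1 / 2) (measurableSet_near_special hZ hx)
    (f := fun ω y => midpoint ℝ (x ω) y)
    (measurable_midpoint (hx.comp measurable_fst) measurable_snd)

theorem measurable_radius (hZ : Measurable Z) {m : Ω → Euc d} (hm : Measurable m) :
    Measurable fun ω => radius (Z ω).pts (m ω) :=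
  measurable_pickVal hZ (p := fun ω x => dist x (m ω) < 1 / 2)
    (measurableSet_lt (measurable_snd.dist (hm.comp measurable_fst)) measurable_const)
    (f := fun ω x => dist x (m ω)) (measurable_snd.dist (hm.comp measurable_fst))

theorem measurable_movePt (hZ : Measurable Z) {x : Ω → Euc d} (hx : Measurable x)
    {ρ : Ω → Euc d → ℝ} (hρ : Measurable fun q : Ω × Euc d => ρ q.1 q.2) :
    Measurable fun ω => movePt (Z ω).pts (ρ ω) (x ω) := by
  classical
  unfold movePt
  have hc := measurable_centerOf hZ hx
  refine Measurable.ite (measurableSet_inSpecialPair hZ hx) ?_ hx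
  have h1 : Measurable fun ω => ρ ω (centerOf (Z ω).pts (x ω)) / dist (x ω) (centerOf (Z ω).pts (x ω)) :=
    (hρ.comp (measurable_id.prodMk hc)).div (hx.dist hc)
  exact hc.add (h1.smul (hx.sub hc))

theorem measurable_ofSet_setRadius (hZ : Measurable Z)
    {ρ : Ω → Euc d → ℝ} (hρ : Measurable fun q : Ω × Euc d => ρ q.1 q.2)
    (hgood : ∀ ω, GoodRadii (Z ω).pts (ρ ω)) :
    Measurable fun ω => ofSet (setRadius (Z ω).pts (ρ ω)) := by
  have h := measurable_ofSet_image hZ (p := fun _ _ => True) MeasurableSet.univ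
    (f := fun ω x => movePt (Z ω).pts (ρ ω) x)
    (measurable_movePt (Z := fun q : Ω × Euc d => Z q.1) (hZ.comp measurable_fst) measurable_snd
      (ρ := fun q => ρ q.1) (hρ.comp (measurable_fst.fst.prodMk measurable_snd)))
    (fun ω x hx y hy he => (hgood ω).injOn_movePt hx.1 hy.1 he)
  simpa [setRadius] using h

theorem measurable_gramSchmidt (n : Fin d) :
    Measurable fun f : Fin d → Euc d => gramSchmidt ℝ f n := by
  induction n using WellFoundedLT.induction with
  | ind n ih =>
    have h1 : (fun f : Fin d → Euc d => gramSchmidt ℝ f n) = fun f =>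
        f n - ∑ i ∈ Finset.Iio n, ((inner ℝ (gramSchmidt ℝ f i) (f n) : ℝ) /
          (‖gramSchmidt ℝ f i‖ : ℝ) ^ 2) • gramSchmidt ℝ f i := by
      funext f
      exact eq_sub_of_add_eq (gramSchmidt_def'' ℝ f n).symm
    rw [h1]
    refine (measurable_pi_apply n).sub (Finset.measurable_fun_sum _ fun i hi => ?_)
    have h2 := ih i (Finset.mem_Iio.1 hi)
    exact ((h2.inner (measurable_pi_apply n)).div (h2.norm.pow_const 2)).smul h2

theorem measurable_basisVec (hZ : Measurable Z) {m : Ω → Euc d} (hm : Measurable m) (i : Fin d) :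
    Measurable fun ω => basisVec (Z ω).pts (m ω) i := by
  have h1 : Measurable fun ω => gramSchmidt ℝ (frameVec (Z ω).pts (m ω)) i :=
    (measurable_gramSchmidt i).comp (measurable_pi_lambda (fun ω => frameVec (Z ω).pts (m ω))
      fun i => measurable_frameVec hZ hm i)
  unfold basisVec gramSchmidtNormed
  exact (h1.norm.inv).smul h1

theorem measurable_toWorld (hZ : Measurable Z) {m x : Ω → Euc d} (hm : Measurable m)
    (hx : Measurable x) : Measurable fun ω => toWorld (Z ω).pts (m ω) (x ω) := by
  unfold toWorld
  refine hm.add (Finset.measurable_fun_sum _ fun i _ => ?_)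
  have : Measurable fun ω => x ω i := (by fun_prop : Measurable fun y : Euc d => y i).comp hx
  exact this.smul (measurable_basisVec hZ hm i)

theorem measurable_toLocal (hZ : Measurable Z) {m y : Ω → Euc d} (hm : Measurable m)
    (hy : Measurable y) : Measurable fun ω => toLocal (Z ω).pts (m ω) (y ω) := by
  unfold toLocal
  refine (WithLp.measurable_toLp 2 _).comp (measurable_pi_lambda _ fun i => ?_)
  exact (measurable_basisVec hZ hm i).inner (hy.sub hm)

theorem measurableSet_cell (hZ : Measurable Z) {m x : Ω → Euc d} (hm : Measurable m)
    (hx : Measurable x) : MeasurableSet {ω | x ω ∈ cell (Z ω).pts (m ω)} := by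
  have : {ω | x ω ∈ cell (Z ω).pts (m ω)} = {ω | ∀ a ∈ (Z ω).pts, ∀ b ∈ (Z ω).pts,
      Special (Z ω).pts (midpoint ℝ a b) → ¬ midpoint ℝ a b = m ω →
        dist (x ω) (m ω) < dist (x ω) (midpoint ℝ a b)} := by
    ext ω
    constructor
    · exact fun h a _ b _ h1 h2 => h _ h1 h2
    · intro h m' hm' hne
      obtain ⟨a, ha, b, hb, hp⟩ := hm'.center
      have := h a ha b hb
      rw [hp.mid] at this
      exact this hm' hne
  rw [this]
  refine measurableSet_forall_pts_pair hZ (p := fun ω a b =>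
    Special (Z ω).pts (midpoint ℝ a b) → ¬ midpoint ℝ a b = m ω →
      dist (x ω) (m ω) < dist (x ω) (midpoint ℝ a b)) ?_
  have hmid : Measurable fun q : (Ω × Euc d) × Euc d => midpoint ℝ q.1.2 q.2 :=
    measurable_midpoint measurable_fst.snd measurable_snd
  have hm' : Measurable fun q : (Ω × Euc d) × Euc d => m q.1.1 := hm.comp measurable_fst.fst
  have hx' : Measurable fun q : (Ω × Euc d) × Euc d => x q.1.1 := hx.comp measurable_fst.fst
  exact (measurableSet_special (hZ.comp measurable_fst.fst) hmid).imp
    ((measurableSet_eq_fun hmid hm').compl.imp (measurableSet_lt (hx'.dist hm') (hx'.dist hmid)))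

end PointMeasure

/-! ### Polar coordinates and the law of the radius -/

section Polar

/-- The law of the norm of a uniform point of the ball of radius `1 / 2`. -/
def radiusLaw (d : ℕ) : Measure ℝ :=
  (Measure.volumeIoiPow (d - 1) (Set.Iio ⟨1 / 2, by norm_num⟩))⁻¹ •
    ((Measure.volumeIoiPow (d - 1)).restrict (Set.Iio ⟨1 / 2, by norm_num⟩)).map Subtype.val

variable {d : ℕ}

theorem volumeIoiPow_half_ne_zero (n : ℕ) :
    Measure.volumeIoiPow n (Set.Iio ⟨1 / 2, by norm_num⟩) ≠ 0 := by
  rw [Measure.volumeIoiPow_apply_Iio]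
  exact (ENNReal.ofReal_pos.2 (by positivity)).ne'

theorem volumeIoiPow_half_ne_top (n : ℕ) :
    Measure.volumeIoiPow n (Set.Iio ⟨1 / 2, by norm_num⟩) ≠ ∞ := by
  rw [Measure.volumeIoiPow_apply_Iio]
  exact ENNReal.ofReal_ne_top

instance : IsProbabilityMeasure (radiusLaw d) := by
  refine ⟨?_⟩
  rw [radiusLaw, Measure.smul_apply, Measure.map_apply measurable_subtype_coe MeasurableSet.univ,
    Set.preimage_univ, Measure.restrict_apply_univ, smul_eq_mul]
  exact ENNReal.inv_mul_cancel (volumeIoiPow_half_ne_zero _) (volumeIoiPow_half_ne_top _)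

theorem ae_radiusLaw : ∀ᵐ u ∂radiusLaw d, u ∈ Set.Ioo (0 : ℝ) (1 / 2) := by
  refine Measure.ae_smul_measure ?_ _
  refine (ae_map_iff (p := fun u => u ∈ Set.Ioo (0 : ℝ) (1 / 2))
    measurable_subtype_coe.aemeasurable measurableSet_Ioo).2 ?_
  filter_upwards [ae_restrict_mem measurableSet_Iio] with t ht
  exact ⟨t.2, ht⟩

instance : NullSingletonClass (radiusLaw d) := by
  refine ⟨fun x => ?_⟩
  rw [radiusLaw, Measure.smul_apply, Measure.map_apply measurable_subtype_coe
    (measurableSet_singleton x), smul_eq_mul]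
  have h1 : Measure.volumeIoiPow (d - 1) (Subtype.val ⁻¹' {x}) = 0 := by
    refine withDensity_absolutelyContinuous _ _ ?_
    rw [comap_subtype_coe_apply measurableSet_Ioi]
    exact measure_mono_null (Set.image_preimage_subset _ _) (measure_singleton x)
  rw [nonpos_iff_eq_zero.1 ((Measure.restrict_apply_le _ _).trans_eq h1), mul_zero]

theorem lintegral_radiusLaw {f : ℝ → ℝ≥0∞} (hf : Measurable f) :
    ∫⁻ t in Set.Iio (⟨1 / 2, by norm_num⟩ : Set.Ioi (0 : ℝ)), f t ∂Measure.volumeIoiPow (d - 1) =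
      Measure.volumeIoiPow (d - 1) (Set.Iio ⟨1 / 2, by norm_num⟩) * ∫⁻ u, f u ∂radiusLaw d := by
  rw [radiusLaw, lintegral_smul_measure, lintegral_map hf measurable_subtype_coe, smul_eq_mul,
    ← mul_assoc, ENNReal.mul_inv_cancel (volumeIoiPow_half_ne_zero _) (volumeIoiPow_half_ne_top _),
    one_mul]

theorem lintegral_polar (hd : 1 ≤ d) {f : Euc d → ℝ≥0∞} (hf : Measurable f) :
    ∫⁻ v, f v = ∫⁻ w : Metric.sphere (0 : Euc d) 1, ∫⁻ t : Set.Ioi (0 : ℝ),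
      f ((t : ℝ) • (w : Euc d)) ∂Measure.volumeIoiPow (d - 1)
        ∂(volume : Measure (Euc d)).toSphere := by
  have hfin : Module.finrank ℝ (Euc d) = d := finrank_euclideanSpace_fin
  have : Nontrivial (Euc d) := Module.nontrivial_of_finrank_pos (R := ℝ) (by omega)
  have h1 := (volume : Measure (Euc d)).measurePreserving_homeomorphUnitSphereProd
  rw [hfin] at h1
  have hg : Measurable fun p : Metric.sphere (0 : Euc d) 1 × Set.Ioi (0 : ℝ) =>
      f ((p.2 : ℝ) • (p.1 : Euc d)) :=
    hf.comp ((measurable_subtype_coe.comp measurable_snd).smul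
      (measurable_subtype_coe.comp measurable_fst))
  calc ∫⁻ v, f v = ∫⁻ v : ({0}ᶜ : Set (Euc d)), f v ∂(Measure.comap Subtype.val volume) := by
        rw [lintegral_subtype_comap (measurableSet_singleton _).compl f, restrict_compl_singleton]
    _ = ∫⁻ p : Metric.sphere (0 : Euc d) 1 × Set.Ioi (0 : ℝ), f ((p.2 : ℝ) • (p.1 : Euc d))
          ∂((volume : Measure (Euc d)).toSphere.prod (Measure.volumeIoiPow (d - 1))) := by
        rw [← h1.lintegral_comp hg]
        refine lintegral_congr fun v => ?_
        have hv : (v : Euc d) ≠ 0 := v.2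
        simp [smul_smul, hv]
    _ = _ := lintegral_prod _ hg.aemeasurable

/-- Resampling the norm of a uniform point of the ball of radius `1 / 2`. -/
theorem lintegral_ball_resample (hd : 1 ≤ d) {f : Euc d → ℝ≥0∞} (hf : Measurable f) :
    ∫⁻ v in Metric.ball (0 : Euc d) (1 / 2), ∫⁻ u, f ((u / ‖v‖) • v) ∂radiusLaw d =
      ∫⁻ v in Metric.ball (0 : Euc d) (1 / 2), f v := by
  have hm : Measurable fun v : Euc d => ∫⁻ u, f ((u / ‖v‖) • v) ∂radiusLaw d := by
    refine Measurable.lintegral_prod_right' (f := fun p : Euc d × ℝ => f ((p.2 / ‖p.1‖) • p.1)) ?_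
    exact hf.comp ((measurable_snd.div measurable_fst.norm).smul measurable_fst)
  have key : ∀ g : Euc d → ℝ≥0∞, Measurable g → ∫⁻ v in Metric.ball (0 : Euc d) (1 / 2), g v =
      ∫⁻ w : Metric.sphere (0 : Euc d) 1, ∫⁻ t in Set.Iio (⟨1 / 2, by norm_num⟩ : Set.Ioi (0 : ℝ)),
      g ((t : ℝ) • (w : Euc d)) ∂Measure.volumeIoiPow (d - 1)
        ∂(volume : Measure (Euc d)).toSphere := by
    intro g hg
    rw [← lintegral_indicator Metric.isOpen_ball.measurableSet,
      lintegral_polar hd (hg.indicator Metric.isOpen_ball.measurableSet)]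
    refine lintegral_congr fun w => ?_
    rw [← lintegral_indicator measurableSet_Iio]
    refine lintegral_congr fun t => ?_
    have hw : ‖(w : Euc d)‖ = 1 := by simp
    have ht : (0 : ℝ) < t := t.2
    have : (t : ℝ) • (w : Euc d) ∈ Metric.ball (0 : Euc d) (1 / 2) ↔
        t ∈ Set.Iio (⟨1 / 2, by norm_num⟩ : Set.Ioi (0 : ℝ)) := by
      rw [mem_ball_zero_iff, norm_smul, hw, mul_one, Real.norm_of_nonneg ht.le, Set.mem_Iio,
        ← Subtype.coe_lt_coe]
    by_cases h : t ∈ Set.Iio (⟨1 / 2, by norm_num⟩ : Set.Ioi (0 : ℝ))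
    · rw [Set.indicator_of_mem h, Set.indicator_of_mem (this.2 h)]
    · rw [Set.indicator_of_notMem h, Set.indicator_of_notMem (fun h' => h (this.1 h'))]
  rw [key _ hm, key _ hf]
  refine lintegral_congr fun w => ?_
  have hw : ‖(w : Euc d)‖ = 1 := by simp
  rw [lintegral_radiusLaw (f := fun t => f (t • (w : Euc d)))
    (hf.comp (measurable_id.smul measurable_const))]
  -- On a ray the resampled integral does not depend on `t`, so integration over t < 1 / 2 only
  -- contributes the mass by which `radiusLaw` is normalised.
  have : ∀ t : Set.Ioi (0 : ℝ), ∫⁻ u, f ((u / ‖(t : ℝ) • (w : Euc d)‖) • (t : ℝ) • (w : Euc d))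
      ∂radiusLaw d = ∫⁻ u, f (u • (w : Euc d)) ∂radiusLaw d := by
    intro t
    refine lintegral_congr fun u => ?_
    have ht : (0 : ℝ) < t := t.2
    rw [norm_smul, hw, mul_one, Real.norm_of_nonneg ht.le, smul_smul, div_mul_cancel₀ _ ht.ne']
  simp_rw [this]
  rw [setLIntegral_const, mul_comm]

/-- Integration in terms of the midpoint and the half difference. -/
theorem exists_lintegral_midpoint (d : ℕ) : ∃ c : ℝ≥0∞, ∀ f : Euc d → Euc d → ℝ≥0∞,
    Measurable (fun p : Euc d × Euc d => f p.1 p.2) →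
    ∫⁻ x, ∫⁻ y, f x y = c * ∫⁻ m, ∫⁻ v, f (m + v) (m - v) := by
  -- The constant is the Jacobian 2 ^ d of y = x - 2v for fixed x; the translation x = m + v then
  -- costs nothing.
  refine ⟨ENNReal.ofReal |((2 : ℝ)⁻¹ ^ Module.finrank ℝ (Euc d))⁻¹|, fun f hf => ?_⟩
  have h1 : ∀ x, ∫⁻ y, f x y = ENNReal.ofReal |((2 : ℝ)⁻¹ ^ Module.finrank ℝ (Euc d))⁻¹| *
      ∫⁻ v, f x (x - (2 : ℝ) • v) := by
    intro x
    have hfx : Measurable fun y => f x y := hf.comp measurable_prodMk_left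
    have hg : Measurable fun w : Euc d => f x (x - (2 : ℝ) • w) :=
      hfx.comp (measurable_const.sub (measurable_id.const_smul (2 : ℝ)))
    rw [← lintegral_sub_left_eq_self _ x, ← smul_eq_mul, ← lintegral_smul_measure,
      ← Measure.map_addHaar_smul volume (r := (2 : ℝ)⁻¹) (by norm_num),
      lintegral_map hg (measurable_const_smul _)]
    simp
  have hm2 : Measurable fun p : Euc d × Euc d => f p.1 (p.1 - (2 : ℝ) • p.2) :=
    hf.comp (measurable_fst.prodMk (measurable_fst.sub (measurable_snd.const_smul (2 : ℝ))))
  have hm3 : Measurable fun p : Euc d × Euc d => f (p.1 + p.2) (p.1 - p.2) :=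
    hf.comp ((measurable_fst.add measurable_snd).prodMk (measurable_fst.sub measurable_snd))
  simp_rw [h1]
  rw [lintegral_const_mul _ hm2.lintegral_prod_right', lintegral_lintegral_swap
      (f := fun x v => f x (x - (2 : ℝ) • v)) hm2.aemeasurable,
    lintegral_lintegral_swap (f := fun m v => f (m + v) (m - v)) hm3.aemeasurable]
  congr 1
  refine lintegral_congr fun v => ?_
  rw [← lintegral_add_right_eq_self _ v]
  refine lintegral_congr fun m => ?_
  congr 1
  module

end Polar

/-! ### Changing the radius of a single pair -/

section Resample

variable {d : ℕ}

/-- Force a real number into the interval of admissible radii. -/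
def clipRadius (u : ℝ) : ℝ :=
  open Classical in if u ∈ Set.Ioo (0 : ℝ) (1 / 2) then u else 1 / 4

theorem clipRadius_mem (u : ℝ) : clipRadius u ∈ Set.Ioo (0 : ℝ) (1 / 2) := by
  unfold clipRadius
  split_ifs with h
  · exact h
  · norm_num

theorem clipRadius_of_mem {u : ℝ} (h : u ∈ Set.Ioo (0 : ℝ) (1 / 2)) : clipRadius u = u :=
  if_pos h

theorem measurable_clipRadius : Measurable clipRadius :=
  Measurable.ite measurableSet_Ioo measurable_id measurable_const

/-- New radii for the pairs with centres in `K`. -/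
def radiiOn (K : Set (Euc d)) (S : Set (Euc d)) (ρ : Euc d → ℝ) (m : Euc d) : ℝ :=
  open Classical in if m ∈ K then ρ m else radius S m

theorem goodRadii_radiiOn {K S : Set (Euc d)} {ρ : Euc d → ℝ} (h : GoodRadii S ρ) :
    GoodRadii S (radiiOn K S ρ) := by
  intro m hm
  unfold radiiOn
  split_ifs
  · exact h m hm
  · exact goodRadii_radius S m hm

theorem goodRadii_clipRadius (S : Set (Euc d)) (f : Euc d → ℝ) :
    GoodRadii S (fun m => clipRadius (f m)) := fun _ _ => clipRadius_mem _

theorem movePt_eq_self {S : Set (Euc d)} {ρ : Euc d → ℝ} {x : Euc d} (hx : x ∈ S)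
    (h : ∀ m, Special S m → dist x m < 1 / 2 → ρ m = radius S m) : movePt S ρ x = x := by
  rcases far_or_near S x with h' | ⟨m, hm, hxm⟩
  · exact movePt_of_far h'
  · obtain ⟨y, hy, hp⟩ := hm.partner hx hxm
    rw [hm.movePt_eq hx hxm, h m hm hxm, hm.radius_eq hx hxm,
      div_self (dist_pos.2 hp.left_ne).ne', one_smul]
    abel

theorem setRadius_radiiOn_of_forall_notMem {K S : Set (Euc d)} {ρ : Euc d → ℝ}
    (h : ∀ m, Special S m → m ∉ K) : setRadius S (radiiOn K S ρ) = S := by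
  have : ∀ x ∈ S, movePt S (radiiOn K S ρ) x = x := fun x hx =>
    movePt_eq_self hx fun m hm _ => by rw [radiiOn, if_neg (h m hm)]
  rw [setRadius, Set.image_congr this, Set.image_id']

/-- The pair `m ± v` added to `T` is special, and disjoint from `T`. -/
structure SpecialPair (T : Set (Euc d)) (m v : Euc d) : Prop where
  special : Special (insert (m + v) (insert (m - v) T)) m
  left : m + v ∉ T
  right : m - v ∉ T

namespace SpecialPair

variable {T K : Set (Euc d)} {m v : Euc d}

/-- The set `K` is too small for a second special centre. A moved point of `T` would therefore
belong to the pair at `m` and equal m + v or m - v, which are not in `T`. -/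
theorem setRadius_eq (h : SpecialPair T m v) (hv : v ≠ 0) (hv' : ‖v‖ < 1 / 2) {ρ : Euc d → ℝ}
    (hm : m ∈ K) (hK : ∀ a ∈ K, ∀ b ∈ K, dist a b < d + 20) :
    setRadius (insert (m + v) (insert (m - v) T))
      (radiiOn K (insert (m + v) (insert (m - v) T)) ρ) =
      insert (m + (ρ m / ‖v‖) • v) (insert (m - (ρ m / ‖v‖) • v) T) := by
  set S := insert (m + v) (insert (m - v) T) with hS
  have h1 : dist (m + v) m = ‖v‖ := by simp
  have h2 : dist (m - v) m = ‖v‖ := by simp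
  have hmem1 : m + v ∈ S := Set.mem_insert _ _
  have hmem2 : m - v ∈ S := Set.mem_insert_of_mem _ (Set.mem_insert _ _)
  have hne : m - v ≠ m + v := by
    intro he
    have : (2 : ℝ) • v = 0 := by
      have := sub_eq_zero.2 he
      rw [← neg_eq_zero, ← this]; module
    exact hv (by simpa using this)
  have h4 : ∀ z ∈ T, movePt S (radiiOn K S ρ) z = z := by
    intro z hz
    have hzS : z ∈ S := Set.mem_insert_of_mem _ (Set.mem_insert_of_mem _ hz)
    refine movePt_eq_self hzS fun m' hm' hzm' => ?_
    have : m' ∉ K := by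
      intro hm'K
      have he : m' = m := h.special.unique hm' (hK _ hm'K _ hm)
      subst he
      obtain ⟨y, hy, hp⟩ := h.special.partner hmem1 (by rw [h1]; exact hv')
      have h5 : y = m' - v := by
        rcases hp.isolated _ hmem2 (by rw [h2]; linarith) with h6 | h6
        · exact absurd h6 hne
        · exact h6.symm
      rcases hp.isolated z hzS (by linarith) with h6 | h6
      · exact h.left (h6 ▸ hz)
      · exact h.right (h5 ▸ h6 ▸ hz)
    rw [radiiOn, if_neg this]
  conv_lhs => rw [setRadius, hS, Set.image_insert_eq, Set.image_insert_eq, ← hS]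
  rw [Set.image_congr h4, Set.image_id', h.special.movePt_eq hmem1 (by rw [h1]; exact hv'),
    h.special.movePt_eq hmem2 (by rw [h2]; exact hv'), h1, h2, radiiOn, if_pos hm]
  congr 2
  · simp
  · module

theorem smul (h : SpecialPair T m v) (hv : v ≠ 0) (hv' : ‖v‖ < 1 / 2) {u : ℝ}
    (hu : u ∈ Set.Ioo (0 : ℝ) (1 / 2)) : SpecialPair T m ((u / ‖v‖) • v) := by
  have hd : (0 : ℝ) ≤ d := Nat.cast_nonneg d
  have h0 := h.setRadius_eq hv hv' (K := {m}) (ρ := fun _ => u) rfl (by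
    rintro a rfl b rfl; rw [dist_self]; linarith)
  have hg : GoodRadii (insert (m + v) (insert (m - v) T))
      (radiiOn {m} (insert (m + v) (insert (m - v) T)) fun _ => u) :=
    goodRadii_radiiOn fun _ _ => hu
  have hnv : 0 < ‖v‖ := norm_pos_iff.2 hv
  have hnorm : ‖(u / ‖v‖) • v‖ = u := by
    rw [norm_smul, Real.norm_of_nonneg (div_nonneg hu.1.le hnv.le), div_mul_cancel₀ _ hnv.ne']
  have key : ∀ z ∈ T, 1 / 2 ≤ dist z m := by
    intro z hz
    by_contra hlt
    push Not at hlt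
    have hmem1 : m + v ∈ insert (m + v) (insert (m - v) T) := Set.mem_insert _ _
    obtain ⟨y, hy, hp⟩ := h.special.partner hmem1 (by simpa using hv')
    have h5 : m + v = z ∨ y = z := by
      rcases hp.isolated z (Set.mem_insert_of_mem _ (Set.mem_insert_of_mem _ hz)) (by linarith)
        with h6 | h6
      · exact Or.inl h6.symm
      · exact Or.inr h6.symm
    rcases h5 with rfl | rfl
    · exact h.left hz
    · have h7 : m - v = y := by
        have := hp.mid
        rw [midpoint_eq_smul_add, invOf_eq_inv] at this
        have h8 : y = (2 : ℝ) • ((2 : ℝ)⁻¹ • (m + v + y)) - (m + v) := by module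
        rw [h8, this]; module
      exact h.right (h7 ▸ hz)
  refine ⟨?_, fun hz => ?_, fun hz => ?_⟩
  · rw [← h0]
    exact hg.special_iff.2 h.special
  · have := key _ hz
    rw [dist_eq_norm, add_sub_cancel_left, hnorm] at this
    exact absurd hu.2 (not_lt.2 this)
  · have := key _ hz
    rw [dist_eq_norm, sub_sub_cancel_left, norm_neg, hnorm] at this
    exact absurd hu.2 (not_lt.2 this)

/-- The condition is constant along rays inside the ball, so the norm of `v` can be resampled
without affecting the indicator of a special pair. -/
theorem smul_iff (hv : v ≠ 0) (hv' : ‖v‖ < 1 / 2) {u : ℝ} (hu : u ∈ Set.Ioo (0 : ℝ) (1 / 2)) :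
    SpecialPair T m ((u / ‖v‖) • v) ↔ SpecialPair T m v := by
  refine ⟨fun h => ?_, fun h => h.smul hv hv' hu⟩
  have hnv : 0 < ‖v‖ := norm_pos_iff.2 hv
  have hnorm : ‖(u / ‖v‖) • v‖ = u := by
    rw [norm_smul, Real.norm_of_nonneg (div_nonneg hu.1.le hnv.le), div_mul_cancel₀ _ hnv.ne']
  have := h.smul (norm_pos_iff.1 (by rw [hnorm]; exact hu.1)) (by rw [hnorm]; exact hu.2)
    (u := ‖v‖) ⟨hnv, hv'⟩
  rwa [hnorm, smul_smul, div_mul_div_cancel₀ hu.1.ne', div_self hnv.ne', one_smul] at this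

end SpecialPair

/-- The pair sum that detects a special centre in `K`. -/
theorem tsum_special_pairs {S K : Set (Euc d)} (hK : ∀ a ∈ K, ∀ b ∈ K, dist a b < d + 20)
    (c : ℝ≥0∞) :
    open Classical in
    ∑' x : S, ∑' y : S, (if (x : Euc d) ≠ y then
      (if Special S (midpoint ℝ (x : Euc d) y) ∧ midpoint ℝ (x : Euc d) y ∈ K ∧
        dist (x : Euc d) (midpoint ℝ (x : Euc d) y) < 1 / 2 then c else 0) else 0) =
      if ∃ m, Special S m ∧ m ∈ K then 2 * c else 0 := by
  classical
  split_ifs with h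
  · obtain ⟨m, hm, hmK⟩ := h
    obtain ⟨a, ha, b, hb, hp⟩ := hm.center
    have hpair : ∀ x ∈ S, ∀ y ∈ S, ∀ z, IsolatedPair 6 S m x z →
        ((x ≠ y ∧ Special S (midpoint ℝ x y) ∧ midpoint ℝ x y ∈ K ∧
          dist x (midpoint ℝ x y) < 1 / 2) ↔ y = z) := by
      intro x hx y hy z hz
      constructor
      · rintro ⟨hne, hs, hK', hlt⟩
        have he : midpoint ℝ x y = m := hm.unique hs (hK _ hK' _ hmK)
        have h3 : dist y m < 6 := by
          rw [← he, dist_right_midpoint, ← dist_left_midpoint]; linarith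
        rcases hz.isolated y hy h3 with h4 | h4
        · exact absurd h4.symm hne
        · exact h4
      · rintro rfl
        exact ⟨hz.ne, by rw [hz.mid]; exact ⟨hm, hmK, hz.dist_lt⟩⟩
    have hin : ∀ x : S, ∀ z (hzS : z ∈ S), IsolatedPair 6 S m x z →
        ∑' y : S, (if (x : Euc d) ≠ y then
          (if Special S (midpoint ℝ (x : Euc d) y) ∧ midpoint ℝ (x : Euc d) y ∈ K ∧
          dist (x : Euc d) (midpoint ℝ (x : Euc d) y) < 1 / 2 then c else 0) else 0) = c := by
      intro x z hzS hz
      rw [tsum_eq_single (⟨z, hzS⟩ : S)]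
      · have := (hpair x x.2 z hzS z hz).2 rfl
        rw [if_pos this.1, if_pos this.2]
      · intro y hy
        rw [← ite_and, if_neg]
        exact fun h => hy (Subtype.ext ((hpair x x.2 y y.2 z hz).1 h))
    -- Only the two orderings of the one special pair contribute, whence the factor 2.
    rw [tsum_eq_sum (s := {⟨a, ha⟩, ⟨b, hb⟩})]
    · rw [Finset.sum_pair (fun he => hp.ne (congrArg Subtype.val he)), hin ⟨a, ha⟩ b hb hp,
        hin ⟨b, hb⟩ a ha hp.symm, two_mul]
    · intro x hx
      refine ENNReal.tsum_eq_zero.2 fun y => ?_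
      rw [← ite_and, if_neg]
      rintro ⟨hne, hs, hK', hlt⟩
      have he : midpoint ℝ (x : Euc d) y = m := hm.unique hs (hK _ hK' _ hmK)
      rw [he] at hlt
      rcases hp.isolated x x.2 (by linarith) with h4 | h4
      · exact hx (by simp [Subtype.ext_iff, h4])
      · exact hx (by simp [Subtype.ext_iff, h4])
  · refine ENNReal.tsum_eq_zero.2 fun x => ENNReal.tsum_eq_zero.2 fun y => ?_
    rw [← ite_and, if_neg]
    rintro ⟨_, hs, hK', _⟩
    exact h ⟨_, hs, hK'⟩

end Resample

/-! ### Invariance of the Poisson law under resampling one radius -/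

namespace PointMeasure

variable {d : ℕ}

/-- Give the pairs with centres in `K` the radii `ρ`. -/
def resample (K : Set (Euc d)) (ρ : Euc d → ℝ) (μ : PointMeasure d) : PointMeasure d :=
  ofSet (setRadius μ.pts (radiiOn K μ.pts ρ))

theorem measurable_resample {Ω : Type*} [MeasurableSpace Ω] {K : Set (Euc d)}
    (hK : MeasurableSet K) {Z : Ω → PointMeasure d} (hZ : Measurable Z) {ρ : Ω → Euc d → ℝ}
    (hρ : Measurable fun q : Ω × Euc d => ρ q.1 q.2) (hgood : ∀ ω, GoodRadii (Z ω).pts (ρ ω)) :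
    Measurable fun ω => resample K (ρ ω) (Z ω) := by
  refine measurable_ofSet_setRadius hZ (ρ := fun ω => radiiOn K (Z ω).pts (ρ ω)) ?_
    fun ω => goodRadii_radiiOn (hgood ω)
  exact Measurable.ite (measurable_snd hK) hρ
    (measurable_radius (Z := fun q : Ω × Euc d => Z q.1) (hZ.comp measurable_fst) measurable_snd)

theorem measurable_resample_const {Ω : Type*} [MeasurableSpace Ω] {K : Set (Euc d)}
    (hK : MeasurableSet K) {Z : Ω → PointMeasure d} (hZ : Measurable Z) {t : Ω → ℝ}
    (ht : Measurable t) : Measurable fun ω => resample K (fun _ => clipRadius (t ω)) (Z ω) :=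
  measurable_resample hK hZ (ρ := fun ω _ => clipRadius (t ω))
    (measurable_clipRadius.comp (ht.comp measurable_fst)) fun _ _ _ => clipRadius_mem _

theorem pts_addPt_addPt (x y : Euc d) (μ : PointMeasure d) :
    (addPt x (addPt y μ)).pts = insert x (insert y μ.pts) := by
  rw [pts_addPt, pts_addPt]

theorem addPt_addPt (x y : Euc d) (μ : PointMeasure d) :
    addPt x (addPt y μ) = ofSet (insert x (insert y μ.pts)) := by
  rw [addPt, pts_addPt]

theorem measurable_addPair : Measurable fun q : (Euc d × Euc d) × PointMeasure d =>
    addPt (q.1.1 + q.1.2) (addPt (q.1.1 - q.1.2) q.2) := by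
  have h1 : Measurable fun q : (Euc d × Euc d) × PointMeasure d =>
      addPt (q.1.1 - q.1.2) q.2 :=
    measurable_addPt.comp ((measurable_fst.fst.sub measurable_fst.snd).prodMk measurable_snd)
  exact measurable_addPt.comp ((measurable_fst.fst.add measurable_fst.snd).prodMk h1)

theorem ae_specialPair (hd : 1 ≤ d) (μ : PointMeasure d) (m : Euc d) :
    ∀ᵐ v : Euc d, v ≠ 0 ∧ m + v ∉ μ.pts ∧ m - v ∉ μ.pts := by
  have : Nonempty (Fin d) := ⟨⟨0, hd⟩⟩
  have h1 : (({0} : Set (Euc d)) ∪ ((fun x => x - m) '' μ.pts ∪ (fun x => m - x) '' μ.pts)).Countable :=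
    (Set.countable_singleton _).union ((μ.countable_pts.image _).union (μ.countable_pts.image _))
  filter_upwards [h1.ae_notMem volume] with v hv
  refine ⟨fun h => hv (Or.inl h), fun h => hv (Or.inr (Or.inl ⟨_, h, by simp⟩)),
    fun h => hv (Or.inr (Or.inr ⟨_, h, by simp⟩))⟩

open Classical in
-- With `μ` and `m` fixed, resampling the pair m ± v replaces only the norm of `v`, so
-- `lintegral_ball_resample` applies. Replacing the indicator by `SpecialPair`, which also excludes
-- collisions with `μ`, costs a null set of `v`.
theorem lintegral_ball_pair_resample (hd : 1 ≤ d) {K : Set (Euc d)}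
    (hK : ∀ a ∈ K, ∀ b ∈ K, dist a b < d + 20) {F : PointMeasure d → ℝ≥0∞} (hF : Measurable F)
    (μ : PointMeasure d) {m : Euc d} (hm : m ∈ K) :
    ∫⁻ v in Metric.ball (0 : Euc d) (1 / 2),
      (if Special (addPt (m + v) (addPt (m - v) μ)).pts m then
        ∫⁻ u, F (resample K (fun _ => clipRadius u) (addPt (m + v) (addPt (m - v) μ))) ∂radiusLaw d
        else 0) =
    ∫⁻ v in Metric.ball (0 : Euc d) (1 / 2),
      (if Special (addPt (m + v) (addPt (m - v) μ)).pts m then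
        F (addPt (m + v) (addPt (m - v) μ)) else 0) := by
  have hadd : Measurable fun v : Euc d => addPt (m + v) (addPt (m - v) μ) :=
    measurable_addPair.comp ((measurable_const.prodMk measurable_id).prodMk measurable_const)
  let f : Euc d → ℝ≥0∞ := fun v => if SpecialPair μ.pts m v then
    F (addPt (m + v) (addPt (m - v) μ)) else 0
  have hf : Measurable f := by
    refine Measurable.ite ?_ (hF.comp hadd) measurable_const
    have h1 := measurableSet_special hadd (m := fun _ => m) measurable_const
    have h2 := measurableSet_mem_pts (Z := fun _ : Euc d => μ) measurable_const
      (f := fun v => m + v) (measurable_const.add measurable_id)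
    have h3 := measurableSet_mem_pts (Z := fun _ : Euc d => μ) measurable_const
      (f := fun v => m - v) (measurable_const.sub measurable_id)
    convert h1.inter (h2.compl.inter h3.compl) using 1
    ext v
    simp only [pts_addPt_addPt]
    exact ⟨fun h => ⟨h.special, h.left, h.right⟩, fun h => ⟨h.1, h.2.1, h.2.2⟩⟩
  have hae := ae_restrict_of_ae (s := Metric.ball (0 : Euc d) (1 / 2)) (ae_specialPair hd μ m)
  have hball := ae_restrict_mem (μ := (volume : Measure (Euc d)))
    (measurableSet_ball (x := (0 : Euc d)) (ε := 1 / 2))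
  calc _ = ∫⁻ v in Metric.ball (0 : Euc d) (1 / 2), ∫⁻ u, f ((u / ‖v‖) • v) ∂radiusLaw d := by
        refine lintegral_congr_ae ?_
        filter_upwards [hae, hball] with v hv hvb
        rw [mem_ball_zero_iff] at hvb
        simp only [pts_addPt_addPt]
        split_ifs with hs
        · have hsp : SpecialPair μ.pts m v := ⟨hs, hv.2.1, hv.2.2⟩
          refine lintegral_congr_ae ?_
          filter_upwards [ae_radiusLaw] with u hu
          simp only [f]
          rw [if_pos (hsp.smul hv.1 hvb hu), resample, pts_addPt_addPt,
            hsp.setRadius_eq hv.1 hvb hm hK, clipRadius_of_mem hu, addPt_addPt]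
        · rw [lintegral_congr_ae (g := fun _ => 0), lintegral_zero]
          filter_upwards [ae_radiusLaw] with u hu
          simp only [f]
          rw [if_neg]
          rw [SpecialPair.smul_iff hv.1 hvb hu]
          exact fun h => hs h.special
    _ = ∫⁻ v in Metric.ball (0 : Euc d) (1 / 2), f v := lintegral_ball_resample hd hf
    _ = _ := by
        refine lintegral_congr_ae ?_
        filter_upwards [hae, hball] with v hv hvb
        simp only [f]
        refine if_congr ?_ rfl rfl
        rw [pts_addPt_addPt]
        exact ⟨fun h => h.special, fun h => ⟨h, hv.2.1, hv.2.2⟩⟩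

end PointMeasure

namespace IsPoissonLaw

open PointMeasure

variable {d : ℕ} {r : ℝ≥0} {P : Measure (PointMeasure d)}

open Classical in
-- A special centre in `K` is detected by a sum over ordered pairs of points, to which the bivariate
-- Mecke formula applies; midpoint and half difference are then the variables of integration. The
-- constant does not depend on `F`, which suffices for comparing two functionals.
theorem exists_lintegral_special (h : IsPoissonLaw r P) (hd : 1 ≤ d) {K : Set (Euc d)}
    (hKm : MeasurableSet K) (hK : ∀ a ∈ K, ∀ b ∈ K, dist a b < d + 20) :
    ∃ c : ℝ≥0∞, ∀ F : PointMeasure d → ℝ≥0∞, Measurable F →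
      ∫⁻ μ, (if ∃ m, Special μ.pts m ∧ m ∈ K then 2 * F μ else 0) ∂P =
        c * ∫⁻ m in K, ∫⁻ μ, ∫⁻ v in Metric.ball (0 : Euc d) (1 / 2),
          (if Special (addPt (m + v) (addPt (m - v) μ)).pts m then
            F (addPt (m + v) (addPt (m - v) μ)) else 0) ∂volume ∂P := by
  have := h.isProbabilityMeasure
  obtain ⟨c, hc⟩ := exists_lintegral_midpoint d
  refine ⟨r * (r * c), fun F hF => ?_⟩
  obtain ⟨f, hfdef⟩ : ∃ f : Euc d → Euc d → PointMeasure d → ℝ≥0∞, ∀ x y μ, f x y μ =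
    if Special μ.pts (midpoint ℝ x y) ∧ midpoint ℝ x y ∈ K ∧ dist x (midpoint ℝ x y) < 1 / 2 then
      F μ else 0 := ⟨_, fun _ _ _ => rfl⟩
  have hf : Measurable fun q : (Euc d × Euc d) × PointMeasure d => f q.1.1 q.1.2 q.2 := by
    simp_rw [hfdef]
    refine Measurable.ite ?_ (hF.comp measurable_snd) measurable_const
    have hmid : Measurable fun q : (Euc d × Euc d) × PointMeasure d => midpoint ℝ q.1.1 q.1.2 :=
      measurable_midpoint measurable_fst.fst measurable_fst.snd
    exact (measurableSet_special measurable_snd hmid).inter ((hmid hKm).inter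
      (measurableSet_lt (measurable_fst.fst.dist hmid) measurable_const))
  have hf2 : Measurable fun q : (Euc d × Euc d) × PointMeasure d =>
      f q.1.1 q.1.2 (addPt q.1.1 (addPt q.1.2 q.2)) := by
    have h1 : Measurable fun q : (Euc d × Euc d) × PointMeasure d => addPt q.1.2 q.2 :=
      measurable_addPt.comp (measurable_fst.snd.prodMk measurable_snd)
    exact hf.comp (measurable_fst.prodMk (measurable_addPt.comp (measurable_fst.fst.prodMk h1)))
  have hf3 : Measurable fun q : (Euc d × Euc d) × PointMeasure d =>
      f (q.1.1 + q.1.2) (q.1.1 - q.1.2) (addPt (q.1.1 + q.1.2) (addPt (q.1.1 - q.1.2) q.2)) :=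
    hf2.comp (((measurable_fst.fst.add measurable_fst.snd).prodMk
      (measurable_fst.fst.sub measurable_fst.snd)).prodMk measurable_snd)
  have h1 := h.mecke_pairs hd hf
  have h0 : ∫⁻ μ, (if ∃ m, Special μ.pts m ∧ m ∈ K then 2 * F μ else 0) ∂P =
      ∫⁻ μ, ∑' x : μ.pts, ∑' y : μ.pts, (if (x : Euc d) ≠ y then f x y μ else 0) ∂P :=
    lintegral_congr fun μ => by
      simp_rw [hfdef]
      exact (tsum_special_pairs hK (F μ)).symm
  rw [h0, h1, hc (fun x y => ∫⁻ μ, f x y (addPt x (addPt y μ)) ∂P) hf2.lintegral_prod_right',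
    mul_assoc, mul_assoc, ← lintegral_indicator hKm]
  congr 3
  refine lintegral_congr fun m => ?_
  rw [lintegral_lintegral_swap (f := fun v μ => f (m + v) (m - v) (addPt (m + v) (addPt (m - v) μ)))
    (hf3.comp ((measurable_const.prodMk measurable_fst).prodMk measurable_snd)).aemeasurable]
  by_cases hm : m ∈ K
  · rw [Set.indicator_of_mem hm]
    refine lintegral_congr fun μ => ?_
    rw [← lintegral_indicator measurableSet_ball]
    refine lintegral_congr fun v => ?_
    have hmid : midpoint ℝ (m + v) (m - v) = m := by
      rw [midpoint_eq_smul_add, invOf_eq_inv]; module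
    simp only [hfdef, hmid, hm, true_and]
    have hdist : dist (m + v) m = ‖v‖ := by simp
    rw [hdist]
    by_cases hv : v ∈ Metric.ball (0 : Euc d) (1 / 2)
    · rw [Set.indicator_of_mem hv]
      rw [mem_ball_zero_iff] at hv
      simp only [hv, and_true]
    · rw [Set.indicator_of_notMem hv, if_neg]
      rw [mem_ball_zero_iff] at hv
      exact fun h => hv h.2
  · rw [Set.indicator_of_notMem hm, lintegral_congr (g := fun _ => 0), lintegral_zero]
    intro μ
    rw [lintegral_congr (g := fun _ => 0), lintegral_zero]
    intro v
    have hmid : midpoint ℝ (m + v) (m - v) = m := by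
      rw [midpoint_eq_smul_add, invOf_eq_inv]; module
    simp only [hfdef, hmid]
    exact if_neg fun h => hm h.2.1

/-- Resampling the radius of the special pair with centre in a small set leaves a Poisson law
invariant. -/
theorem lintegral_resample_const (h : IsPoissonLaw r P) (hd : 1 ≤ d) {K : Set (Euc d)}
    (hKm : MeasurableSet K) (hK : ∀ a ∈ K, ∀ b ∈ K, dist a b < d + 20)
    {F : PointMeasure d → ℝ≥0∞} (hF : Measurable F) :
    ∫⁻ μ, ∫⁻ u, F (resample K (fun _ => clipRadius u) μ) ∂radiusLaw d ∂P = ∫⁻ μ, F μ ∂P := by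
  classical
  obtain ⟨c, hc⟩ := h.exists_lintegral_special hd hKm hK
  have hg : Measurable fun μ => ∫⁻ u, F (resample K (fun _ => clipRadius u) μ) ∂radiusLaw d :=
    (hF.comp (measurable_resample_const hKm measurable_fst measurable_snd)).lintegral_prod_right'
  have hHm : MeasurableSet {μ : PointMeasure d | ∃ m, Special μ.pts m ∧ m ∈ K} := by
    have : {μ : PointMeasure d | ∃ m, Special μ.pts m ∧ m ∈ K} = {μ | ∃ x ∈ μ.pts, ∃ y ∈ μ.pts,
        Special μ.pts (midpoint ℝ x y) ∧ midpoint ℝ x y ∈ K} := by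
      ext μ
      constructor
      · rintro ⟨m, hm, hmK⟩
        obtain ⟨x, hx, y, hy, hp⟩ := hm.center
        exact ⟨x, hx, y, hy, by rw [hp.mid]; exact ⟨hm, hmK⟩⟩
      · rintro ⟨x, hx, y, hy, hs⟩
        exact ⟨_, hs⟩
    rw [this]
    have hmid : Measurable fun q : (PointMeasure d × Euc d) × Euc d => midpoint ℝ q.1.2 q.2 :=
      measurable_midpoint measurable_fst.snd measurable_snd
    exact measurableSet_exists_pts_pair measurable_id
      (p := fun μ x y => Special μ.pts (midpoint ℝ x y) ∧ midpoint ℝ x y ∈ K)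
      ((measurableSet_special measurable_fst.fst hmid).inter (hmid hKm))
  set H := {μ : PointMeasure d | ∃ m, Special μ.pts m ∧ m ∈ K} with hH
  -- Up to the same constant, both integrals over `H` are integrals over `m`, `μ` and `v`, and they
  -- already agree after integration over `v`.
  have hin : ∫⁻ μ in H, ∫⁻ u, F (resample K (fun _ => clipRadius u) μ) ∂radiusLaw d ∂P =
      ∫⁻ μ in H, F μ ∂P := by
    have h2 : ∀ G : PointMeasure d → ℝ≥0∞, Measurable G → 2 * ∫⁻ μ in H, G μ ∂P =
        c * ∫⁻ m in K, ∫⁻ μ, ∫⁻ v in Metric.ball (0 : Euc d) (1 / 2),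
          (if Special (addPt (m + v) (addPt (m - v) μ)).pts m then
            G (addPt (m + v) (addPt (m - v) μ)) else 0) ∂volume ∂P := by
      intro G hG
      rw [← hc G hG, ← lintegral_const_mul _ hG, ← lintegral_indicator hHm]
      refine lintegral_congr fun μ => ?_
      by_cases hμ : μ ∈ H
      · rw [Set.indicator_of_mem hμ]
        exact (if_pos hμ).symm
      · rw [Set.indicator_of_notMem hμ]
        exact (if_neg hμ).symm
    have h3 := h2 _ hg
    have h4 := h2 _ hF
    rw [← (ENNReal.mul_right_inj two_ne_zero ENNReal.ofNat_ne_top), h3, h4]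
    congr 1
    refine setLIntegral_congr_fun hKm fun m hm => ?_
    exact lintegral_congr fun μ => lintegral_ball_pair_resample hd hK hF μ hm
  -- Without a special centre in `K`, resampling does nothing.
  have hout : ∫⁻ μ in Hᶜ, ∫⁻ u, F (resample K (fun _ => clipRadius u) μ) ∂radiusLaw d ∂P =
      ∫⁻ μ in Hᶜ, F μ ∂P := by
    refine lintegral_congr_ae ?_
    filter_upwards [ae_restrict_of_ae h.ae_locFin, ae_restrict_mem hHm.compl] with μ hμ hμH
    have : ∀ u : ℝ, resample K (fun _ => clipRadius u) μ = μ := by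
      intro u
      rw [resample, setRadius_radiiOn_of_forall_notMem, pts_eq_supp hμ, ofSet_supp]
      exact fun m hm hmK => hμH ⟨m, hm, hmK⟩
    simp [this]
  rw [← lintegral_add_compl _ hHm, hin, hout, lintegral_add_compl _ hHm]

end IsPoissonLaw

/-! ### Resampling all radii, one grid cell at a time -/

section Grid

variable {d : ℕ}

/-- The cell of the unit grid that contains a point. -/
def grid (m : Euc d) : Fin d → ℤ := fun i => ⌊m i⌋

theorem measurable_grid : Measurable (grid : Euc d → _) :=
  measurable_pi_lambda _ fun i => Int.measurable_floor.comp (by fun_prop : Measurable fun m : Euc d => m i)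

/-- A unit cube has diameter √d, so it contains at most one special centre and grid cells can index
the independent radii. The grid is not isometry invariant, but it is used only for laws and
measurability and does not enter the final maps. -/
theorem dist_lt_of_grid_eq {a b : Euc d} (h : grid a = grid b) : dist a b < d + 20 := by
  have h1 : ∀ i, dist (a i) (b i) ^ 2 ≤ 1 := by
    intro i
    have h2 := Int.abs_sub_lt_one_of_floor_eq_floor (congrFun h i)
    rw [Real.dist_eq, sq_abs]
    rw [abs_lt] at h2
    nlinarith
  have h2 : dist a b ^ 2 ≤ d := by
    rw [EuclideanSpace.dist_eq, Real.sq_sqrt (Finset.sum_nonneg fun i _ => sq_nonneg _)]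
    calc ∑ i, dist (a i) (b i) ^ 2 ≤ ∑ _i : Fin d, (1 : ℝ) := Finset.sum_le_sum fun i _ => h1 i
      _ = d := by simp
  have h3 : (0 : ℝ) ≤ d := Nat.cast_nonneg d
  nlinarith [dist_nonneg (x := a) (y := b)]

theorem finite_grid_ball (d n : ℕ) : (grid '' Metric.ball (0 : Euc d) n).Finite := by
  refine (Set.finite_Icc (fun _ => -(n : ℤ)) (fun _ => (n : ℤ))).subset ?_
  rintro _ ⟨m, hm, rfl⟩
  rw [mem_ball_zero_iff] at hm
  have h1 : ∀ i, |m i| < n := fun i => (PiLp.norm_apply_le m i).trans_lt hm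
  refine ⟨fun i => ?_, fun i => ?_⟩
  · refine Int.le_floor.2 ?_
    have := (abs_lt.1 (h1 i)).1
    push_cast
    exact this.le
  · have := (abs_lt.1 (h1 i)).2
    have h2 := Int.floor_le (m i)
    have : (⌊m i⌋ : ℝ) < n := by linarith
    exact_mod_cast this.le

theorem radiiOn_congr {K S : Set (Euc d)} {ρ ρ' : Euc d → ℝ} (h : ∀ m ∈ K, ρ m = ρ' m) :
    radiiOn K S ρ = radiiOn K S ρ' := by
  funext m
  unfold radiiOn
  split_ifs with hm
  · exact h m hm
  · rfl

theorem setRadius_inter_ball_subset {S : Set (Euc d)} {ρ ρ' : Euc d → ℝ} (hρ : GoodRadii S ρ)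
    {c : Euc d} {R : ℝ} (h : ∀ m, Special S m → dist m c < R + 1 / 2 → ρ m = ρ' m) :
    setRadius S ρ ∩ Metric.ball c R ⊆ setRadius S ρ' := by
  rintro _ ⟨⟨x, hx, rfl⟩, hb⟩
  refine ⟨x, hx, ?_⟩
  rcases far_or_near S x with h' | ⟨m, hm, hxm⟩
  · rw [movePt_of_far h', movePt_of_far h']
  · rw [hm.movePt_eq hx hxm, hm.movePt_eq hx hxm, h m hm]
    have h1 := hm.dist_movePt hx hxm (hρ m hm).1
    have h2 := (hρ m hm).2
    have h3 := dist_triangle_left m c (movePt S ρ x)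
    rw [Metric.mem_ball] at hb
    linarith

end Grid

section Update

variable {ι : Type*} {E : Type*} [MeasurableSpace E]

/-- Redrawing one coordinate independently does not change a product law; this isolates a coordinate
in inductions over finite index sets. -/
theorem measurePreserving_update [DecidableEq ι] (ν : Measure E) [IsProbabilityMeasure ν] (k : ι) :
    MeasurePreserving (fun p : (ι → E) × E => Function.update p.1 k p.2)
      ((Measure.infinitePi fun _ : ι => ν).prod ν) (Measure.infinitePi fun _ : ι => ν) := by
  have hm : Measurable fun p : (ι → E) × E => Function.update p.1 k p.2 := by
    refine measurable_pi_lambda _ fun i => ?_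
    by_cases h : i = k
    · subst h; simpa using measurable_snd
    · simp only [Function.update_of_ne h]
      exact (measurable_pi_apply i).comp measurable_fst
  refine ⟨hm, Measure.eq_infinitePi _ fun s t ht => ?_⟩
  rw [Measure.map_apply hm (MeasurableSet.pi s.countable_toSet fun i _ => ht i)]
  have h1 : (fun p : (ι → E) × E => Function.update p.1 k p.2) ⁻¹' (Set.pi s t) =
      (Set.pi (s.erase k) t) ×ˢ (if k ∈ s then t k else Set.univ) := by
    ext p
    simp only [Set.mem_preimage, Set.mem_pi, Set.mem_prod, Finset.mem_coe, Finset.mem_erase]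
    constructor
    · intro h
      refine ⟨fun i hi => ?_, ?_⟩
      · simpa [Function.update_of_ne hi.1] using h i hi.2
      · split_ifs with hk
        · simpa using h k hk
        · trivial
    · rintro ⟨h, h'⟩ i hi
      by_cases hik : i = k
      · subst hik; simpa [hi] using h'
      · simpa [Function.update_of_ne hik] using h i ⟨hik, hi⟩
  rw [h1, Measure.prod_prod, Measure.infinitePi_pi _ fun i _ => ht i]
  split_ifs with hk
  · rw [Finset.prod_erase_mul _ _ hk]
  · rw [measure_univ, mul_one, Finset.erase_eq_of_notMem hk]

end Update

namespace PointMeasure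

variable {d : ℕ}

theorem pts_resample {K : Set (Euc d)} {ρ : Euc d → ℝ} {μ : PointMeasure d}
    (h : GoodRadii μ.pts ρ) : (resample K ρ μ).pts = setRadius μ.pts (radiiOn K μ.pts ρ) :=
  pts_ofSet (μ.locFin_pts.setRadius (goodRadii_radiiOn h))

theorem resample_congr {K : Set (Euc d)} {ρ ρ' : Euc d → ℝ} {μ : PointMeasure d}
    (h : ∀ m ∈ K, ρ m = ρ' m) : resample K ρ μ = resample K ρ' μ := by
  rw [resample, radiiOn_congr h, resample]

theorem resample_resample {K K' : Set (Euc d)} {ρ : Euc d → ℝ} {μ : PointMeasure d}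
    (h : GoodRadii μ.pts ρ) : resample K' ρ (resample K ρ μ) = resample (K' ∪ K) ρ μ := by
  have hg := goodRadii_radiiOn (K := K) h
  rw [resample, pts_resample h, hg.setRadius_setRadius, resample]
  congr 1
  refine setRadius_congr fun m hm => ?_
  by_cases h1 : m ∈ K'
  · rw [radiiOn, radiiOn, if_pos h1, if_pos (Set.mem_union_left _ h1)]
  · rw [radiiOn, if_neg h1, hg.radius_setRadius hm]
    by_cases h2 : m ∈ K
    · rw [radiiOn, radiiOn, if_pos h2, if_pos (Set.mem_union_right _ h2)]
    · rw [radiiOn, radiiOn, if_neg h2, if_neg (by simp [h1, h2])]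

theorem measurable_resample_grid {Ω : Type*} [MeasurableSpace Ω] (J : Set (Fin d → ℤ))
    {Z : Ω → PointMeasure d} (hZ : Measurable Z) {u : Ω → (Fin d → ℤ) → ℝ} (hu : Measurable u) :
    Measurable fun ω => resample (grid ⁻¹' J) (fun m => clipRadius (u ω (grid m))) (Z ω) := by
  refine measurable_resample (measurable_grid J.to_countable.measurableSet) hZ
    (ρ := fun ω m => clipRadius (u ω (grid m))) ?_ fun _ _ _ => clipRadius_mem _
  refine measurable_clipRadius.comp ?_
  have : Measurable fun q : ((Fin d → ℤ) → ℝ) × (Fin d → ℤ) => q.1 q.2 :=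
    measurable_from_prod_countable_left fun k => measurable_pi_apply k
  exact this.comp ((hu.comp measurable_fst).prodMk (measurable_grid.comp measurable_snd))

end PointMeasure

namespace IsPoissonLaw

open PointMeasure

variable {d : ℕ} {r : ℝ≥0} {P : Measure (PointMeasure d)}

/-- Resampling in `insert k J` is resampling in `J` followed by resampling in the single cell `k`,
so `lintegral_resample_const` can be applied inductively. -/
theorem lintegral_resample_finset (h : IsPoissonLaw r P) (hd : 1 ≤ d) (J : Finset (Fin d → ℤ))
    {F : PointMeasure d → ℝ≥0∞} (hF : Measurable F) :
    ∫⁻ u, ∫⁻ μ, F (resample (grid ⁻¹' J) (fun m => clipRadius (u (grid m))) μ) ∂P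
      ∂(Measure.infinitePi fun _ : Fin d → ℤ => radiusLaw d) = ∫⁻ μ, F μ ∂P := by
  classical
  have := h.isProbabilityMeasure
  induction J using Finset.induction_on generalizing F with
  | empty =>
    have : ∀ᵐ μ ∂P, ∀ u : (Fin d → ℤ) → ℝ,
        resample (grid ⁻¹' ((∅ : Finset (Fin d → ℤ)) : Set (Fin d → ℤ)))
          (fun m => clipRadius (u (grid m))) μ = μ := by
      filter_upwards [h.ae_locFin] with μ hμ u
      rw [resample, setRadius_radiiOn_of_forall_notMem (by simp), pts_eq_supp hμ, ofSet_supp]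
    have h2 : ∀ u : (Fin d → ℤ) → ℝ, ∫⁻ μ, F (resample
        (grid ⁻¹' ((∅ : Finset (Fin d → ℤ)) : Set (Fin d → ℤ)))
          (fun m => clipRadius (u (grid m))) μ) ∂P = ∫⁻ μ, F μ ∂P := fun u =>
      lintegral_congr_ae (this.mono fun μ hμ => by simp only [hμ u])
    simp_rw [h2]
    simp
  | insert k J hk ih =>
    have hKm : MeasurableSet (grid ⁻¹' {k} : Set (Euc d)) :=
      measurable_grid (measurableSet_singleton k)
    have hK : ∀ a ∈ (grid ⁻¹' {k} : Set (Euc d)), ∀ b ∈ (grid ⁻¹' {k} : Set (Euc d)),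
        dist a b < d + 20 := fun a ha b hb => dist_lt_of_grid_eq (Eq.trans ha (Eq.symm hb))
    have h1 : Measurable fun u : (Fin d → ℤ) → ℝ => ∫⁻ μ, F (resample
        (grid ⁻¹' ((insert k J : Finset (Fin d → ℤ)) : Set (Fin d → ℤ)))
        (fun m => clipRadius (u (grid m))) μ) ∂P :=
      (hF.comp (measurable_resample_grid _ measurable_fst measurable_snd)).lintegral_prod_left'
    have h2 : ∀ (u : (Fin d → ℤ) → ℝ) (t : ℝ) (μ : PointMeasure d),
        resample (grid ⁻¹' ((insert k J : Finset (Fin d → ℤ)) : Set (Fin d → ℤ)))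
          (fun m => clipRadius (Function.update u k t (grid m))) μ =
        resample (grid ⁻¹' {k}) (fun _ => clipRadius t)
          (resample (grid ⁻¹' J) (fun m => clipRadius (u (grid m))) μ) := by
      intro u t μ
      rw [Finset.coe_insert, Set.insert_eq, Set.preimage_union,
        ← resample_resample (goodRadii_clipRadius _ _)]
      rw [resample_congr (K := grid ⁻¹' {k}) (ρ' := fun _ => clipRadius t),
        resample_congr (K := grid ⁻¹' J) (ρ' := fun m => clipRadius (u (grid m)))]
      · intro m hm
        rw [Function.update_of_ne]
        rintro rfl
        exact hk hm
      · rintro m rfl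
        simp
    have h3 : Measurable fun q : (((Fin d → ℤ) → ℝ) × ℝ) × PointMeasure d =>
        F (resample (grid ⁻¹' {k}) (fun _ => clipRadius q.1.2)
          (resample (grid ⁻¹' (J : Set (Fin d → ℤ))) (fun m => clipRadius (q.1.1 (grid m))) q.2)) :=
      hF.comp (measurable_resample_const hKm
        (measurable_resample_grid _ measurable_snd measurable_fst.fst) measurable_fst.snd)
    -- The radius for cell `k` becomes a separate independent variable t. For fixed t the induction
    -- hypothesis removes the cells in `J`, applied to the functional that already includes the
    -- resampling of cell `k`.
    rw [← (measurePreserving_update (radiusLaw d) k).lintegral_comp h1]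
    simp_rw [h2]
    rw [lintegral_prod_symm' _ h3.lintegral_prod_right']
    have h4 : ∀ t : ℝ, ∫⁻ u, ∫⁻ μ, F (resample (grid ⁻¹' {k}) (fun _ => clipRadius t)
          (resample (grid ⁻¹' J) (fun m => clipRadius (u (grid m))) μ)) ∂P
          ∂(Measure.infinitePi fun _ : Fin d → ℤ => radiusLaw d) =
        ∫⁻ μ, F (resample (grid ⁻¹' {k}) (fun _ => clipRadius t) μ) ∂P := fun t =>
      ih (F := fun μ => F (resample (grid ⁻¹' {k}) (fun _ => clipRadius t) μ))
        (hF.comp (measurable_resample_const hKm measurable_id measurable_const))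
    simp_rw [h4]
    rw [lintegral_lintegral_swap
      (f := fun t μ => F (resample (grid ⁻¹' {k}) (fun _ => clipRadius t) μ))
      (hF.comp (measurable_resample_const hKm measurable_snd measurable_fst)).aemeasurable]
    exact h.lintegral_resample_const hd hKm hK hF

/-- Moved points stay within 1 / 2 of their centre, so a function that vanishes outside a ball only
sees centres in finitely many grid cells. -/
theorem lintegral_resample_univ_expNeg (h : IsPoissonLaw r P) (hd : 1 ≤ d)
    {f : Euc d → ℝ≥0∞} (hf : Measurable f) (n : ℕ) (hn : ∀ x ∉ Metric.ball (0 : Euc d) n, f x = 0) :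
    ∫⁻ u, ∫⁻ μ, expNeg (∫⁻ x, f x ∂(resample Set.univ
      (fun m => clipRadius (u (grid m))) μ).toMeasure) ∂P
      ∂(Measure.infinitePi fun _ : Fin d → ℤ => radiusLaw d) =
      ∫⁻ μ, expNeg (∫⁻ x, f x ∂μ.toMeasure) ∂P := by
  set J := (finite_grid_ball d (n + 1)).toFinset with hJ
  have hmeas : Measurable fun μ : PointMeasure d => expNeg (∫⁻ x, f x ∂μ.toMeasure) :=
    measurable_expNeg.comp (measurable_lintegral hf)
  rw [← h.lintegral_resample_finset hd J hmeas]
  refine lintegral_congr fun u => lintegral_congr fun μ => ?_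
  have hg : GoodRadii μ.pts fun m => clipRadius (u (grid m)) := goodRadii_clipRadius _ _
  rw [resample, resample, toMeasure_ofSet (μ.locFin_pts.setRadius (goodRadii_radiiOn hg)).countable,
    toMeasure_ofSet (μ.locFin_pts.setRadius (goodRadii_radiiOn hg)).countable, lintegral_sumDirac,
    lintegral_sumDirac, tsum_subtype _ f, tsum_subtype _ f]
  congr 1
  refine tsum_congr fun x => ?_
  by_cases hx : x ∈ Metric.ball (0 : Euc d) n
  · have key : ∀ m, Special μ.pts m → dist m 0 < (n : ℝ) + 1 / 2 →
        radiiOn Set.univ μ.pts (fun m => clipRadius (u (grid m))) m =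
          radiiOn (grid ⁻¹' J) μ.pts (fun m => clipRadius (u (grid m))) m := by
      intro m _ hm
      rw [radiiOn, radiiOn, if_pos (Set.mem_univ m), if_pos]
      rw [hJ, Set.Finite.coe_toFinset]
      refine ⟨m, ?_, rfl⟩
      rw [Metric.mem_ball]
      push_cast
      linarith
    have h1 : x ∈ setRadius μ.pts (radiiOn Set.univ μ.pts fun m => clipRadius (u (grid m))) ↔
        x ∈ setRadius μ.pts (radiiOn (grid ⁻¹' J) μ.pts fun m => clipRadius (u (grid m))) :=
      ⟨fun hx' => setRadius_inter_ball_subset (goodRadii_radiiOn hg) key ⟨hx', hx⟩,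
        fun hx' => setRadius_inter_ball_subset (goodRadii_radiiOn hg)
          (fun m hm hm' => (key m hm hm').symm) ⟨hx', hx⟩⟩
    by_cases h2 : x ∈ setRadius μ.pts (radiiOn Set.univ μ.pts fun m => clipRadius (u (grid m)))
    · rw [Set.indicator_of_mem h2, Set.indicator_of_mem (h1.1 h2)]
    · rw [Set.indicator_of_notMem h2, Set.indicator_of_notMem (mt h1.2 h2)]
  · rw [Set.indicator_apply_eq_zero.2 fun _ => hn x hx, Set.indicator_apply_eq_zero.2 fun _ => hn x hx]

/-- Resampling all radii leaves a Poisson law invariant. -/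
theorem map_resample_univ (h : IsPoissonLaw r P) (hd : 1 ≤ d) :
    (P.prod (Measure.infinitePi fun _ : Fin d → ℤ => radiusLaw d)).map
      (fun q => resample Set.univ (fun m => clipRadius (q.2 (grid m))) q.1) = P := by
  have := h.isProbabilityMeasure
  have hR : Measurable fun q : PointMeasure d × ((Fin d → ℤ) → ℝ) =>
      resample Set.univ (fun m => clipRadius (q.2 (grid m))) q.1 :=
    measurable_resample_grid Set.univ measurable_fst measurable_snd
  have := Measure.isProbabilityMeasure_map
    (μ := P.prod (Measure.infinitePi fun _ : Fin d → ℤ => radiusLaw d)) hR.aemeasurable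
  refine PointMeasure.ext_of_laplace fun f hf => ?_
  have hball : ∀ n : ℕ, Measurable ((Metric.ball (0 : Euc d) n).indicator f) := fun n =>
    hf.indicator measurableSet_ball
  have hn : ∀ n : ℕ, ∫⁻ μ, expNeg (∫⁻ x, (Metric.ball (0 : Euc d) n).indicator f x ∂μ.toMeasure)
      ∂((P.prod (Measure.infinitePi fun _ : Fin d → ℤ => radiusLaw d)).map
      (fun q => resample Set.univ (fun m => clipRadius (q.2 (grid m))) q.1)) =
      ∫⁻ μ, expNeg (∫⁻ x, (Metric.ball (0 : Euc d) n).indicator f x ∂μ.toMeasure) ∂P := by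
    intro n
    have hmeas : Measurable fun μ : PointMeasure d =>
        expNeg (∫⁻ x, (Metric.ball (0 : Euc d) n).indicator f x ∂μ.toMeasure) :=
      measurable_expNeg.comp (measurable_lintegral (hball n))
    rw [← h.lintegral_resample_univ_expNeg hd (hball n) n fun x hx => Set.indicator_of_notMem hx f]
    rw [lintegral_map hmeas hR]
    exact lintegral_prod_symm' _ (hmeas.comp hR)
  have hlim : ∀ M : Measure (PointMeasure d), IsProbabilityMeasure M → Tendsto (fun n : ℕ =>
      ∫⁻ μ, expNeg (∫⁻ x, (Metric.ball (0 : Euc d) n).indicator f x ∂μ.toMeasure) ∂M) atTop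
      (𝓝 (∫⁻ μ, expNeg (∫⁻ x, f x ∂μ.toMeasure) ∂M)) := by
    intro M hM
    refine tendsto_lintegral_of_dominated_convergence (fun _ => 1)
      (fun n => measurable_expNeg.comp (measurable_lintegral (hball n)))
      (fun n => Eventually.of_forall fun μ => expNeg_le_one _) (by simp)
      (Eventually.of_forall fun μ => (continuous_expNeg.tendsto _).comp ?_)
    refine lintegral_tendsto_of_tendsto_of_monotone (fun n => (hball n).aemeasurable)
      (Eventually.of_forall fun x n n' hnn => ?_) (Eventually.of_forall fun x => ?_)
    · exact Set.indicator_le_indicator_of_subset (Metric.ball_subset_ball (by exact_mod_cast hnn))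
        (fun _ => zero_le) x
    · obtain ⟨N, hN⟩ := exists_nat_gt ‖x‖
      refine tendsto_const_nhds.congr' ?_
      filter_upwards [eventually_ge_atTop N] with n hn
      rw [Set.indicator_of_mem]
      rw [mem_ball_zero_iff]
      exact hN.trans_le (by exact_mod_cast hn)
  refine tendsto_nhds_unique (hlim _ inferInstance) ?_
  simp_rw [hn]
  exact hlim P inferInstance

end IsPoissonLaw

/-! ### Isomorphism of laws without atoms -/

section Isomorphism

theorem continuous_cdf (κ : Measure ℝ) [IsProbabilityMeasure κ] [NullSingletonClass κ] :
    Continuous (cdf κ) := by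
  refine continuous_iff_continuousAt.2 fun x => ?_
  rw [(monotone_cdf κ).continuousAt_iff_leftLim_eq_rightLim, (cdf κ).rightLim_eq]
  have h1 := (cdf κ).measure_singleton x
  rw [measure_cdf, measure_singleton] at h1
  have h2 := ENNReal.ofReal_eq_zero.1 h1.symm
  have h3 := (monotone_cdf κ).leftLim_le (le_refl x)
  linarith

/-- Without atoms the distribution function is continuous, so it has a right inverse `q` on (0, 1).
Any right inverse is monotone there, hence measurable. -/
theorem exists_quantile (κ : Measure ℝ) [IsProbabilityMeasure κ] [NullSingletonClass κ] :
    ∃ F q : ℝ → ℝ, Measurable F ∧ Measurable q ∧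
      (volume.restrict (Set.Ioo (0 : ℝ) 1)).map q = κ ∧ ∀ t ∈ Set.Ioo (0 : ℝ) 1, F (q t) = t := by
  classical
  have hex : ∀ t ∈ Set.Ioo (0 : ℝ) 1, ∃ x, cdf κ x = t := by
    intro t ht
    obtain ⟨a, ha⟩ := ((tendsto_cdf_atBot κ).eventually (gt_mem_nhds ht.1)).exists
    obtain ⟨b, hb⟩ := ((tendsto_cdf_atTop κ).eventually (lt_mem_nhds ht.2)).exists
    exact mem_range_of_exists_le_of_exists_ge (continuous_cdf κ) ⟨a, ha.le⟩ ⟨b, hb.le⟩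
  let q : ℝ → ℝ := fun t => if h : t ∈ Set.Ioo (0 : ℝ) 1 then (hex t h).choose else 0
  have hq : ∀ t ∈ Set.Ioo (0 : ℝ) 1, cdf κ (q t) = t := by
    intro t ht
    simp only [q, dif_pos ht]
    exact (hex t ht).choose_spec
  have hmono : ∀ t ∈ Set.Ioo (0 : ℝ) 1, ∀ t' ∈ Set.Ioo (0 : ℝ) 1, t ≤ t' → q t ≤ q t' := by
    intro t ht t' ht' hle
    by_contra hlt
    push Not at hlt
    have h1 := monotone_cdf κ hlt.le
    rw [hq t ht, hq t' ht'] at h1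
    rw [le_antisymm hle h1] at hlt
    exact lt_irrefl _ hlt
  have hqm : Measurable q := by
    refine measurable_of_Iic fun x => ?_
    have : q ⁻¹' Set.Iic x = (Set.Ioo (0 : ℝ) 1 ∩ {t | q t ≤ x}) ∪
        ((Set.Ioo (0 : ℝ) 1)ᶜ ∩ {_t | 0 ≤ x}) := by
      ext t
      by_cases ht : t ∈ Set.Ioo (0 : ℝ) 1
      · simp only [Set.mem_preimage, Set.mem_Iic, Set.mem_union, Set.mem_inter_iff, ht, true_and,
          Set.mem_ofPred_eq, Set.mem_compl_iff, not_true_eq_false, false_and, or_false]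
      · simp only [Set.mem_preimage, Set.mem_Iic, Set.mem_union, Set.mem_inter_iff, ht, false_and,
          Set.mem_ofPred_eq, Set.mem_compl_iff, not_false_eq_true, true_and, false_or, q, dif_neg]
    rw [this]
    refine MeasurableSet.union ?_ (measurableSet_Ioo.compl.inter (MeasurableSet.const _))
    refine Set.OrdConnected.measurableSet ⟨fun a ha b hb c hc => ?_⟩
    have hc' : c ∈ Set.Ioo (0 : ℝ) 1 := ⟨ha.1.1.trans_le hc.1, hc.2.trans_lt hb.1.2⟩
    exact ⟨hc', (hmono c hc' b hb.1 hc.2).trans hb.2⟩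
  refine ⟨cdf κ, q, (continuous_cdf κ).measurable, hqm, ?_, hq⟩
  have hfin : IsFiniteMeasure (volume.restrict (Set.Ioo (0 : ℝ) 1)) :=
    ⟨by simp⟩
  have := Measure.isFiniteMeasure_map (volume.restrict (Set.Ioo (0 : ℝ) 1)) q
  -- Within (0, 1), the set where q t ≤ x lies between the open and the half-open interval from 0 to
  -- `cdf κ x`.
  refine Measure.ext_of_Iic _ _ fun x => ?_
  rw [Measure.map_apply hqm measurableSet_Iic, Measure.restrict_apply (hqm measurableSet_Iic),
    ← ofReal_cdf]
  refine le_antisymm ?_ ?_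
  · refine (measure_mono (t := Set.Ioc 0 (cdf κ x)) ?_).trans (by simp)
    rintro t ⟨ht, ht'⟩
    refine ⟨ht'.1, ?_⟩
    rw [← hq t ht']
    exact monotone_cdf κ ht
  · refine le_trans (by simp) (measure_mono (s := Set.Ioo 0 (cdf κ x)) ?_)
    intro t ht
    have ht' : t ∈ Set.Ioo (0 : ℝ) 1 := ⟨ht.1, ht.2.trans_le (cdf_le_one κ x)⟩
    refine ⟨?_, ht'⟩
    by_contra hlt
    have h1 := monotone_cdf κ (not_le.1 hlt).le
    rw [hq t ht'] at h1
    exact absurd ht.2 (not_lt.2 h1)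

/-- Both measures are transported to the uniform law on (0, 1) by their distribution functions and
back by quantiles. On Ω only a real code `e` with an almost sure left inverse is needed, not a
standard Borel structure. -/
theorem exists_ae_isomorphism {Ω : Type*} [MeasurableSpace Ω] (p : Measure Ω)
    [IsProbabilityMeasure p] {e : Ω → ℝ} {f : ℝ → Ω} (he : Measurable e) (hf : Measurable f)
    (hfe : ∀ᵐ ω ∂p, f (e ω) = ω) [NullSingletonClass (p.map e)] (ν : Measure ℝ) [IsProbabilityMeasure ν]
    [NullSingletonClass ν] :
    ∃ (α : ℝ → Ω) (β : Ω → ℝ), Measurable α ∧ Measurable β ∧ p.map β = ν ∧ ν.map α = p ∧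
      (∀ᵐ ω ∂p, α (β ω) = ω) ∧ ∀ᵐ u ∂ν, β (α u) = u := by
  have := Measure.isProbabilityMeasure_map (μ := p) he.aemeasurable
  obtain ⟨F, q, hF, hq, h1, h2⟩ := exists_quantile (p.map e)
  obtain ⟨F', q', hF', hq', h1', h2'⟩ := exists_quantile ν
  set I : Measure ℝ := volume.restrict (Set.Ioo (0 : ℝ) 1) with hI
  have hI' : ∀ᵐ t ∂I, t ∈ Set.Ioo (0 : ℝ) 1 := ae_restrict_mem measurableSet_Ioo
  have hqF : ∀ᵐ x ∂(p.map e), q (F x) = x := by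
    rw [← h1, ae_map_iff (p := fun x => q (F x) = x) hq.aemeasurable (measurableSet_eq_fun (hq.comp hF) measurable_id)]
    filter_upwards [hI'] with t ht
    rw [h2 t ht]
  have hqF' : ∀ᵐ x ∂ν, q' (F' x) = x := by
    rw [← h1', ae_map_iff (p := fun x => q' (F' x) = x) hq'.aemeasurable (measurableSet_eq_fun (hq'.comp hF') measurable_id)]
    filter_upwards [hI'] with t ht
    rw [h2' t ht]
  have hmapF : (p.map e).map F = I := by
    rw [← h1, Measure.map_map hF hq]
    conv_rhs => rw [← Measure.map_id (μ := I)]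
    exact Measure.map_congr (hI'.mono fun t ht => h2 t ht)
  have hmapF' : ν.map F' = I := by
    rw [← h1', Measure.map_map hF' hq']
    conv_rhs => rw [← Measure.map_id (μ := I)]
    exact Measure.map_congr (hI'.mono fun t ht => h2' t ht)
  have hef : ∀ᵐ x ∂(p.map e), e (f x) = x := by
    rw [ae_map_iff (p := fun x => e (f x) = x) he.aemeasurable (measurableSet_eq_fun (he.comp hf) measurable_id)]
    filter_upwards [hfe] with ω hω
    rw [hω]
  have hIp : ∀ᵐ ω ∂p, F (e ω) ∈ Set.Ioo (0 : ℝ) 1 := by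
    rw [← hmapF] at hI'
    exact ae_of_ae_map he.aemeasurable (ae_of_ae_map hF.aemeasurable hI')
  have hIν : ∀ᵐ x ∂ν, F' x ∈ Set.Ioo (0 : ℝ) 1 := by
    rw [← hmapF'] at hI'
    exact ae_of_ae_map hF'.aemeasurable hI'
  refine ⟨f ∘ q ∘ F', q' ∘ F ∘ e, hf.comp (hq.comp hF'), hq'.comp (hF.comp he), ?_, ?_, ?_, ?_⟩
  · rw [← Measure.map_map hq' (hF.comp he), ← Measure.map_map hF he, hmapF, h1']
  · rw [← Measure.map_map hf (hq.comp hF'), ← Measure.map_map hq hF', hmapF', h1,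
      Measure.map_map hf he]
    conv_rhs => rw [← Measure.map_id (μ := p)]
    exact Measure.map_congr hfe
  · filter_upwards [hIp, hfe, ae_of_ae_map he.aemeasurable hqF] with ω h3 h4 h5
    simp only [Function.comp]
    rw [h2' _ h3, h5, h4]
  · have h3 : ∀ᵐ x ∂ν, e (f (q (F' x))) = q (F' x) := by
      have : ∀ᵐ x ∂(ν.map (q ∘ F')), e (f x) = x := by
        rwa [← Measure.map_map hq hF', hmapF', h1]
      exact ae_of_ae_map (hq.comp hF').aemeasurable this
    filter_upwards [h3, hIν, hqF'] with x h4 h5 h6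
    simp only [Function.comp]
    rw [h4, h2 _ h5, h6]

end Isomorphism

/-! ### Encoding sequences of Poisson processes in one radius -/

section Enumeration

theorem pickVal_eq_default_or {α β : Type*} [Inhabited β] (S : Set α) (p : α → Prop) (f : α → β) :
    pickVal S p f = default ∨ ∃ x ∈ S, p x ∧ f x = pickVal S p f := by
  unfold pickVal chooseOrDefault
  split_ifs with h
  · obtain ⟨⟨x, hx, hpx⟩, h2⟩ := h.choose_spec
    exact Or.inr ⟨x, hx, hpx, h2 x hx hpx⟩
  · exact Or.inl rfl

namespace PointMeasure

variable {d : ℕ}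

/-- The number of points closer to the origin than `x`. -/
def rank (μ : PointMeasure d) (x : Euc d) : ℝ≥0∞ :=
  open Classical in ∑' y : μ.pts, if ‖(y : Euc d)‖ < ‖x‖ then 1 else 0

/-- The points in the order of their distances from the origin. -/
def enum (μ : PointMeasure d) (n : ℕ) : Euc d :=
  pickVal μ.pts (fun x => μ.rank x = n) (fun x => x)

theorem measurable_rank : Measurable fun q : PointMeasure d × Euc d => q.1.rank q.2 := by
  classical
  refine measurable_tsum_pts (Z := fun q : PointMeasure d × Euc d => q.1) measurable_fst
    (f := fun q y => if ‖y‖ < ‖q.2‖ then 1 else 0) ?_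
  exact Measurable.ite (measurableSet_lt measurable_snd.norm measurable_fst.snd.norm)
    measurable_const measurable_const

theorem measurable_enum : Measurable (enum : PointMeasure d → ℕ → Euc d) :=
  measurable_pi_lambda _ fun n => measurable_pickVal measurable_id
    (p := fun μ x => μ.rank x = n) (measurable_rank (measurableSet_singleton _))
    (f := fun _ x => x) measurable_snd

theorem rank_eq_encard (μ : PointMeasure d) (x : Euc d) :
    μ.rank x = ({y | y ∈ μ.pts ∧ ‖y‖ < ‖x‖}.encard : ℝ≥0∞) := by
  classical
  rw [rank, ← ENNReal.tsum_set_one, tsum_subtype _ (fun _ => (1 : ℝ≥0∞)),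
    tsum_subtype μ.pts (fun y => if ‖y‖ < ‖x‖ then (1 : ℝ≥0∞) else 0)]
  refine tsum_congr fun y => ?_
  by_cases h1 : y ∈ μ.pts <;> by_cases h2 : ‖y‖ < ‖x‖ <;> simp [Set.indicator, h1, h2]

theorem finite_norm_lt (μ : PointMeasure d) (x : Euc d) : {y | y ∈ μ.pts ∧ ‖y‖ < ‖x‖}.Finite := by
  obtain ⟨n, hn⟩ := exists_nat_gt ‖x‖
  refine (μ.locFin_pts n).subset fun y hy => ⟨hy.1, ?_⟩
  rw [mem_ball_zero_iff]
  exact hy.2.trans hn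

theorem exists_rank_eq (μ : PointMeasure d) (x : Euc d) : ∃ n : ℕ, μ.rank x = n := by
  rw [rank_eq_encard, ← (μ.finite_norm_lt x).cast_ncard_eq]
  exact ⟨_, rfl⟩

theorem rank_lt_of_norm_lt {μ : PointMeasure d} {x y : Euc d} (hx : x ∈ μ.pts)
    (h : ‖x‖ < ‖y‖) : μ.rank x < μ.rank y := by
  rw [rank_eq_encard, rank_eq_encard, ENat.toENNReal_lt]
  refine (μ.finite_norm_lt x).encard_lt_encard ⟨fun z hz => ⟨hz.1, hz.2.trans h⟩, fun hs => ?_⟩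
  exact lt_irrefl _ (hs (⟨hx, h⟩ : x ∈ {z | z ∈ μ.pts ∧ ‖z‖ < ‖y‖})).2

/-- The set of nonzero points in a sequence. -/
def ofSeq (s : ℕ → Euc d) : PointMeasure d := ofSet (Set.range s \ {0})

/-- Ranks of distinct points differ because their norms do. Unattained ranks give the default value
0, which `ofSeq` discards; no atom is lost, as the origin is not one. -/
theorem ofSeq_enum {μ : PointMeasure d} (hl : LocFin μ.supp) (h0 : (0 : Euc d) ∉ μ.supp)
    (hn : ∀ x ∈ μ.pts, ∀ y ∈ μ.pts, x ≠ y → ‖x‖ ≠ ‖y‖) : ofSeq μ.enum = μ := by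
  have : Set.range μ.enum \ {0} = μ.supp := by
    ext x
    constructor
    · rintro ⟨⟨n, rfl⟩, hne⟩
      rcases pickVal_eq_default_or μ.pts (fun x => μ.rank x = n) (fun x => x) with h | ⟨x, hx, _, h⟩
      · exact absurd h hne
      · rw [← pts_eq_supp hl]
        exact (show x = μ.enum n from h) ▸ hx
    · intro hx
      have hx' : x ∈ μ.pts := by rwa [pts_eq_supp hl]
      refine ⟨?_, fun h => h0 (h ▸ hx)⟩
      obtain ⟨n, hn'⟩ := μ.exists_rank_eq x
      refine ⟨n, ?_⟩
      refine pickVal_eq (p := fun x => μ.rank x = n) (f := fun x => x) hx' hn' fun y hy hyn => ?_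
      by_contra hne
      rcases lt_or_gt_of_ne (hn y hy x hx' hne) with h | h
      · exact absurd (rank_lt_of_norm_lt hy h) (by rw [hyn, hn']; exact lt_irrefl _)
      · exact absurd (rank_lt_of_norm_lt hx' h) (by rw [hyn, hn']; exact lt_irrefl _)
  rw [ofSeq, this, ofSet_supp]

theorem measurable_ofSeq : Measurable (ofSeq : (ℕ → Euc d) → PointMeasure d) := by
  classical
  refine measurable_ofSet_of_encard (fun s => (Set.countable_range s).mono Set.sdiff_subset)
    fun A hA => ?_
  -- Values of the sequence may repeat, so each is counted at its first index.
  have h1 : ∀ s : ℕ → Euc d, (((Set.range s \ {0}) ∩ A).encard : ℝ≥0∞) =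
      ∑' n : ℕ, if (∀ k < n, s k ≠ s n) ∧ s n ≠ 0 ∧ s n ∈ A then 1 else 0 := by
    intro s
    have h2 : (Set.range s \ {0}) ∩ A = s '' {n | (∀ k < n, s k ≠ s n) ∧ s n ≠ 0 ∧ s n ∈ A} := by
      ext x
      constructor
      · rintro ⟨⟨hx, hx0⟩, hxA⟩
        have hex : ∃ n, s n = x := hx
        have hs := Nat.find_spec hex
        refine ⟨Nat.find hex, ⟨fun k hk => ?_, ?_, ?_⟩, hs⟩
        · rw [hs]; exact Nat.find_min hex hk
        · rw [hs]; exact hx0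
        · rw [hs]; exact hxA
      · rintro ⟨n, hn, rfl⟩
        exact ⟨⟨⟨n, rfl⟩, hn.2.1⟩, hn.2.2⟩
    have h3 : Set.InjOn s {n | (∀ k < n, s k ≠ s n) ∧ s n ≠ 0 ∧ s n ∈ A} := by
      intro a ha b hb he
      rcases lt_trichotomy a b with h | h | h
      · exact absurd he (hb.1 a h)
      · exact h
      · exact absurd he.symm (ha.1 b h)
    rw [h2, h3.encard_image, ← ENNReal.tsum_set_one, tsum_subtype _ (fun _ => (1 : ℝ≥0∞))]
    refine tsum_congr fun n => ?_
    simp [Set.indicator]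
  simp_rw [h1]
  refine Measurable.tsum fun n => Measurable.ite ?_ measurable_const measurable_const
  have hs : ∀ k, Measurable fun s : ℕ → Euc d => s k := fun k => measurable_pi_apply k
  refine MeasurableSet.inter ?_ (MeasurableSet.inter ?_ (hs n hA))
  · have : {s : ℕ → Euc d | ∀ k < n, s k ≠ s n} = ⋂ k, ⋂ _ : k < n, {s | s k = s n}ᶜ := by
      ext s
      simp
    have hm : MeasurableSet {s : ℕ → Euc d | ∀ k < n, s k ≠ s n} := by
      rw [this]
      exact MeasurableSet.iInter fun k => MeasurableSet.iInter fun _ =>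
        (measurableSet_eq_fun (hs k) (hs n)).compl
    exact hm
  · exact (measurableSet_eq_fun (hs n) measurable_const).compl

end PointMeasure

open PointMeasure

/-- A single real random variable with the radius law encodes a sequence of independent Poisson
processes. -/
theorem exists_radius_code {d : ℕ} (hd : 1 ≤ d) {s : ℝ≥0} (hs : 0 < s) {Q : Measure (PointMeasure d)}
    (h : IsPoissonLaw s Q) [IsProbabilityMeasure Q] :
    ∃ (α : ℝ → ℕ → PointMeasure d) (β : (ℕ → PointMeasure d) → ℝ), Measurable α ∧ Measurable β ∧
      (∀ z, β z ∈ Set.Ioo (0 : ℝ) (1 / 2)) ∧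
      (Measure.infinitePi fun _ : ℕ => Q).map β = radiusLaw d ∧
      (radiusLaw d).map α = Measure.infinitePi (fun _ : ℕ => Q) ∧
      (∀ᵐ z ∂(Measure.infinitePi fun _ : ℕ => Q), α (β z) = z) ∧
      ∀ᵐ u ∂radiusLaw d, β (α u) = u := by
  set p := Measure.infinitePi (fun _ : ℕ => Q) with hp
  have hcode : ∀ᵐ μ ∂Q, ofSeq μ.enum = μ := by
    filter_upwards [h.ae_locFin, h.ae_notMem hd 0, h.ae_norm_ne hd] with μ h1 h2 h3
    exact ofSeq_enum h1 h2 h3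
  have hcode' : ∀ᵐ z ∂p, ∀ n, ofSeq (z n).enum = z n := by
    rw [ae_all_iff]
    intro n
    exact (measurePreserving_eval_infinitePi (fun _ : ℕ => Q) n).quasiMeasurePreserving.ae hcode
  have hemb := measurableEmbedding_embeddingReal (ℕ → ℕ → Euc d)
  obtain ⟨g, hg, hge⟩ := hemb.exists_measurable_extend measurable_id fun _ => inferInstance
  let c : (ℕ → PointMeasure d) → ℕ → ℕ → Euc d := fun z n => (z n).enum
  have hc : Measurable c := measurable_pi_lambda _ fun n => measurable_enum.comp (measurable_pi_apply n)
  let dec : (ℕ → ℕ → Euc d) → ℕ → PointMeasure d := fun x n => ofSeq (x n)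
  have hdec : Measurable dec :=
    measurable_pi_lambda _ fun n => measurable_ofSeq.comp (measurable_pi_apply n)
  have he : Measurable (embeddingReal (ℕ → ℕ → Euc d) ∘ c) := hemb.measurable.comp hc
  have hfe : ∀ᵐ z ∂p, (dec ∘ g) ((embeddingReal (ℕ → ℕ → Euc d) ∘ c) z) = z := by
    filter_upwards [hcode'] with z hz
    have : g (embeddingReal (ℕ → ℕ → Euc d) (c z)) = c z := congrFun hge (c z)
    simp only [Function.comp, this]
    funext n
    exact hz n
  -- An atom would make `z 0` equal to one fixed point measure with positive probability. If that
  -- measure has no `pts`, this contradicts nonemptiness, which uses `hs`; if it has some point,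
  -- that point is almost surely not an atom of `z 0`.
  have hnull : NullSingletonClass (p.map (embeddingReal (ℕ → ℕ → Euc d) ∘ c)) := by
    refine ⟨fun t => ?_⟩
    rw [Measure.map_apply he (measurableSet_singleton t)]
    have h1 : ∀ᵐ μ ∂Q, μ ≠ (dec (g t)) 0 := by
      rcases ((dec (g t)) 0).pts.eq_empty_or_nonempty with h2 | ⟨x, hx⟩
      · filter_upwards [h.ae_pts_nonempty hd hs] with μ hμ he
        rw [he, h2] at hμ
        exact Set.not_nonempty_empty hμ
      · filter_upwards [h.ae_notMem hd x] with μ hμ he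
        exact hμ (he ▸ pts_subset_supp _ hx)
    have h2 : ∀ᵐ z ∂p, z 0 ≠ (dec (g t)) 0 :=
      (measurePreserving_eval_infinitePi (fun _ : ℕ => Q) 0).quasiMeasurePreserving.ae h1
    rw [← compl_compl ((embeddingReal (ℕ → ℕ → Euc d) ∘ c) ⁻¹' {t})]
    refine mem_ae_iff.1 ?_
    filter_upwards [h2, hfe] with z h3 h4 h5
    have h6 : (embeddingReal (ℕ → ℕ → Euc d) ∘ c) z = t := h5
    rw [h6] at h4
    exact h3 (congrFun h4 0).symm
  obtain ⟨α, β, hα, hβ, h1, h2, h3, h4⟩ := exists_ae_isomorphism p he (hdec.comp hg) hfe (radiusLaw d)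
  have hmem : ∀ᵐ z ∂p, clipRadius (β z) = β z := by
    have h5 := ae_radiusLaw (d := d)
    rw [← h1] at h5
    filter_upwards [ae_of_ae_map hβ.aemeasurable h5] with z hz
    exact clipRadius_of_mem hz
  refine ⟨α, clipRadius ∘ β, hα, measurable_clipRadius.comp hβ, fun z => clipRadius_mem _, ?_, h2,
    ?_, ?_⟩
  · rw [← h1]
    exact Measure.map_congr hmem
  · filter_upwards [hmem, h3] with z h5 h6
    simp only [Function.comp, h5, h6]
  · filter_upwards [h4, ae_radiusLaw] with u h5 h6
    simp only [Function.comp, h5, clipRadius_of_mem h6]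

end Enumeration

/-! ### The split and merge maps -/

section Maps

variable {d : ℕ}

/-- The cell of a special centre, in the coordinates given by its frame. -/
def locCell (S : Set (Euc d)) (m : Euc d) : Set (Euc d) :=
  {x | Special S m ∧ toWorld S m x ∈ cell S m}

/-- `A` inside `D` and `B` outside. -/
def mixSet (D A B : Set (Euc d)) : Set (Euc d) := A ∩ D ∪ B \ D

/-- Insert `A` inside `D` in front of a sequence of point measures. -/
def mergeSeq (D A : Set (Euc d)) (z : ℕ → PointMeasure d) : ℕ → PointMeasure d
  | 0 => PointMeasure.ofSet (mixSet D A (z 0).pts)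
  | n + 1 => PointMeasure.ofSet (mixSet D (z n).pts (z (n + 1)).pts)

/-- Remove the first term inside `D` from a sequence of point measures. -/
def splitSeq (D : Set (Euc d)) (z : ℕ → PointMeasure d) (n : ℕ) : PointMeasure d :=
  PointMeasure.ofSet (mixSet D (z (n + 1)).pts (z n).pts)

/-- The radius that remains after a configuration has been extracted. -/
def splitRadius (α : ℝ → ℕ → PointMeasure d) (β : (ℕ → PointMeasure d) → ℝ) (S : Set (Euc d))
    (m : Euc d) : ℝ :=
  β (splitSeq (locCell S m) (α (radius S m)))

/-- The configuration encoded by the radii. -/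
def extractSet (α : ℝ → ℕ → PointMeasure d) (S : Set (Euc d)) : Set (Euc d) :=
  {y | ∃ m, Special S m ∧ y ∈ cell S m ∧ toLocal S m y ∈ (α (radius S m) 0).pts}

/-- The radius that encodes in addition the part of `A` in the cell. -/
def mergeRadius (α : ℝ → ℕ → PointMeasure d) (β : (ℕ → PointMeasure d) → ℝ) (S A : Set (Euc d))
    (m : Euc d) : ℝ :=
  β (mergeSeq (locCell S m) (toLocal S m '' A) (α (radius S m)))

/-- Extract a second point process from the radii of the special pairs. -/
def splitMap (α : ℝ → ℕ → PointMeasure d) (β : (ℕ → PointMeasure d) → ℝ) (μ : PointMeasure d) :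
    PointMeasure d × PointMeasure d :=
  (PointMeasure.ofSet (setRadius μ.pts (splitRadius α β μ.pts)),
    PointMeasure.ofSet (extractSet α μ.pts))

/-- Encode a second point process in the radii of the special pairs. -/
def mergeMap (α : ℝ → ℕ → PointMeasure d) (β : (ℕ → PointMeasure d) → ℝ)
    (p : PointMeasure d × PointMeasure d) : PointMeasure d :=
  PointMeasure.ofSet (setRadius p.1.pts (mergeRadius α β p.1.pts p.2.pts))

theorem LocFin.mixSet {D A B : Set (Euc d)} (hA : LocFin A) (hB : LocFin B) :
    LocFin (mixSet D A B) :=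
  (hA.subset Set.inter_subset_left).union (hB.subset Set.sdiff_subset)

theorem mixSet_mixSet (D A B C E : Set (Euc d)) :
    mixSet D (mixSet D A B) (mixSet D C E) = mixSet D A E := by
  ext x
  by_cases h : x ∈ D <;> simp [mixSet, h]

theorem mixSet_self (D A : Set (Euc d)) : mixSet D A A = A := by
  ext x
  simp [mixSet]

/-- Hilbert's hotel: merging moves the parts inside `D` one place up the sequence and leaves the
parts outside where they are; splitting moves the inner parts back down. -/
theorem splitSeq_mergeSeq {D A : Set (Euc d)} (hA : LocFin A) {z : ℕ → PointMeasure d}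
    (hz : ∀ n, LocFin (z n).supp) : splitSeq D (mergeSeq D A z) = z := by
  funext n
  have h : PointMeasure.ofSet (z n).pts = z n := by
    rw [PointMeasure.pts_eq_supp (hz n), PointMeasure.ofSet_supp]
  cases n with
  | zero =>
    rw [splitSeq, mergeSeq, mergeSeq, PointMeasure.pts_ofSet (hA.mixSet (z 0).locFin_pts),
      PointMeasure.pts_ofSet ((z 0).locFin_pts.mixSet (z 1).locFin_pts), mixSet_mixSet, mixSet_self, h]
  | succ n =>
    rw [splitSeq, mergeSeq, mergeSeq,
      PointMeasure.pts_ofSet ((z n).locFin_pts.mixSet (z (n + 1)).locFin_pts),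
      PointMeasure.pts_ofSet ((z (n + 1)).locFin_pts.mixSet (z (n + 1 + 1)).locFin_pts),
      mixSet_mixSet, mixSet_self, h]

/-- The special centre in a given cell of the unit grid. -/
def centerAt (S : Set (Euc d)) (k : Fin d → ℤ) : Euc d :=
  pickVal S (fun x => InSpecialPair S x ∧ grid (centerOf S x) = k) (centerOf S)

theorem Special.centerAt_eq {S : Set (Euc d)} {m : Euc d} (hm : Special S m) :
    centerAt S (grid m) = m := by
  obtain ⟨a, ha, b, hb, h⟩ := hm.center
  have hc := hm.centerOf_eq ha h.dist_lt
  have h1 : centerAt S (grid m) = centerOf S a := by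
    refine pickVal_eq (f := centerOf S) ha ⟨hm.inSpecialPair ha h.dist_lt, by rw [hc]⟩ ?_
    rintro y hy ⟨⟨z, hz, hs, hlt⟩, hg⟩
    rw [hs.centerOf_eq hy hlt] at hg ⊢
    rw [hc]
    exact hm.unique hs (dist_lt_of_grid_eq hg)
  rw [h1, hc]

/-- A point of the ball that prefers `m` to a fixed centre m₀ forces ‖m‖ < 2R + ‖m₀‖. Hence only
finitely many cells contribute near the origin, and the extracted set is locally finite. -/
theorem finite_special_cell_meets_ball {S : Set (Euc d)} (hS : LocFin S) (R : ℝ) :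
    {m | Special S m ∧ (cell S m ∩ Metric.ball 0 R).Nonempty}.Finite := by
  by_cases hne : ∃ m, Special S m
  · obtain ⟨m₀, hm₀⟩ := hne
    refine ((hS.finite_special 0 (2 * R + ‖m₀‖)).union (Set.finite_singleton m₀)).subset ?_
    rintro m ⟨hm, x, hx, hxR⟩
    by_cases he : m = m₀
    · exact Or.inr he
    · refine Or.inl ⟨hm, ?_⟩
      have h1 := hx m₀ hm₀ (Ne.symm he)
      have h2 := dist_triangle_left m 0 x
      have h3 := dist_triangle_right x m₀ 0
      rw [Metric.mem_ball] at hxR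
      rw [dist_zero_right m₀] at h3
      linarith
  · push Not at hne
    refine Set.finite_empty.subset fun m hm => hne m hm.1

theorem LocFin.image_toWorld {S A : Set (Euc d)} {m : Euc d} (hm : Special S m) (hA : LocFin A) :
    LocFin (toWorld S m '' A) := by
  obtain ⟨L, h1, -⟩ := exists_linearIsometryEquiv_frame hm.frame.2
  have := hA.image_isometry (L.toIsometryEquiv.trans (IsometryEquiv.addLeft m))
  convert this using 2
  exact h1 _

theorem LocFin.image_toLocal {S A : Set (Euc d)} {m : Euc d} (hm : Special S m) (hA : LocFin A) :
    LocFin (toLocal S m '' A) := by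
  obtain ⟨L, -, h2⟩ := exists_linearIsometryEquiv_frame hm.frame.2
  have := hA.image_isometry ((IsometryEquiv.subRight m).trans L.symm.toIsometryEquiv)
  convert this using 2
  exact h2 _

theorem LocFin.extractSet (α : ℝ → ℕ → PointMeasure d) {S : Set (Euc d)} (hS : LocFin S) :
    LocFin (extractSet α S) := by
  intro n
  have hfin := finite_special_cell_meets_ball hS n
  refine (hfin.biUnion fun m hm =>
    (LocFin.image_toWorld hm.1 (α (radius S m) 0).locFin_pts) n).subset ?_
  rintro y ⟨⟨m, hm, hc, hy⟩, hn⟩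
  refine Set.mem_biUnion (x := m) ⟨hm, y, hc, hn⟩ ⟨⟨_, hy, hm.toWorld_toLocal y⟩, hn⟩

theorem goodRadii_splitRadius {α : ℝ → ℕ → PointMeasure d} {β : (ℕ → PointMeasure d) → ℝ}
    (hβ : ∀ z, β z ∈ Set.Ioo (0 : ℝ) (1 / 2)) (S : Set (Euc d)) :
    GoodRadii S (splitRadius α β S) := fun _ _ => hβ _

theorem goodRadii_mergeRadius {α : ℝ → ℕ → PointMeasure d} {β : (ℕ → PointMeasure d) → ℝ}
    (hβ : ∀ z, β z ∈ Set.Ioo (0 : ℝ) (1 / 2)) (S A : Set (Euc d)) :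
    GoodRadii S (mergeRadius α β S A) := fun _ _ => hβ _

/-- Indexing the centres by grid cells gives a countable union, which is disjoint since the Voronoi
cells are; measurability can then be checked term by term. -/
theorem extractSet_eq_iUnion (α : ℝ → ℕ → PointMeasure d) (S : Set (Euc d)) :
    extractSet α S = ⋃ k, toWorld S (centerAt S k) '' {x | x ∈ (α (radius S (centerAt S k)) 0).pts ∧
      (x ∈ locCell S (centerAt S k) ∧ grid (centerAt S k) = k)} := by
  ext y
  simp only [Set.mem_iUnion, Set.mem_image, Set.mem_ofPred_eq]
  constructor
  · rintro ⟨m, hm, hc, hy⟩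
    refine ⟨grid m, toLocal S m y, ?_⟩
    rw [hm.centerAt_eq]
    exact ⟨⟨hy, ⟨hm, by rwa [hm.toWorld_toLocal]⟩, rfl⟩, hm.toWorld_toLocal y⟩
  · rintro ⟨k, x, ⟨hx, ⟨hm, hc⟩, _⟩, rfl⟩
    exact ⟨_, hm, hc, by rwa [hm.toLocal_toWorld]⟩

end Maps

/-! ### Measurability of the split and merge maps -/

namespace PointMeasure

variable {d : ℕ} {Ω : Type*} [MeasurableSpace Ω] {Z Z' : Ω → PointMeasure d}

theorem measurableSet_locCell (hZ : Measurable Z) {m x : Ω → Euc d} (hm : Measurable m)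
    (hx : Measurable x) : MeasurableSet {ω | x ω ∈ locCell (Z ω).pts (m ω)} :=
  (measurableSet_special hZ hm).inter (measurableSet_cell hZ hm (measurable_toWorld hZ hm hx))

theorem measurable_mixSet_image (hZ : Measurable Z) (hZ' : Measurable Z') {D : Ω → Set (Euc d)}
    (hD : MeasurableSet {q : Ω × Euc d | q.2 ∈ D q.1}) {f : Ω → Euc d → Euc d}
    (hf : Measurable fun q : Ω × Euc d => f q.1 q.2)
    (hinj : ∀ ω, Set.InjOn (f ω) {x | x ∈ (Z ω).pts ∧ f ω x ∈ D ω}) :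
    Measurable fun ω => ofSet (mixSet (D ω) (f ω '' (Z ω).pts) (Z' ω).pts) := by
  have h1 := measurable_ofSet_image hZ (p := fun ω x => f ω x ∈ D ω)
    (hD.preimage (measurable_fst.prodMk hf)) hf hinj
  have h2 := measurable_ofSet_image hZ' (p := fun ω x => x ∉ D ω) hD.compl
    (f := fun _ x => x) measurable_snd (fun ω x _ y _ h => h)
  have h3 : ∀ ω, mixSet (D ω) (f ω '' (Z ω).pts) (Z' ω).pts =
      f ω '' {x | x ∈ (Z ω).pts ∧ f ω x ∈ D ω} ∪
      (fun x => x) '' {x | x ∈ (Z' ω).pts ∧ x ∉ D ω} := by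
    intro ω
    rw [mixSet, Set.image_id']
    congr 1
    ext y
    constructor
    · rintro ⟨⟨x, hx, rfl⟩, hy⟩
      exact ⟨x, ⟨hx, hy⟩, rfl⟩
    · rintro ⟨x, ⟨hx, hy⟩, rfl⟩
      exact ⟨⟨x, hx, rfl⟩, hy⟩
  simp_rw [h3]
  refine measurable_ofSet_union (fun ω => ((Z ω).countable_pts.mono fun x hx => hx.1).image _)
    (fun ω => ((Z' ω).countable_pts.mono fun x hx => hx.1).image _) (fun ω => ?_) h1 h2
  rw [Set.disjoint_left]
  rintro y ⟨x, hx, rfl⟩ ⟨x', hx', he⟩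
  have : x' = f ω x := he
  exact hx'.2 (this ▸ hx.2)

theorem measurable_mixSet (hZ : Measurable Z) (hZ' : Measurable Z') {D : Ω → Set (Euc d)}
    (hD : MeasurableSet {q : Ω × Euc d | q.2 ∈ D q.1}) :
    Measurable fun ω => ofSet (mixSet (D ω) (Z ω).pts (Z' ω).pts) := by
  have := measurable_mixSet_image hZ hZ' hD (f := fun _ x => x) measurable_snd
    (fun ω x _ y _ h => h)
  simpa only [Set.image_id'] using this

theorem measurable_ofSet_iUnion {ι : Type*} [Countable ι] {T : ι → Ω → Set (Euc d)}
    (hc : ∀ k ω, (T k ω).Countable) (hd : ∀ ω, Pairwise fun k l => Disjoint (T k ω) (T l ω))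
    (hm : ∀ k, Measurable fun ω => ofSet (T k ω)) :
    Measurable fun ω => ofSet (⋃ k, T k ω) := by
  refine measurable_ofSet_of_encard (fun ω => Set.countable_iUnion fun k => hc k ω) fun A hA => ?_
  have h1 : ∀ ω, (((⋃ k, T k ω) ∩ A).encard : ℝ≥0∞) = ∑' k, (ofSet (T k ω)).toMeasure A := by
    intro ω
    simp_rw [toMeasure_ofSet (hc _ ω), sumDirac_apply hA]
    rw [Set.iUnion_inter, ← ENNReal.tsum_set_one,
      ENNReal.tsum_biUnion (f := fun _ => (1 : ℝ≥0∞)) (t := fun k => T k ω ∩ A)]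
    · simp_rw [ENNReal.tsum_set_one]
    · intro k _ l _ hkl
      exact (hd ω hkl).mono Set.inter_subset_left Set.inter_subset_left
  simp_rw [h1]
  exact Measurable.tsum fun k => (measurable_count hA).comp (hm k)

theorem measurable_centerAt (hZ : Measurable Z) (k : Fin d → ℤ) :
    Measurable fun ω => centerAt (Z ω).pts k := by
  have h1 : Measurable fun q : Ω × Euc d => centerOf (Z q.1).pts q.2 :=
    measurable_centerOf (Z := fun q : Ω × Euc d => Z q.1) (hZ.comp measurable_fst) measurable_snd
  exact measurable_pickVal hZ
    (p := fun ω x => InSpecialPair (Z ω).pts x ∧ grid (centerOf (Z ω).pts x) = k)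
    ((measurableSet_inSpecialPair (Z := fun q : Ω × Euc d => Z q.1) (hZ.comp measurable_fst)
      measurable_snd).inter ((measurable_grid.comp h1) (measurableSet_singleton k)))
    (f := fun ω x => centerOf (Z ω).pts x) h1

variable {α : ℝ → ℕ → PointMeasure d} {β : (ℕ → PointMeasure d) → ℝ}

theorem measurable_code (hα : Measurable α) (hZ : Measurable Z) {m : Ω → Euc d} (hm : Measurable m)
    (n : ℕ) : Measurable fun ω => α (radius (Z ω).pts (m ω)) n :=
  (measurable_pi_apply n).comp (hα.comp (measurable_radius hZ hm))

theorem measurable_splitRadius (hα : Measurable α) (hβ : Measurable β) (hZ : Measurable Z)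
    {m : Ω → Euc d} (hm : Measurable m) :
    Measurable fun ω => splitRadius α β (Z ω).pts (m ω) := by
  refine hβ.comp (measurable_pi_lambda _ fun n => ?_)
  exact measurable_mixSet (measurable_code hα hZ hm (n + 1)) (measurable_code hα hZ hm n)
    (measurableSet_locCell (Z := fun q : Ω × Euc d => Z q.1) (hZ.comp measurable_fst)
      (hm.comp measurable_fst) measurable_snd)

theorem measurable_mergeRadius (hα : Measurable α) (hβ : Measurable β) (hZ : Measurable Z)
    (hZ' : Measurable Z') {m : Ω → Euc d} (hm : Measurable m) :
    Measurable fun ω => mergeRadius α β (Z ω).pts (Z' ω).pts (m ω) := by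
  have hD := measurableSet_locCell (Z := fun q : Ω × Euc d => Z q.1) (hZ.comp measurable_fst)
      (hm.comp measurable_fst) measurable_snd
  refine hβ.comp (measurable_pi_lambda _ fun n => ?_)
  cases n with
  | zero =>
    refine measurable_mixSet_image hZ' (measurable_code hα hZ hm 0) hD
      (f := fun ω => toLocal (Z ω).pts (m ω))
      (measurable_toLocal (Z := fun q : Ω × Euc d => Z q.1) (hZ.comp measurable_fst)
        (hm.comp measurable_fst) measurable_snd) ?_
    -- A point in `locCell` certifies that the centre is special, and then `toLocal` is injective.
    rintro ω x ⟨_, hx⟩ y _ he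
    rw [← hx.1.toWorld_toLocal x, he, hx.1.toWorld_toLocal]
  | succ n =>
    exact measurable_mixSet (measurable_code hα hZ hm n) (measurable_code hα hZ hm (n + 1)) hD

theorem measurable_ofSet_extractSet (hα : Measurable α) (hZ : Measurable Z) :
    Measurable fun ω => ofSet (extractSet α (Z ω).pts) := by
  simp_rw [extractSet_eq_iUnion]
  refine measurable_ofSet_iUnion (T := fun k ω => toWorld (Z ω).pts (centerAt (Z ω).pts k) ''
    {x | x ∈ (α (radius (Z ω).pts (centerAt (Z ω).pts k)) 0).pts ∧
      (x ∈ locCell (Z ω).pts (centerAt (Z ω).pts k) ∧ grid (centerAt (Z ω).pts k) = k)})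
    (fun k ω => ((countable_pts _).mono fun x hx => hx.1).image _) (fun ω k l hkl => ?_)
    fun k => ?_
  · refine Set.disjoint_left.2 ?_
    rintro y ⟨x, ⟨_, ⟨hs, hc⟩, hk⟩, rfl⟩ ⟨x', ⟨_, ⟨hs', hc'⟩, hl⟩, he⟩
    rw [he] at hc'
    have := cell_disjoint hs hs' hc hc'
    exact hkl (by rw [← hk, ← hl, this])
  · have hc := measurable_centerAt hZ k
    have hZ1 : Measurable fun q : Ω × Euc d => Z q.1 := hZ.comp measurable_fst
    have hc1 : Measurable fun q : Ω × Euc d => centerAt (Z q.1).pts k := hc.comp measurable_fst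
    refine measurable_ofSet_image (measurable_code hα hZ hc 0)
      (p := fun ω x => x ∈ locCell (Z ω).pts (centerAt (Z ω).pts k) ∧ grid (centerAt (Z ω).pts k) = k)
      ((measurableSet_locCell hZ1 hc1 measurable_snd).inter
        ((measurable_grid.comp hc1) (measurableSet_singleton k)))
      (f := fun ω x => toWorld (Z ω).pts (centerAt (Z ω).pts k) x)
      (measurable_toWorld hZ1 hc1 measurable_snd) ?_
    rintro ω x ⟨_, ⟨hs, _⟩, _⟩ y _ he
    exact hs.injective_toWorld he

theorem measurable_splitMap (hα : Measurable α) (hβ : Measurable β)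
    (hβ' : ∀ z, β z ∈ Set.Ioo (0 : ℝ) (1 / 2)) : Measurable (splitMap α β) :=
  (measurable_ofSet_setRadius measurable_id
    (measurable_splitRadius (Z := fun q : PointMeasure d × Euc d => q.1) hα hβ measurable_fst
      measurable_snd) fun μ => goodRadii_splitRadius hβ' μ.pts).prodMk
    (measurable_ofSet_extractSet hα measurable_id)

theorem measurable_mergeMap (hα : Measurable α) (hβ : Measurable β)
    (hβ' : ∀ z, β z ∈ Set.Ioo (0 : ℝ) (1 / 2)) : Measurable (mergeMap α β) :=
  measurable_ofSet_setRadius measurable_fst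
    (measurable_mergeRadius (Z := fun q : (PointMeasure d × PointMeasure d) × Euc d => q.1.1)
      (Z' := fun q : (PointMeasure d × PointMeasure d) × Euc d => q.1.2) hα hβ measurable_fst.fst
      measurable_fst.snd measurable_snd) fun p => goodRadii_mergeRadius hβ' p.1.pts p.2.pts

end PointMeasure

/-! ### Laplace functionals of independent families -/

section InfiniteProduct

variable {ι Ω : Type*} [MeasurableSpace Ω]

theorem lintegral_infinitePi_expNeg_sum (p : Measure Ω) [IsProbabilityMeasure p]
    {F : ι → Ω → ℝ≥0∞} (hF : ∀ k, Measurable (F k)) (I : Finset ι) :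
    ∫⁻ w, expNeg (∑ k ∈ I, F k (w k)) ∂(Measure.infinitePi fun _ : ι => p) =
      ∏ k ∈ I, ∫⁻ x, expNeg (F k x) ∂p := by
  classical
  induction I using Finset.induction_on with
  | empty => simp
  | insert k I hk ih =>
    have hm : ∀ J : Finset ι, Measurable fun w : ι → Ω => expNeg (∑ k ∈ J, F k (w k)) := fun J =>
      measurable_expNeg.comp (Finset.measurable_fun_sum _ fun k _ =>
        (hF k).comp (measurable_pi_apply k))
    rw [← (measurePreserving_update p k).lintegral_comp (hm _), Finset.prod_insert hk, ← ih]
    have h1 : ∀ q : (ι → Ω) × Ω, expNeg (∑ j ∈ insert k I, F j (Function.update q.1 k q.2 j)) =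
        expNeg (∑ j ∈ I, F j (q.1 j)) * expNeg (F k q.2) := by
      intro q
      rw [Finset.sum_insert hk, expNeg_add, mul_comm, Function.update_self]
      congr 2
      refine Finset.sum_congr rfl fun j hj => ?_
      rw [Function.update_of_ne (ne_of_mem_of_not_mem hj hk)]
    simp_rw [h1]
    rw [lintegral_prod_mul (g := fun x => expNeg (F k x)) (hm I).aemeasurable
      (measurable_expNeg.comp (hF k)).aemeasurable, mul_comm]

theorem lintegral_infinitePi_expNeg_tsum [Countable ι] (p : Measure Ω) [IsProbabilityMeasure p]
    {F : ι → Ω → ℝ≥0∞} (hF : ∀ k, Measurable (F k)) {c : ι → ℝ≥0∞}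
    (hc : ∀ k, ∫⁻ x, expNeg (F k x) ∂p = expNeg (c k)) :
    ∫⁻ w, expNeg (∑' k, F k (w k)) ∂(Measure.infinitePi fun _ : ι => p) = expNeg (∑' k, c k) := by
  have h1 : Tendsto (fun I : Finset ι => ∫⁻ w, expNeg (∑ k ∈ I, F k (w k))
      ∂(Measure.infinitePi fun _ : ι => p)) atTop
      (𝓝 (∫⁻ w, expNeg (∑' k, F k (w k)) ∂(Measure.infinitePi fun _ : ι => p))) := by
    refine tendsto_lintegral_filter_of_dominated_convergence (fun _ => 1)
      (Eventually.of_forall fun I => measurable_expNeg.comp (Finset.measurable_fun_sum _ fun k _ =>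
        (hF k).comp (measurable_pi_apply k)))
      (Eventually.of_forall fun I => Eventually.of_forall fun w => expNeg_le_one _) (by simp)
      (Eventually.of_forall fun w => (continuous_expNeg.tendsto _).comp ENNReal.summable.hasSum)
  have h2 : Tendsto (fun I : Finset ι => expNeg (∑ k ∈ I, c k)) atTop (𝓝 (expNeg (∑' k, c k))) :=
    (continuous_expNeg.tendsto _).comp ENNReal.summable.hasSum
  refine tendsto_nhds_unique h1 (h2.congr fun I => ?_)
  rw [lintegral_infinitePi_expNeg_sum p hF, expNeg_sum]
  simp_rw [hc]

end InfiniteProduct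

section Codes

variable {d : ℕ} {ι : Type*} [Countable ι]

/-- The functionals of a family of sequences of point measures that are sums of integrals. -/
def codeFunctionals (d : ℕ) (ι : Type*) : Set ((ι → ℕ → PointMeasure d) → ℝ≥0∞) :=
  {F | ∃ f : ι → ℕ → Euc d → ℝ≥0∞, (∀ k n, Measurable (f k n)) ∧
    F = fun w => ∑' k, ∑' n, ∫⁻ x, f k n x ∂(w k n).toMeasure}

theorem measurable_codeFunctional {f : ι → ℕ → Euc d → ℝ≥0∞} (hf : ∀ k n, Measurable (f k n)) :
    Measurable fun w : ι → ℕ → PointMeasure d => ∑' k, ∑' n, ∫⁻ x, f k n x ∂(w k n).toMeasure :=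
  Measurable.tsum fun k => Measurable.tsum fun n =>
    (IsPoissonLaw.measurable_lintegral (hf k n)).comp
      ((measurable_pi_apply n).comp (measurable_pi_apply k))

theorem ext_of_laplace_code {M M' : Measure (ι → ℕ → PointMeasure d)} [IsFiniteMeasure M]
    [IsFiniteMeasure M'] (h : ∀ f : ι → ℕ → Euc d → ℝ≥0∞, (∀ k n, Measurable (f k n)) →
      ∫⁻ w, expNeg (∑' k, ∑' n, ∫⁻ x, f k n x ∂(w k n).toMeasure) ∂M =
        ∫⁻ w, expNeg (∑' k, ∑' n, ∫⁻ x, f k n x ∂(w k n).toMeasure) ∂M') : M = M' := by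
  classical
  refine Measure.ext_of_laplace (codeFunctionals d ι) ?_ ⟨0, fun _ _ => measurable_zero, by
    funext w; simp⟩ ?_ ?_ ?_
  · rintro _ ⟨f, hf, rfl⟩
    exact measurable_codeFunctional hf
  · rintro _ ⟨f, hf, rfl⟩ _ ⟨g, hg, rfl⟩
    refine ⟨fun k n => f k n + g k n, fun k n => (hf k n).add (hg k n), ?_⟩
    funext w
    simp only [Pi.add_apply]
    rw [← ENNReal.tsum_add]
    refine tsum_congr fun k => ?_
    rw [← ENNReal.tsum_add]
    refine tsum_congr fun n => ?_
    rw [lintegral_add_left (hf k n)]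
  · refine iSup_le fun k => ?_
    rw [MeasurableSpace.comap_le_iff_le_map]
    refine iSup_le fun n => ?_
    rw [MeasurableSpace.comap_le_iff_le_map]
    refine PointMeasure.le_iSup_comap_linearFunctionals.trans (iSup_le ?_)
    rintro ⟨_, f, hf, rfl⟩
    rw [← MeasurableSpace.comap_le_iff_le_map, ← MeasurableSpace.comap_le_iff_le_map,
      MeasurableSpace.comap_comp, MeasurableSpace.comap_comp]
    have hmem : (fun w : ι → ℕ → PointMeasure d => ∫⁻ x, f x ∂(w k n).toMeasure) ∈
        codeFunctionals d ι := by
      refine ⟨fun k' n' => if k' = k ∧ n' = n then f else 0, fun k' n' => ?_, ?_⟩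
      · dsimp only
        split_ifs
        · exact hf
        · exact measurable_zero
      · funext w
        rw [tsum_eq_single k, tsum_eq_single n]
        · simp
        · intro n' hn'
          simp [hn']
        · intro k' hk'
          simp [hk']
    exact le_iSup (fun F : codeFunctionals d ι => MeasurableSpace.comap
      (F : (ι → ℕ → PointMeasure d) → ℝ≥0∞) inferInstance) ⟨_, hmem⟩
  · rintro _ ⟨f, hf, rfl⟩
    exact h f hf

theorem IsPoissonLaw.lintegral_code {s : ℝ≥0} {Q : Measure (PointMeasure d)} (h : IsPoissonLaw s Q)
    [IsProbabilityMeasure Q] {f : ι → ℕ → Euc d → ℝ≥0∞} (hf : ∀ k n, Measurable (f k n)) :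
    ∫⁻ w, expNeg (∑' k, ∑' n, ∫⁻ x, f k n x ∂(w k n).toMeasure)
      ∂(Measure.infinitePi fun _ : ι => Measure.infinitePi fun _ : ℕ => Q) =
      expNeg (∑' k, ∑' n, s * ∫⁻ x, (1 - expNeg (f k n x))) := by
  refine lintegral_infinitePi_expNeg_tsum _
    (F := fun k (z : ℕ → PointMeasure d) => ∑' n, ∫⁻ x, f k n x ∂(z n).toMeasure)
    (fun k => Measurable.tsum fun n => (measurable_lintegral (hf k n)).comp (measurable_pi_apply n))
    fun k => ?_
  exact lintegral_infinitePi_expNeg_tsum Q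
    (F := fun n (μ : PointMeasure d) => ∫⁻ x, f k n x ∂μ.toMeasure)
    (fun n => measurable_lintegral (hf k n)) fun n => h.laplace (hf k n)

end Codes

/-! ### Invariance of the law of the codes under merging -/

section MergeLaw

variable {d : ℕ}

/-- The cell of the special centre in the grid cell `k`, in the coordinates of its frame. -/
def gridCell (S : Set (Euc d)) (k : Fin d → ℤ) : Set (Euc d) :=
  {x | grid (centerAt S k) = k ∧ x ∈ locCell S (centerAt S k)}

/-- Merge the parts of `A` in all cells into the corresponding sequences. -/
def mergeCode (S A : Set (Euc d)) (w : (Fin d → ℤ) → ℕ → PointMeasure d) (k : Fin d → ℤ) :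
    ℕ → PointMeasure d :=
  mergeSeq (gridCell S k) (toLocal S (centerAt S k) '' A) (w k)

theorem Special.gridCell_eq {S : Set (Euc d)} {m : Euc d} (hm : Special S m) :
    gridCell S (grid m) = locCell S m := by
  simp [gridCell, hm.centerAt_eq]

theorem Special.mergeCode_eq {S A : Set (Euc d)} {m : Euc d} (hm : Special S m)
    (w : (Fin d → ℤ) → ℕ → PointMeasure d) :
    mergeCode S A w (grid m) = mergeSeq (locCell S m) (toLocal S m '' A) (w (grid m)) := by
  rw [mergeCode, hm.gridCell_eq, hm.centerAt_eq]

theorem Special.measurePreserving_toLocal {S : Set (Euc d)} {m : Euc d} (h : Special S m) :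
    MeasurePreserving (toLocal S m) volume volume := by
  obtain ⟨L, -, h2⟩ := exists_linearIsometryEquiv_frame h.frame.2
  have : toLocal S m = L.symm ∘ fun y => y - m := funext h2
  rw [this]
  exact L.symm.measurePreserving.comp (measurePreserving_sub_right volume m)

theorem measurable_toLocal_const {S : Set (Euc d)} {m : Euc d} : Measurable (toLocal S m) := by
  unfold toLocal
  refine (WithLp.measurable_toLp 2 _).comp (measurable_pi_lambda _ fun i => ?_)
  exact measurable_const.inner (measurable_id.sub measurable_const)

theorem measurableSet_gridCell {S : Set (Euc d)} (hS : LocFin S) (k : Fin d → ℤ) :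
    MeasurableSet (gridCell S k) := by
  have h1 : S = (PointMeasure.ofSet S).pts := (PointMeasure.pts_ofSet hS).symm
  have h2 : MeasurableSet (locCell S (centerAt S k)) := by
    have := PointMeasure.measurableSet_locCell (Ω := Euc d) (Z := fun _ => PointMeasure.ofSet S)
      measurable_const (m := fun _ => centerAt S k) measurable_const measurable_id
    rw [← h1] at this
    exact this
  exact (MeasurableSet.const _).inter h2

theorem lintegral_mixSet {D A B : Set (Euc d)} (hA : A.Countable) (hB : B.Countable)
    (f : Euc d → ℝ≥0∞) :
    ∫⁻ x, f x ∂(PointMeasure.ofSet (mixSet D A B)).toMeasure =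
      ∑' x : A, D.indicator f x + ∑' x : B, Dᶜ.indicator f x := by
  have hc : (mixSet D A B).Countable :=
    (hA.mono Set.inter_subset_left).union (hB.mono Set.sdiff_subset)
  rw [PointMeasure.toMeasure_ofSet hc, lintegral_sumDirac, tsum_subtype _ f,
    tsum_subtype A (D.indicator f), tsum_subtype B (Dᶜ.indicator f), ← ENNReal.tsum_add]
  refine tsum_congr fun x => ?_
  by_cases h1 : x ∈ D <;> by_cases h2 : x ∈ A <;> by_cases h3 : x ∈ B <;>
    simp [mixSet, Set.indicator, h1, h2, h3]

theorem ENNReal.tsum_eq_zero_add (f : ℕ → ℝ≥0∞) : ∑' n, f n = f 0 + ∑' n, f (n + 1) :=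
  _root_.tsum_eq_zero_add' ENNReal.summable

/-- The shift is transferred to the test functions: inside `D` the term z n is tested by f (n + 1),
outside by f n, and the inserted set by f 0. -/
theorem tsum_lintegral_mergeSeq {D A : Set (Euc d)} (hD : MeasurableSet D) (hA : A.Countable)
    {z : ℕ → PointMeasure d} (hz : ∀ n, LocFin (z n).supp) {f : ℕ → Euc d → ℝ≥0∞}
    (hf : ∀ n, Measurable (f n)) :
    ∑' n, ∫⁻ x, f n x ∂(mergeSeq D A z n).toMeasure = ∑' x : A, D.indicator (f 0) x +
      ∑' n, ∫⁻ x, (Dᶜ.indicator (f n) x + D.indicator (f (n + 1)) x) ∂(z n).toMeasure := by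
  have h1 : ∀ n, ∫⁻ x, (Dᶜ.indicator (f n) x + D.indicator (f (n + 1)) x) ∂(z n).toMeasure =
      ∑' x : (z n).pts, Dᶜ.indicator (f n) x + ∑' x : (z n).pts, D.indicator (f (n + 1)) x := by
    intro n
    rw [lintegral_add_left ((hf n).indicator hD.compl),
      IsPoissonLaw.lintegral_toMeasure_of_locFin (hz n),
      IsPoissonLaw.lintegral_toMeasure_of_locFin (hz n)]
  simp_rw [h1]
  rw [ENNReal.tsum_add, ENNReal.tsum_eq_zero_add,
    ENNReal.tsum_eq_zero_add (f := fun n => ∑' x : (z n).pts, Dᶜ.indicator (f n) x)]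
  simp only [mergeSeq]
  rw [lintegral_mixSet hA (z 0).countable_pts]
  simp_rw [fun n => lintegral_mixSet (D := D) (z n).countable_pts (z (n + 1)).countable_pts]
  rw [ENNReal.tsum_add]
  ring

theorem tsum_image_toLocal {S A : Set (Euc d)} {k : Fin d → ℤ} (g : Euc d → ℝ≥0∞) :
    ∑' x : toLocal S (centerAt S k) '' A, (gridCell S k).indicator g x =
      ∑' y : A, (gridCell S k).indicator g (toLocal S (centerAt S k) y) := by
  by_cases hm : Special S (centerAt S k)
  · have hinj : Function.Injective (toLocal S (centerAt S k)) :=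
      Function.LeftInverse.injective hm.toWorld_toLocal
    exact tsum_image (f := (gridCell S k).indicator g) hinj.injOn
  · have : gridCell S k = ∅ := by
      ext x
      simp only [gridCell, locCell, Set.mem_ofPred_eq, Set.mem_empty_iff_false, iff_false]
      exact fun h => hm h.2.1
    simp [this]

theorem one_sub_expNeg_add_indicator {D : Set (Euc d)} (f g : Euc d → ℝ≥0∞) (x : Euc d) :
    1 - expNeg (Dᶜ.indicator f x + D.indicator g x) =
      Dᶜ.indicator (fun x => 1 - expNeg (f x)) x + D.indicator (fun x => 1 - expNeg (g x)) x := by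
  by_cases h : x ∈ D <;> simp [h]

/-- Cells are disjoint, so at most one term of the sum is nonzero, and x ↦ 1 - e⁻ˣ vanishes at 0. -/
theorem one_sub_expNeg_tsum_gridCell (S : Set (Euc d)) (f : (Fin d → ℤ) → Euc d → ℝ≥0∞)
    (y : Euc d) :
    1 - expNeg (∑' k, (gridCell S k).indicator (f k) (toLocal S (centerAt S k) y)) =
      ∑' k, (gridCell S k).indicator (fun x => 1 - expNeg (f k x)) (toLocal S (centerAt S k) y) := by
  by_cases h : ∃ k, toLocal S (centerAt S k) y ∈ gridCell S k
  · obtain ⟨k, hk⟩ := h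
    have huniq : ∀ l, l ≠ k → toLocal S (centerAt S l) y ∉ gridCell S l := by
      intro l hl hl'
      have h1 := hk.2.2
      have h2 := hl'.2.2
      rw [hk.2.1.toWorld_toLocal] at h1
      rw [hl'.2.1.toWorld_toLocal] at h2
      have h3 := cell_disjoint hl'.2.1 hk.2.1 h2 h1
      exact hl (by rw [← hl'.1, ← hk.1, h3])
    rw [tsum_eq_single k fun l hl => Set.indicator_of_notMem (huniq l hl) _,
      tsum_eq_single k fun l hl => Set.indicator_of_notMem (huniq l hl) _,
      Set.indicator_of_mem hk, Set.indicator_of_mem hk]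
  · push Not at h
    simp_rw [Set.indicator_of_notMem (h _)]
    simp

theorem lintegral_gridCell_toLocal {S : Set (Euc d)} (hS : LocFin S) (k : Fin d → ℤ)
    {g : Euc d → ℝ≥0∞} (hg : Measurable g) :
    ∫⁻ y, (gridCell S k).indicator g (toLocal S (centerAt S k) y) =
      ∫⁻ x, (gridCell S k).indicator g x := by
  by_cases hm : Special S (centerAt S k)
  · exact hm.measurePreserving_toLocal.lintegral_comp (hg.indicator (measurableSet_gridCell hS k))
  · have : gridCell S k = ∅ := by
      ext x
      simp only [gridCell, locCell, Set.mem_ofPred_eq, Set.mem_empty_iff_false, iff_false]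
      exact fun h => hm h.2.1
    simp [this]

theorem measurable_mergeCode {Ω : Type*} [MeasurableSpace Ω] {Z Z' : Ω → PointMeasure d}
    (hZ : Measurable Z) (hZ' : Measurable Z') {w : Ω → (Fin d → ℤ) → ℕ → PointMeasure d}
    (hw : Measurable w) : Measurable fun ω => mergeCode (Z ω).pts (Z' ω).pts (w ω) := by
  refine measurable_pi_lambda _ fun k => measurable_pi_lambda _ fun n => ?_
  have hc := PointMeasure.measurable_centerAt hZ k
  have hZ1 : Measurable fun q : Ω × Euc d => Z q.1 := hZ.comp measurable_fst
  have hc1 : Measurable fun q : Ω × Euc d => centerAt (Z q.1).pts k := hc.comp measurable_fst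
  have hD : MeasurableSet {q : Ω × Euc d | q.2 ∈ gridCell (Z q.1).pts k} :=
    ((measurable_grid.comp hc1) (measurableSet_singleton k)).inter
      (PointMeasure.measurableSet_locCell hZ1 hc1 measurable_snd)
  have hw' : ∀ n, Measurable fun ω => w ω k n := fun n =>
    (measurable_pi_apply n).comp ((measurable_pi_apply k).comp hw)
  cases n with
  | zero =>
    refine PointMeasure.measurable_mixSet_image hZ' (hw' 0) hD
      (f := fun ω => toLocal (Z ω).pts (centerAt (Z ω).pts k))
      (PointMeasure.measurable_toLocal hZ1 hc1 measurable_snd) ?_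
    rintro ω x ⟨_, hx⟩ y _ he
    rw [← hx.2.1.toWorld_toLocal x, he, hx.2.1.toWorld_toLocal]
  | succ n => exact PointMeasure.measurable_mixSet (hw' n) (hw' (n + 1)) hD

theorem IsPoissonLaw.ae_code_locFin {s : ℝ≥0} {Q : Measure (PointMeasure d)} (h : IsPoissonLaw s Q)
    [IsProbabilityMeasure Q] (ι : Type*) [Countable ι] :
    ∀ᵐ w ∂(Measure.infinitePi fun _ : ι => Measure.infinitePi fun _ : ℕ => Q),
      ∀ k n, LocFin (w k n).supp := by
  rw [ae_all_iff]
  intro k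
  refine (measurePreserving_eval_infinitePi (fun _ : ι => Measure.infinitePi fun _ : ℕ => Q)
    k).quasiMeasurePreserving.ae (p := fun z => ∀ n, LocFin (z n).supp) ?_
  rw [ae_all_iff]
  intro n
  exact (measurePreserving_eval_infinitePi (fun _ : ℕ => Q) n).quasiMeasurePreserving.ae h.ae_locFin

/-- Merging a Poisson process into independent sequences of Poisson processes does not change the
law of the sequences. -/
theorem IsPoissonLaw.map_mergeCode {s : ℝ≥0} {Q : Measure (PointMeasure d)} (h : IsPoissonLaw s Q)
    [IsProbabilityMeasure Q] {S : Set (Euc d)} (hS : LocFin S) :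
    ((Measure.infinitePi fun _ : Fin d → ℤ => Measure.infinitePi fun _ : ℕ => Q).prod Q).map
      (fun q => mergeCode S q.2.pts q.1) =
      Measure.infinitePi fun _ : Fin d → ℤ => Measure.infinitePi fun _ : ℕ => Q := by
  set W := Measure.infinitePi fun _ : Fin d → ℤ => Measure.infinitePi fun _ : ℕ => Q with hW
  have hmeas : Measurable fun q : ((Fin d → ℤ) → ℕ → PointMeasure d) × PointMeasure d =>
      mergeCode S q.2.pts q.1 := by
    have := measurable_mergeCode (Ω := ((Fin d → ℤ) → ℕ → PointMeasure d) × PointMeasure d)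
      (Z := fun _ => PointMeasure.ofSet S) measurable_const measurable_snd measurable_fst
    rw [PointMeasure.pts_ofSet hS] at this
    exact this
  have := Measure.isProbabilityMeasure_map (μ := W.prod Q) hmeas.aemeasurable
  refine ext_of_laplace_code fun f hf => ?_
  have hD := fun k => measurableSet_gridCell hS k
  have hexp : Measurable fun w : (Fin d → ℤ) → ℕ → PointMeasure d =>
      expNeg (∑' k, ∑' n, ∫⁻ x, f k n x ∂(w k n).toMeasure) :=
    measurable_expNeg.comp (measurable_codeFunctional hf)
  let g : (Fin d → ℤ) → ℕ → Euc d → ℝ≥0∞ := fun k n x =>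
    (gridCell S k)ᶜ.indicator (f k n) x + (gridCell S k).indicator (f k (n + 1)) x
  have hg : ∀ k n, Measurable (g k n) := fun k n =>
    ((hf k n).indicator (hD k).compl).add ((hf k (n + 1)).indicator (hD k))
  let G : Euc d → ℝ≥0∞ := fun y =>
    ∑' k, (gridCell S k).indicator (f k 0) (toLocal S (centerAt S k) y)
  have hG1 : ∀ k, ∀ F : Euc d → ℝ≥0∞, Measurable F → Measurable fun y =>
      (gridCell S k).indicator F (toLocal S (centerAt S k) y) := fun k F hF =>
    (hF.indicator (hD k)).comp measurable_toLocal_const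
  have hG : Measurable G := Measurable.tsum fun k => hG1 k _ (hf k 0)
  have hsub : ∀ k n, Measurable fun x => 1 - expNeg (f k n x) := fun k n =>
    continuous_one_sub_expNeg.measurable.comp (hf k n)
  -- The merged functional separates into one of the codes, with shifted test functions `g`, and one
  -- of the inserted process, with test function `G`. By independence the integral factors.
  have hsplit : ∀ᵐ q ∂(W.prod Q), expNeg (∑' k, ∑' n,
      ∫⁻ x, f k n x ∂(mergeCode S q.2.pts q.1 k n).toMeasure) =
      expNeg (∑' k, ∑' n, ∫⁻ x, g k n x ∂(q.1 k n).toMeasure) *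
        expNeg (∫⁻ x, G x ∂q.2.toMeasure) := by
    have h1 := (Measure.quasiMeasurePreserving_fst (μ := W) (ν := Q)).ae (h.ae_code_locFin (Fin d → ℤ))
    have h2 := (Measure.quasiMeasurePreserving_snd (μ := W) (ν := Q)).ae h.ae_locFin
    filter_upwards [h1, h2] with q hq1 hq2
    rw [← expNeg_add]
    congr 1
    have h3 : ∫⁻ x, G x ∂q.2.toMeasure = ∑' k, ∑' y : q.2.pts,
        (gridCell S k).indicator (f k 0) (toLocal S (centerAt S k) y) := by
      rw [IsPoissonLaw.lintegral_toMeasure_of_locFin hq2]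
      exact ENNReal.tsum_comm
    rw [h3, ← ENNReal.tsum_add]
    refine tsum_congr fun k => ?_
    rw [← tsum_image_toLocal, add_comm]
    exact tsum_lintegral_mergeSeq (hD k) (q.2.countable_pts.image _) (hq1 k) (hf k)
  rw [lintegral_map hexp hmeas, lintegral_congr_ae hsplit,
    lintegral_prod_mul (f := fun w : (Fin d → ℤ) → ℕ → PointMeasure d =>
      expNeg (∑' k, ∑' n, ∫⁻ x, g k n x ∂(w k n).toMeasure))
      (g := fun μ : PointMeasure d => expNeg (∫⁻ x, G x ∂μ.toMeasure))
      (measurable_expNeg.comp (measurable_codeFunctional hg)).aemeasurable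
      (measurable_expNeg.comp (measurable_lintegral hG)).aemeasurable,
    h.lintegral_code hg, h.lintegral_code hf, h.laplace hG, ← expNeg_add]
  congr 1
  simp_rw [ENNReal.tsum_mul_left]
  rw [← mul_add]
  congr 1
  have h4 : ∫⁻ x, (1 - expNeg (G x)) = ∑' k, ∫⁻ x, (gridCell S k).indicator
      (fun x => 1 - expNeg (f k 0 x)) x := by
    simp only [G]
    simp_rw [one_sub_expNeg_tsum_gridCell S (fun k => f k 0)]
    rw [lintegral_tsum fun k => (hG1 k _ (hsub k 0)).aemeasurable]
    exact tsum_congr fun k => lintegral_gridCell_toLocal hS k (hsub k 0)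
  rw [h4, ← ENNReal.tsum_add]
  refine tsum_congr fun k => ?_
  have h5 : ∀ n, ∫⁻ x, (1 - expNeg (g k n x)) =
      (∫⁻ x, (gridCell S k)ᶜ.indicator (fun x => 1 - expNeg (f k n x)) x) +
        ∫⁻ x, (gridCell S k).indicator (fun x => 1 - expNeg (f k (n + 1) x)) x := by
    intro n
    simp only [g]
    simp_rw [one_sub_expNeg_add_indicator]
    exact lintegral_add_left ((hsub k n).indicator (hD k).compl) _
  have h6 : ∀ n, ∫⁻ x, (1 - expNeg (f k n x)) =
      (∫⁻ x, (gridCell S k)ᶜ.indicator (fun x => 1 - expNeg (f k n x)) x) +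
        ∫⁻ x, (gridCell S k).indicator (fun x => 1 - expNeg (f k n x)) x := by
    intro n
    rw [lintegral_indicator (hD k).compl, lintegral_indicator (hD k), add_comm,
      lintegral_add_compl _ (hD k)]
  simp_rw [h5]
  conv_rhs => simp only [h6]
  rw [ENNReal.tsum_add, ENNReal.tsum_add, add_assoc]
  congr 1
  -- Inside the cell the codes are tested by f k 1, f k 2, …; the inserted process supplies the
  -- missing term f k 0.
  rw [ENNReal.tsum_eq_zero_add (f := fun n => ∫⁻ x, (gridCell S k).indicator
    (fun x => 1 - expNeg (f k n x)) x), add_comm]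

end MergeLaw

/-! ### The maps in terms of the codes -/

/-- `β` encodes sequences of independent point measures with law `Q` as radii, and `α` decodes. -/
structure IsRadiusCode {d : ℕ} (Q : Measure (PointMeasure d)) [IsProbabilityMeasure Q]
    (α : ℝ → ℕ → PointMeasure d) (β : (ℕ → PointMeasure d) → ℝ) : Prop where
  measurable_decode : Measurable α
  measurable_encode : Measurable β
  encode_mem : ∀ z, β z ∈ Set.Ioo (0 : ℝ) (1 / 2)
  map_encode : (Measure.infinitePi fun _ : ℕ => Q).map β = radiusLaw d
  decode_encode : ∀ᵐ z ∂(Measure.infinitePi fun _ : ℕ => Q), α (β z) = z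

section Deterministic

variable {d : ℕ} {S : Set (Euc d)} {ρ : Euc d → ℝ} {m : Euc d}

theorem GoodRadii.toLocal_eq (hρ : GoodRadii S ρ) (hm : Special S m) :
    toLocal (setRadius S ρ) m = toLocal S m :=
  toLocal_congr (hρ.frameVec_eq hm)

theorem GoodRadii.cell_eq (hρ : GoodRadii S ρ) : cell (setRadius S ρ) m = cell S m :=
  cell_congr fun _ => hρ.special_iff

theorem GoodRadii.locCell_eq (hρ : GoodRadii S ρ) (hm : Special S m) :
    locCell (setRadius S ρ) m = locCell S m := by
  simp only [locCell, hρ.special_iff, hρ.cell_eq, toWorld_congr (hρ.frameVec_eq hm)]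

variable {α : ℝ → ℕ → PointMeasure d} {β : (ℕ → PointMeasure d) → ℝ}
  {w : (Fin d → ℤ) → ℕ → PointMeasure d}

/-- Choose the radii according to a family of sequences of point measures. -/
def encodeSet (β : (ℕ → PointMeasure d) → ℝ) (S : Set (Euc d))
    (w : (Fin d → ℤ) → ℕ → PointMeasure d) : Set (Euc d) :=
  setRadius S fun m => β (w (grid m))

theorem goodRadii_encode (hβ : ∀ z, β z ∈ Set.Ioo (0 : ℝ) (1 / 2)) (S : Set (Euc d)) :
    GoodRadii S fun m => β (w (grid m)) := fun _ _ => hβ _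

theorem LocFin.encodeSet (hβ : ∀ z, β z ∈ Set.Ioo (0 : ℝ) (1 / 2)) (hS : LocFin S) :
    LocFin (encodeSet β S w) :=
  hS.setRadius (goodRadii_encode hβ S)

/-- Cells, frames and centres are unaffected by encoding, so the code can be read off, merged and
written back: under `encodeSet`, merging configurations corresponds to `mergeCode`. -/
theorem setRadius_encodeSet_mergeRadius (hβ : ∀ z, β z ∈ Set.Ioo (0 : ℝ) (1 / 2))
    (hw : ∀ k, α (β (w k)) = w k) (A : Set (Euc d)) :
    setRadius (encodeSet β S w) (mergeRadius α β (encodeSet β S w) A) =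
      encodeSet β S (mergeCode S A w) := by
  have hg := goodRadii_encode (w := w) hβ S
  rw [encodeSet, hg.setRadius_setRadius]
  refine setRadius_congr fun m hm => ?_
  rw [mergeRadius, hg.locCell_eq hm, hg.toLocal_eq hm, hg.radius_setRadius hm, hw, hm.mergeCode_eq]

theorem setRadius_encodeSet_splitRadius (hβ : ∀ z, β z ∈ Set.Ioo (0 : ℝ) (1 / 2))
    {A : Set (Euc d)} (hA : LocFin A) (hl : ∀ k n, LocFin (w k n).supp)
    (hw : ∀ k, α (β (mergeCode S A w k)) = mergeCode S A w k) :
    setRadius (encodeSet β S (mergeCode S A w))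
      (splitRadius α β (encodeSet β S (mergeCode S A w))) = encodeSet β S w := by
  have hg := goodRadii_encode (w := mergeCode S A w) hβ S
  rw [encodeSet, hg.setRadius_setRadius]
  refine setRadius_congr fun m hm => ?_
  rw [splitRadius, hg.locCell_eq hm, hg.radius_setRadius hm, hw, hm.mergeCode_eq,
    splitSeq_mergeSeq (hA.image_toLocal hm) (hl _)]

/-- After merging, the term of index 0 restricted to the cell is exactly the part of `A` there; the
hypothesis `hcell` ensures that no point of `A` falls between the cells. -/
theorem extractSet_encodeSet (hβ : ∀ z, β z ∈ Set.Ioo (0 : ℝ) (1 / 2))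
    {A : Set (Euc d)} (hA : LocFin A) (hw : ∀ k, α (β (mergeCode S A w k)) = mergeCode S A w k)
    (hcell : ∀ y ∈ A, ∃ m, Special S m ∧ y ∈ cell S m) :
    extractSet α (encodeSet β S (mergeCode S A w)) = A := by
  have hg := goodRadii_encode (w := mergeCode S A w) hβ S
  have key : ∀ m, Special S m → ∀ y ∈ cell S m,
      (toLocal S m y ∈ (mergeCode S A w (grid m) 0).pts ↔ y ∈ A) := by
    intro m hm y hy
    have hD : toLocal S m y ∈ locCell S m := ⟨hm, by rwa [hm.toWorld_toLocal]⟩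
    rw [hm.mergeCode_eq, mergeSeq,
      PointMeasure.pts_ofSet ((hA.image_toLocal hm).mixSet (PointMeasure.locFin_pts _))]
    constructor
    · rintro (⟨⟨y', hy', he⟩, _⟩ | h)
      · rw [← hm.toWorld_toLocal y, ← he, hm.toWorld_toLocal]
        exact hy'
      · exact absurd hD h.2
    · exact fun h => Or.inl ⟨⟨y, h, rfl⟩, hD⟩
  ext y
  rw [encodeSet]
  constructor
  · rintro ⟨m, hm, hc, hy⟩
    rw [hg.special_iff] at hm
    rw [hg.cell_eq] at hc
    rw [hg.toLocal_eq hm, hg.radius_setRadius hm, hw] at hy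
    exact (key m hm y hc).1 hy
  · intro hy
    obtain ⟨m, hm, hc⟩ := hcell y hy
    refine ⟨m, hg.special_iff.2 hm, by rwa [hg.cell_eq], ?_⟩
    rw [hg.toLocal_eq hm, hg.radius_setRadius hm, hw]
    exact (key m hm y hc).2 hy

end Deterministic

/-! ### Laws of the maps and almost sure inversion -/

section Law

variable {d : ℕ}

/-- Equality is combined with local finiteness because there it becomes a comparison of the sets
`pts`, whose quantifiers are measurable. -/
theorem PointMeasure.measurableSet_locFin_eq {Ω : Type*} [MeasurableSpace Ω]
    {Z Z' : Ω → PointMeasure d} (hZ : Measurable Z) (hZ' : Measurable Z') :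
    MeasurableSet {ω | LocFin (Z ω).supp ∧ LocFin (Z' ω).supp ∧ Z ω = Z' ω} := by
  have h1 : {ω | LocFin (Z ω).supp ∧ LocFin (Z' ω).supp ∧ Z ω = Z' ω} =
      (Z ⁻¹' {μ | LocFin μ.supp} ∩ Z' ⁻¹' {μ | LocFin μ.supp}) ∩
        ({ω | ∀ x ∈ (Z ω).pts, x ∈ (Z' ω).pts} ∩ {ω | ∀ x ∈ (Z' ω).pts, x ∈ (Z ω).pts}) := by
    ext ω
    constructor
    · rintro ⟨ha, hb, he⟩
      exact ⟨⟨ha, hb⟩, fun x hx => he ▸ hx, fun x hx => he ▸ hx⟩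
    · rintro ⟨⟨ha, hb⟩, hc, hd⟩
      refine ⟨ha, hb, PointMeasure.ext_supp ?_⟩
      rw [← PointMeasure.pts_eq_supp ha, ← PointMeasure.pts_eq_supp hb]
      exact Set.Subset.antisymm hc hd
  rw [h1]
  have hZ1 : Measurable fun q : Ω × Euc d => Z q.1 := hZ.comp measurable_fst
  have hZ1' : Measurable fun q : Ω × Euc d => Z' q.1 := hZ'.comp measurable_fst
  exact ((hZ measurableSet_locFin).inter (hZ' measurableSet_locFin)).inter
    ((measurableSet_forall_pts hZ (p := fun ω x => x ∈ (Z' ω).pts)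
      (measurableSet_mem_pts hZ1' measurable_snd)).inter
    (measurableSet_forall_pts hZ' (p := fun ω x => x ∈ (Z ω).pts)
      (measurableSet_mem_pts hZ1 measurable_snd)))

theorem IsPoissonLaw.ae_forall_supp {r : ℝ≥0} {P : Measure (PointMeasure d)} (h : IsPoissonLaw r P)
    {p : Euc d → Prop} (hp : ∀ᵐ x, p x) : ∀ᵐ μ ∂P, ∀ x ∈ μ.supp, p x := by
  obtain ⟨N, hN, hNm, h0⟩ := exists_measurable_superset_of_null (ae_iff.1 hp)
  have h1 := h.map_count N hNm (by simp [h0])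
  have h2 : ∀ᵐ y ∂(P.map (PointMeasure.count N)), y = 0 := by
    rw [h1, ae_map_iff (p := fun y : ℝ≥0∞ => y = 0) (measurable_of_countable _).aemeasurable
      (measurableSet_singleton 0), h0]
    rw [ae_iff, poissonMeasure]
    simp only [Nat.cast_eq_zero, ENNReal.toNNReal_zero, mul_zero]
    rw [Measure.sum_apply _ (by measurability), ENNReal.tsum_eq_zero]
    intro n
    rcases n with _ | n <;> simp
  have h3 := ae_of_ae_map (PointMeasure.measurable_count hNm).aemeasurable h2
  filter_upwards [h3] with μ hμ x hx
  by_contra hpx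
  have hxN : x ∈ N := hN hpx
  rw [PointMeasure.count, μ.toMeasure_eq, sumDirac_apply hNm] at hμ
  have : (μ.supp ∩ N) = ∅ := by simpa using hμ
  exact (Set.eq_empty_iff_forall_notMem.1 this x) ⟨hx, hxN⟩

variable {r s : ℝ≥0} {P Q : Measure (PointMeasure d)} [IsProbabilityMeasure Q]
  {α : ℝ → ℕ → PointMeasure d} {β : (ℕ → PointMeasure d) → ℝ}

/-- The law of independent sequences of independent point measures. -/
def codeLaw (Q : Measure (PointMeasure d)) [IsProbabilityMeasure Q] :
    Measure ((Fin d → ℤ) → ℕ → PointMeasure d) :=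
  Measure.infinitePi fun _ : Fin d → ℤ => Measure.infinitePi fun _ : ℕ => Q

instance : IsProbabilityMeasure (codeLaw Q) := by
  unfold codeLaw; infer_instance

namespace IsRadiusCode

theorem ae_decode_encode (hc : IsRadiusCode Q α β) :
    ∀ᵐ w ∂codeLaw Q, ∀ k, α (β (w k)) = w k := by
  rw [ae_all_iff]
  intro k
  exact (measurePreserving_eval_infinitePi (fun _ : Fin d → ℤ => Measure.infinitePi fun _ : ℕ => Q)
    k).quasiMeasurePreserving.ae (p := fun z => α (β z) = z) hc.decode_encode

/-- Encoding turns independent codes into independent radii of law `radiusLaw d`, and resampling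
with these preserves P. A Poisson process can thus be assumed to carry explicit independent codes,
which avoids conditional laws. -/
theorem measurePreserving_encode (hc : IsRadiusCode Q α β) (h : IsPoissonLaw r P) (hd : 1 ≤ d) :
    MeasurePreserving (fun q : PointMeasure d × ((Fin d → ℤ) → ℕ → PointMeasure d) =>
      PointMeasure.ofSet (encodeSet β q.1.pts q.2)) (P.prod (codeLaw Q)) P := by
  have := h.isProbabilityMeasure
  have hm : Measurable fun w : (Fin d → ℤ) → ℕ → PointMeasure d => fun k => β (w k) :=
    measurable_pi_lambda _ fun k => hc.measurable_encode.comp (measurable_pi_apply k)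
  have h1 : MeasurePreserving (fun w : (Fin d → ℤ) → ℕ → PointMeasure d => fun k => β (w k))
      (codeLaw Q) (Measure.infinitePi fun _ : Fin d → ℤ => radiusLaw d) := by
    refine ⟨hm, ?_⟩
    rw [codeLaw, Measure.infinitePi_map_pi _ fun _ => hc.measurable_encode]
    simp_rw [hc.map_encode]
  have h2 := (MeasurePreserving.id P).prod h1
  have h3 : MeasurePreserving (fun q : PointMeasure d × ((Fin d → ℤ) → ℝ) =>
      PointMeasure.resample Set.univ (fun m => clipRadius (q.2 (grid m))) q.1)
      (P.prod (Measure.infinitePi fun _ : Fin d → ℤ => radiusLaw d)) P :=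
    ⟨PointMeasure.measurable_resample_grid Set.univ measurable_fst measurable_snd,
      h.map_resample_univ hd⟩
  convert h3.comp h2 using 1
  funext q
  simp only [Function.comp_apply, Prod.map, id]
  rw [PointMeasure.resample, encodeSet]
  congr 1
  refine setRadius_congr fun m _ => ?_
  rw [radiiOn, if_pos (Set.mem_univ m), clipRadius_of_mem (hc.encode_mem _)]

theorem measurePreserving_mergeCode (h : IsPoissonLaw r P) (h' : IsPoissonLaw s Q) :
    MeasurePreserving
      (fun q : PointMeasure d × (((Fin d → ℤ) → ℕ → PointMeasure d) × PointMeasure d) =>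
        (q.1, mergeCode q.1.pts q.2.2.pts q.2.1)) (P.prod ((codeLaw Q).prod Q))
      (P.prod (codeLaw Q)) := by
  have := h.isProbabilityMeasure
  refine MeasurePreserving.skew_product (MeasurePreserving.id P)
    (g := fun μ (q : ((Fin d → ℤ) → ℕ → PointMeasure d) × PointMeasure d) =>
      mergeCode μ.pts q.2.pts q.1)
    (measurable_mergeCode (Z := fun q : PointMeasure d × (((Fin d → ℤ) → ℕ → PointMeasure d) ×
      PointMeasure d) => q.1) measurable_fst measurable_snd.snd measurable_snd.fst) ?_
  exact Filter.Eventually.of_forall fun μ => h'.map_mergeCode μ.locFin_pts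

end IsRadiusCode

end Law

namespace IsRadiusCode

variable {d : ℕ} {r s : ℝ≥0} {P Q : Measure (PointMeasure d)} [IsProbabilityMeasure Q]
  {α : ℝ → ℕ → PointMeasure d} {β : (ℕ → PointMeasure d) → ℝ}

theorem measurePreserving_encode_pair (hc : IsRadiusCode Q α β) (h : IsPoissonLaw r P)
    (hd : 1 ≤ d) :
    MeasurePreserving
      (fun q : PointMeasure d × (((Fin d → ℤ) → ℕ → PointMeasure d) × PointMeasure d) =>
        (PointMeasure.ofSet (encodeSet β q.1.pts q.2.1), q.2.2)) (P.prod ((codeLaw Q).prod Q))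
      (P.prod Q) := by
  have := h.isProbabilityMeasure
  have h1 := (hc.measurePreserving_encode h hd).prod (MeasurePreserving.id Q)
  have h2 : MeasurePreserving (MeasurableEquiv.prodAssoc.symm :
      PointMeasure d × (((Fin d → ℤ) → ℕ → PointMeasure d) × PointMeasure d) ≃ᵐ _)
      (P.prod ((codeLaw Q).prod Q)) ((P.prod (codeLaw Q)).prod Q) :=
    (measurePreserving_prodAssoc P (codeLaw Q) Q).symm _
  exact h1.comp h2

theorem mergeMap_encode (hc : IsRadiusCode Q α β) {μ ν : PointMeasure d}
    {w : (Fin d → ℤ) → ℕ → PointMeasure d} (hw : ∀ k, α (β (w k)) = w k) :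
    mergeMap α β (PointMeasure.ofSet (encodeSet β μ.pts w), ν) =
      PointMeasure.ofSet (encodeSet β μ.pts (mergeCode μ.pts ν.pts w)) := by
  rw [mergeMap, PointMeasure.pts_ofSet (μ.locFin_pts.encodeSet hc.encode_mem),
    setRadius_encodeSet_mergeRadius hc.encode_mem hw]

theorem ae_triple_decode (hc : IsRadiusCode Q α β) [IsProbabilityMeasure P] :
    ∀ᵐ q ∂(P.prod ((codeLaw Q).prod Q)), ∀ k, α (β (q.2.1 k)) = q.2.1 k :=
  (Measure.quasiMeasurePreserving_snd (μ := P) (ν := (codeLaw Q).prod Q)).ae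
    (p := fun q => ∀ k, α (β (q.1 k)) = q.1 k)
    ((Measure.quasiMeasurePreserving_fst (μ := codeLaw Q) (ν := Q)).ae hc.ae_decode_encode)

/-- A commutative square: almost surely, encoding and then applying `mergeMap` is the same as
applying `mergeCode` and then encoding. The encoding maps and `mergeCode` preserve the measures, so
`mergeMap` does as well. -/
theorem measurePreserving_mergeMap (hc : IsRadiusCode Q α β) (h : IsPoissonLaw r P)
    (h' : IsPoissonLaw s Q) (hd : 1 ≤ d) :
    MeasurePreserving (mergeMap α β) (P.prod Q) P := by
  have := h.isProbabilityMeasure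
  have hm := PointMeasure.measurable_mergeMap hc.measurable_decode hc.measurable_encode
    hc.encode_mem
  refine ⟨hm, ?_⟩
  have hE := hc.measurePreserving_encode_pair h hd
  have hF := (hc.measurePreserving_encode h hd).comp (measurePreserving_mergeCode h h')
  rw [← hE.map_eq, Measure.map_map hm hE.measurable]
  conv_rhs => rw [← hF.map_eq]
  refine Measure.map_congr ?_
  filter_upwards [hc.ae_triple_decode] with q hq
  exact hc.mergeMap_encode hq

theorem measurableSet_splitMap_mergeMap (hc : IsRadiusCode Q α β) :
    MeasurableSet {p : PointMeasure d × PointMeasure d |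
      (LocFin (splitMap α β (mergeMap α β p)).1.supp ∧ LocFin p.1.supp ∧
        (splitMap α β (mergeMap α β p)).1 = p.1) ∧
      (LocFin (splitMap α β (mergeMap α β p)).2.supp ∧ LocFin p.2.supp ∧
        (splitMap α β (mergeMap α β p)).2 = p.2)} := by
  have hm := PointMeasure.measurable_mergeMap hc.measurable_decode hc.measurable_encode
    hc.encode_mem
  have hs := PointMeasure.measurable_splitMap hc.measurable_decode hc.measurable_encode
    hc.encode_mem
  have h1 : Measurable fun p => splitMap α β (mergeMap α β p) := hs.comp hm
  exact (PointMeasure.measurableSet_locFin_eq h1.fst measurable_fst).inter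
    (PointMeasure.measurableSet_locFin_eq h1.snd measurable_snd)

/-- Given the first process, the complement of the cells is a fixed null set, which the independent
second process misses almost surely. -/
theorem ae_pts_mem_cell (h : IsPoissonLaw r P) (h' : IsPoissonLaw s Q)
    (hne : ∀ᵐ μ ∂P, ∃ m, Special μ.pts m) :
    ∀ᵐ p ∂(P.prod Q), ∀ y ∈ p.2.pts, ∃ m, Special p.1.pts m ∧ y ∈ cell p.1.pts m := by
  have := h.isProbabilityMeasure
  have hms : MeasurableSet {p : PointMeasure d × PointMeasure d |
      ∀ y ∈ p.2.pts, ∃ m, Special p.1.pts m ∧ y ∈ cell p.1.pts m} := by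
    refine PointMeasure.measurableSet_forall_pts (Z := fun p : PointMeasure d × PointMeasure d =>
      p.2) measurable_snd (p := fun p y => ∃ m, Special p.1.pts m ∧ y ∈ cell p.1.pts m) ?_
    have h1 : {q : (PointMeasure d × PointMeasure d) × Euc d |
        ∃ m, Special q.1.1.pts m ∧ q.2 ∈ cell q.1.1.pts m} =
        ⋃ k, {q | Special q.1.1.pts (centerAt q.1.1.pts k) ∧
          q.2 ∈ cell q.1.1.pts (centerAt q.1.1.pts k)} := by
      ext q
      rw [Set.mem_iUnion]
      constructor
      · rintro ⟨m, hm, hy⟩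
        exact ⟨grid m, by rw [Set.mem_ofPred_eq, hm.centerAt_eq]; exact ⟨hm, hy⟩⟩
      · rintro ⟨k, hk⟩
        exact ⟨_, hk⟩
    rw [h1]
    have hZ : Measurable fun q : (PointMeasure d × PointMeasure d) × Euc d => q.1.1 :=
      measurable_fst.fst
    refine MeasurableSet.iUnion fun k => ?_
    have hk := PointMeasure.measurable_centerAt hZ k
    exact (PointMeasure.measurableSet_special hZ hk).inter
      (PointMeasure.measurableSet_cell hZ hk measurable_snd)
  rw [Measure.ae_prod_iff_ae_ae hms]
  filter_upwards [hne] with μ hμ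
  filter_upwards [h'.ae_forall_supp (μ.locFin_pts.ae_mem_cell hμ)] with ν hν y hy
  exact hν y (ν.pts_subset_supp hy)

theorem ae_splitMap_mergeMap_locFin (hc : IsRadiusCode Q α β) (h : IsPoissonLaw r P)
    (h' : IsPoissonLaw s Q) (hd : 1 ≤ d) (hne : ∀ᵐ μ ∂P, ∃ m, Special μ.pts m) :
    ∀ᵐ p ∂(P.prod Q), (LocFin (splitMap α β (mergeMap α β p)).1.supp ∧ LocFin p.1.supp ∧
        (splitMap α β (mergeMap α β p)).1 = p.1) ∧
      (LocFin (splitMap α β (mergeMap α β p)).2.supp ∧ LocFin p.2.supp ∧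
        (splitMap α β (mergeMap α β p)).2 = p.2) := by
  have := h.isProbabilityMeasure
  have hE := hc.measurePreserving_encode_pair h hd
  rw [← hE.map_eq, ae_map_iff hE.measurable.aemeasurable hc.measurableSet_splitMap_mergeMap]
  -- Merged codes have the law of codes, so decoding inverts encoding for them as well.
  have hF := (measurePreserving_mergeCode h h').quasiMeasurePreserving.ae
    (p := fun q => ∀ k, α (β (q.2 k)) = q.2 k)
    ((Measure.quasiMeasurePreserving_snd (μ := P) (ν := codeLaw Q)).ae hc.ae_decode_encode)
  have hlw : ∀ᵐ q ∂(P.prod ((codeLaw Q).prod Q)), ∀ k n, LocFin (q.2.1 k n).supp :=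
    (Measure.quasiMeasurePreserving_snd (μ := P) (ν := (codeLaw Q).prod Q)).ae
      (p := fun q => ∀ k n, LocFin (q.1 k n).supp)
      ((Measure.quasiMeasurePreserving_fst (μ := codeLaw Q) (ν := Q)).ae
        (h'.ae_code_locFin (Fin d → ℤ)))
  have hlY : ∀ᵐ q ∂(P.prod ((codeLaw Q).prod Q)), LocFin q.2.2.supp :=
    (Measure.quasiMeasurePreserving_snd (μ := P) (ν := (codeLaw Q).prod Q)).ae
      (p := fun q => LocFin q.2.supp)
      ((Measure.quasiMeasurePreserving_snd (μ := codeLaw Q) (ν := Q)).ae h'.ae_locFin)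
  have hcell := hE.quasiMeasurePreserving.ae (ae_pts_mem_cell h h' hne)
  filter_upwards [hc.ae_triple_decode, hF, hlw, hlY, hcell] with q h1 h2 h3 h4 h5
  have hβ := hc.encode_mem
  have hl : ∀ w, LocFin (encodeSet β q.1.pts w) := fun w => q.1.locFin_pts.encodeSet hβ
  have hcell' : ∀ y ∈ q.2.2.pts, ∃ m, Special q.1.pts m ∧ y ∈ cell q.1.pts m := by
    intro y hy
    obtain ⟨m, hm, hym⟩ := h5 y hy
    have hg := goodRadii_encode (w := q.2.1) hβ q.1.pts
    rw [PointMeasure.pts_ofSet (hl _), encodeSet] at hm hym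
    rw [hg.special_iff] at hm
    rw [hg.cell_eq] at hym
    exact ⟨m, hm, hym⟩
  have e1 : (splitMap α β (mergeMap α β (PointMeasure.ofSet (encodeSet β q.1.pts q.2.1), q.2.2))).1 =
      PointMeasure.ofSet (encodeSet β q.1.pts q.2.1) := by
    rw [hc.mergeMap_encode h1, splitMap, PointMeasure.pts_ofSet (hl _)]
    dsimp only
    rw [setRadius_encodeSet_splitRadius hβ (PointMeasure.locFin_pts _) h3 h2]
  have e2 : (splitMap α β (mergeMap α β (PointMeasure.ofSet (encodeSet β q.1.pts q.2.1), q.2.2))).2 =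
      q.2.2 := by
    rw [hc.mergeMap_encode h1, splitMap, PointMeasure.pts_ofSet (hl _)]
    dsimp only
    rw [extractSet_encodeSet hβ (PointMeasure.locFin_pts _) h2 hcell', PointMeasure.pts_eq_supp h4,
      PointMeasure.ofSet_supp]
  have hl1 : LocFin (PointMeasure.ofSet (encodeSet β q.1.pts q.2.1)).supp := by
    rw [PointMeasure.supp_ofSet (hl _).countable]
    exact hl _
  exact ⟨⟨by rw [e1]; exact hl1, hl1, e1⟩, by rw [e2]; exact h4, h4, e2⟩

theorem ae_splitMap_mergeMap (hc : IsRadiusCode Q α β) (h : IsPoissonLaw r P)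
    (h' : IsPoissonLaw s Q) (hd : 1 ≤ d) (hne : ∀ᵐ μ ∂P, ∃ m, Special μ.pts m) :
    ∀ᵐ p ∂(P.prod Q), splitMap α β (mergeMap α β p) = p := by
  filter_upwards [hc.ae_splitMap_mergeMap_locFin h h' hd hne] with p hp
  exact Prod.ext hp.1.2.2 hp.2.2.2

/-- P is the image of P × Q under `mergeMap`, and `splitMap` brings it back; no separate computation
is needed. -/
theorem measurePreserving_splitMap (hc : IsRadiusCode Q α β) (h : IsPoissonLaw r P)
    (h' : IsPoissonLaw s Q) (hd : 1 ≤ d) (hne : ∀ᵐ μ ∂P, ∃ m, Special μ.pts m) :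
    MeasurePreserving (splitMap α β) P (P.prod Q) := by
  have hs := PointMeasure.measurable_splitMap hc.measurable_decode hc.measurable_encode
    hc.encode_mem
  have hm := hc.measurePreserving_mergeMap h h' hd
  refine ⟨hs, ?_⟩
  conv_lhs => rw [← hm.map_eq]
  rw [Measure.map_map hs hm.measurable]
  have h1 : splitMap α β ∘ mergeMap α β =ᵐ[P.prod Q] id := hc.ae_splitMap_mergeMap h h' hd hne
  rw [Measure.map_congr h1, Measure.map_id]

/-- Since P is the law of `mergeMap α β p`, it suffices to check configurations of this form, where
the identity follows from the left inverse. -/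
theorem ae_mergeMap_splitMap (hc : IsRadiusCode Q α β) (h : IsPoissonLaw r P)
    (h' : IsPoissonLaw s Q) (hd : 1 ≤ d) (hne : ∀ᵐ μ ∂P, ∃ m, Special μ.pts m) :
    ∀ᵐ μ ∂P, mergeMap α β (splitMap α β μ) = μ := by
  have hs := (hc.measurePreserving_splitMap h h' hd hne)
  have hm := hc.measurePreserving_mergeMap h h' hd
  have hms : MeasurableSet {μ : PointMeasure d | LocFin (mergeMap α β (splitMap α β μ)).supp ∧
      LocFin μ.supp ∧ mergeMap α β (splitMap α β μ) = μ} :=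
    PointMeasure.measurableSet_locFin_eq (hm.measurable.comp hs.measurable) measurable_id
  have h1 : ∀ᵐ μ ∂P, LocFin (mergeMap α β (splitMap α β μ)).supp ∧ LocFin μ.supp ∧
      mergeMap α β (splitMap α β μ) = μ := by
    conv in ae P => rw [← hm.map_eq]
    rw [ae_map_iff hm.measurable.aemeasurable hms]
    have h2 := hm.quasiMeasurePreserving.ae h.ae_locFin
    filter_upwards [hc.ae_splitMap_mergeMap h h' hd hne, h2] with p hp hl
    rw [hp]
    exact ⟨hl, hl, rfl⟩
  exact h1.mono fun μ hμ => hμ.2.2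

theorem isAEBijection (hc : IsRadiusCode Q α β) (h : IsPoissonLaw r P)
    (h' : IsPoissonLaw s Q) (hd : 1 ≤ d) (hne : ∀ᵐ μ ∂P, ∃ m, Special μ.pts m) :
    IsAEBijectionWithInverse P (P.prod Q) (splitMap α β) (mergeMap α β) := by
  refine ⟨{μ | mergeMap α β (splitMap α β μ) = μ}, hc.ae_mergeMap_splitMap h h' hd hne,
    {p | splitMap α β (mergeMap α β p) = p}, hc.ae_splitMap_mergeMap h h' hd hne, ?_, ?_⟩
  · refine ⟨fun μ hμ => ?_, fun μ hμ ν hν he => ?_, fun p hp => ⟨mergeMap α β p, ?_, hp⟩⟩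
    · exact congrArg (splitMap α β) hμ
    · have h1 : mergeMap α β (splitMap α β μ) = μ := hμ
      have h2 : mergeMap α β (splitMap α β ν) = ν := hν
      rw [← h1, ← h2, he]
    · exact congrArg (mergeMap α β) hp
  · exact ⟨fun μ hμ => hμ, fun p hp => hp⟩

end IsRadiusCode

/-! ### Equivariance of the split and merge maps -/

section Equivariance

variable {d : ℕ}

theorem PointMeasure.supp_act (g : Euc d ≃ᵢ Euc d) (μ : PointMeasure d) :
    (μ.act g).supp = g '' μ.supp := by
  ext x
  have h1 : (μ.act g).toMeasure {x} = μ.toMeasure {g.symm x} := by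
    have h0 : (μ.act g).toMeasure = μ.toMeasure.map g := rfl
    rw [h0, Measure.map_apply g.continuous.measurable (measurableSet_singleton x)]
    congr 1
    ext y
    simp [g.eq_symm_apply]
  have h2 : ∀ (ν : PointMeasure d) y, y ∈ ν.supp ↔ ν.toMeasure {y} ≠ 0 := by
    intro ν y
    rw [ν.toMeasure_eq, sumDirac_singleton_ne_zero]
  rw [h2, h1, ← h2]
  constructor
  · exact fun h => ⟨_, h, g.apply_symm_apply x⟩
  · rintro ⟨y, hy, rfl⟩
    rwa [g.symm_apply_apply]

theorem PointMeasure.act_ofSet (g : Euc d ≃ᵢ Euc d) {S : Set (Euc d)} (hS : S.Countable) :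
    (ofSet S).act g = ofSet (g '' S) := by
  refine ext_supp ?_
  rw [supp_act, supp_ofSet hS, supp_ofSet (hS.image g)]

theorem PointMeasure.pts_act (g : Euc d ≃ᵢ Euc d) {μ : PointMeasure d} (h : LocFin μ.supp) :
    (μ.act g).pts = g '' μ.pts := by
  rw [pts_eq_supp h, pts_eq_supp, supp_act]
  rw [supp_act]
  exact h.image_isometry g

variable (G : Euc d ≃ᵃⁱ[ℝ] Euc d) {S A : Set (Euc d)} {m : Euc d}

theorem Special.locCell_image (h : Special S m) : locCell (G '' S) (G m) = locCell S m := by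
  ext x
  rw [locCell, locCell, Set.mem_ofPred_eq, Set.mem_ofPred_eq, special_image_iff, h.toWorld_image,
    mem_cell_image]

theorem Special.toLocal_image_image (h : Special S m) :
    toLocal (G '' S) (G m) '' (G '' A) = toLocal S m '' A := by
  rw [Set.image_image]
  exact Set.image_congr fun x _ => h.toLocal_image G

variable (α : ℝ → ℕ → PointMeasure d) (β : (ℕ → PointMeasure d) → ℝ)

theorem Special.splitRadius_image (h : Special S m) :
    splitRadius α β (G '' S) (G m) = splitRadius α β S m := by
  rw [splitRadius, splitRadius, h.locCell_image, radius_image]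

theorem Special.mergeRadius_image (h : Special S m) :
    mergeRadius α β (G '' S) (G '' A) (G m) = mergeRadius α β S A m := by
  rw [mergeRadius, mergeRadius, h.locCell_image, radius_image, h.toLocal_image_image]

theorem extractSet_image : extractSet α (G '' S) = G '' extractSet α S := by
  ext y
  constructor
  · rintro ⟨m', hm', hy, hx⟩
    obtain ⟨m, hm, rfl⟩ := (special_image_iff' G).1 hm'
    obtain ⟨z, rfl⟩ := G.surjective y
    rw [mem_cell_image] at hy
    rw [hm.toLocal_image, radius_image] at hx
    exact ⟨z, ⟨m, hm, hy, hx⟩, rfl⟩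
  · rintro ⟨z, ⟨m, hm, hy, hx⟩, rfl⟩
    refine ⟨G m, hm.image G, (mem_cell_image G).2 hy, ?_⟩
    rwa [hm.toLocal_image, radius_image]

variable {α β}

theorem splitMap_act (hβ : ∀ z, β z ∈ Set.Ioo (0 : ℝ) (1 / 2)) {μ : PointMeasure d}
    (hμ : LocFin μ.supp) (g : Euc d ≃ᵢ Euc d) :
    splitMap α β (μ.act g) = ((splitMap α β μ).1.act g, (splitMap α β μ).2.act g) := by
  -- Surjective isometries are affine (Mazur–Ulam), so midpoints and frames are respected.
  let G : Euc d ≃ᵃⁱ[ℝ] Euc d := g.toRealAffineIsometryEquiv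
  have hG : ∀ A : Set (Euc d), g '' A = G '' A := fun A => rfl
  have h1 := (μ.locFin_pts.setRadius (goodRadii_splitRadius (α := α) hβ μ.pts)).countable
  have h2 := (LocFin.extractSet α μ.locFin_pts).countable
  rw [splitMap, PointMeasure.pts_act g hμ, splitMap, PointMeasure.act_ofSet g h1,
    PointMeasure.act_ofSet g h2]
  simp only [hG]
  rw [extractSet_image, setRadius_image G fun m hm => hm.splitRadius_image G α β]

theorem mergeMap_act (hβ : ∀ z, β z ∈ Set.Ioo (0 : ℝ) (1 / 2)) {μ ν : PointMeasure d}
    (hμ : LocFin μ.supp) (hν : LocFin ν.supp) (g : Euc d ≃ᵢ Euc d) :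
    mergeMap α β (μ.act g, ν.act g) = (mergeMap α β (μ, ν)).act g := by
  let G : Euc d ≃ᵃⁱ[ℝ] Euc d := g.toRealAffineIsometryEquiv
  have hG : ∀ A : Set (Euc d), g '' A = G '' A := fun A => rfl
  have h1 := (μ.locFin_pts.setRadius (goodRadii_mergeRadius (α := α) hβ μ.pts ν.pts)).countable
  rw [mergeMap, mergeMap, PointMeasure.pts_act g hμ, PointMeasure.pts_act g hν,
    PointMeasure.act_ofSet g h1]
  simp only [hG]
  rw [setRadius_image G fun m hm => hm.mergeRadius_image G α β]

end Equivariance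

namespace IsRadiusCode

variable {d : ℕ} {r s : ℝ≥0} {P Q : Measure (PointMeasure d)} [IsProbabilityMeasure Q]
  {α : ℝ → ℕ → PointMeasure d} {β : (ℕ → PointMeasure d) → ℝ}

theorem isFactorToPair (hc : IsRadiusCode Q α β) (h : IsPoissonLaw r P)
    (h' : IsPoissonLaw s Q) (hd : 1 ≤ d) (hne : ∀ᵐ μ ∂P, ∃ m, Special μ.pts m) :
    IsFactorToPair r s P (splitMap α β) := by
  have := h.isProbabilityMeasure
  have hs := hc.measurePreserving_splitMap h h' hd hne
  have h1 : P.map (fun μ => (splitMap α β μ).1) = P :=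
    (measurePreserving_fst.comp hs).map_eq
  have h2 : P.map (fun μ => (splitMap α β μ).2) = Q :=
    (measurePreserving_snd.comp hs).map_eq
  refine ⟨hs.measurable, by rwa [h1], by rwa [h2], ?_, ?_⟩
  · rw [indepFun_iff_map_prod_eq_prod_map_map hs.measurable.fst.aemeasurable
      hs.measurable.snd.aemeasurable, h1, h2]
    exact hs.map_eq
  · filter_upwards [h.ae_locFin] with μ hμ g
    exact splitMap_act hc.encode_mem hμ g

theorem isFactorFromPair (hc : IsRadiusCode Q α β) (h : IsPoissonLaw r P)
    (h' : IsPoissonLaw s Q) (hd : 1 ≤ d) :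
    IsFactorFromPair r (P.prod Q) (mergeMap α β) := by
  have := h.isProbabilityMeasure
  have hm := hc.measurePreserving_mergeMap h h' hd
  refine ⟨hm.measurable, by rwa [hm.map_eq], ?_⟩
  filter_upwards [(Measure.quasiMeasurePreserving_fst (μ := P) (ν := Q)).ae h.ae_locFin,
    (Measure.quasiMeasurePreserving_snd (μ := P) (ν := Q)).ae h'.ae_locFin] with p h1 h2 g
  exact mergeMap_act hc.encode_mem h1 h2 g

end IsRadiusCode

/-! ### A pattern that forces a special centre -/

section Pattern

variable {d : ℕ}

/-- The size of the balls in the test pattern. -/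
def patternEps (d : ℕ) : ℝ := 1 / (8 * (d + 1))

theorem patternEps_pos (d : ℕ) : 0 < patternEps d := by
  unfold patternEps; positivity

theorem patternEps_mul (d : ℕ) : d * patternEps d ≤ 1 / 8 := by
  unfold patternEps
  rw [mul_one_div, div_le_div_iff₀ (by positivity) (by norm_num)]
  linarith

theorem patternEps_le (d : ℕ) : patternEps d ≤ 1 / 8 := by
  unfold patternEps
  rw [div_le_div_iff₀ (by positivity) (by norm_num)]
  have : (0 : ℝ) ≤ d := Nat.cast_nonneg _
  linarith

/-- The centres of the balls in the test pattern. -/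
def patternVec (i : Fin d) : Euc d := EuclideanSpace.single i (13 / 2 + (i : ℝ))

theorem norm_patternVec (i : Fin d) : ‖patternVec i‖ = 13 / 2 + i := by
  rw [patternVec, PiLp.norm_single, Real.norm_of_nonneg (by positivity)]

theorem patternVec_self (i : Fin d) : patternVec i i = 13 / 2 + i := by
  simp [patternVec]

theorem patternVec_of_ne {i j : Fin d} (h : j ≠ i) : patternVec i j = 0 := by
  simp [patternVec, h]

theorem abs_apply_sub_le_dist (a b : Euc d) (j : Fin d) : |a j - b j| ≤ dist a b := by
  rw [dist_eq_norm, ← Real.norm_eq_abs]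
  exact PiLp.norm_apply_le (a - b) j

theorem le_dist_patternVec {i j : Fin d} (h : i ≠ j) :
    13 / 2 ≤ dist (patternVec i) (patternVec j) := by
  have h1 := abs_apply_sub_le_dist (patternVec i) (patternVec j) i
  rw [patternVec_self, patternVec_of_ne h, sub_zero, abs_of_nonneg (by positivity)] at h1
  have : (0 : ℝ) ≤ (i : ℕ) := Nat.cast_nonneg _
  linarith

/-- Diagonal dominance: in the coordinate whose coefficient is largest, the diagonal term is at
least 13 / 2 times that coefficient, while all perturbations together contribute at most 1 / 4 times
it. -/
theorem linearIndependent_of_dist_patternVec {v : Fin d → Euc d}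
    (h : ∀ i, dist (v i) (patternVec i) < 2 * patternEps d) : LinearIndependent ℝ v := by
  rw [Fintype.linearIndependent_iff]
  intro g hg
  by_contra! hne
  obtain ⟨i₀, hi₀⟩ := hne
  obtain ⟨i, -, hi⟩ := Finset.exists_max_image Finset.univ (fun i => |g i|) ⟨i₀, Finset.mem_univ _⟩
  have hpos : 0 < |g i| := (abs_pos.2 hi₀).trans_le (hi i₀ (Finset.mem_univ _))
  have h1 : ∑ j, g j * v j i = 0 := by
    have := congrArg (fun x : Euc d => x i) hg
    simpa using this
  have h2 : ∑ j, g j * (v j i - patternVec j i) = -(g i * (13 / 2 + i)) := by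
    have h3 : ∑ j, g j * patternVec j i = g i * (13 / 2 + i) := by
      rw [Finset.sum_eq_single i]
      · rw [patternVec_self]
      · intro j _ hj
        rw [patternVec_of_ne hj.symm, mul_zero]
      · simp
    simp_rw [mul_sub]
    rw [Finset.sum_sub_distrib, h1, h3, zero_sub]
  have h4 : |∑ j, g j * (v j i - patternVec j i)| ≤ ∑ _j : Fin d, |g i| * (2 * patternEps d) := by
    refine (Finset.abs_sum_le_sum_abs _ _).trans (Finset.sum_le_sum fun j _ => ?_)
    rw [abs_mul]
    refine mul_le_mul (hi j (Finset.mem_univ _)) ?_ (abs_nonneg _) (abs_nonneg _)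
    exact (abs_apply_sub_le_dist _ _ i).trans (h j).le
  rw [h2, abs_neg, abs_mul, abs_of_nonneg (by positivity : (0 : ℝ) ≤ 13 / 2 + (i : ℝ)),
    Finset.sum_const, Finset.card_univ, Fintype.card_fin, nsmul_eq_mul] at h4
  have h5 := patternEps_mul d
  have h6 : (0 : ℝ) ≤ (i : ℕ) := Nat.cast_nonneg _
  have h7 : (d : ℝ) * (|g i| * (2 * patternEps d)) = |g i| * (2 * (d * patternEps d)) := by ring
  rw [h7] at h4
  have := le_of_mul_le_mul_left h4 hpos
  linarith

/-- A configuration which looks like the test pattern near `c` has a special centre. -/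
theorem special_of_pattern {S : Set (Euc d)} {c x y : Euc d} {z : Fin d → Euc d} (hx : x ∈ S)
    (hy : y ∈ S) (hne : x ≠ y) (hxc : dist x c < patternEps d) (hyc : dist y c < patternEps d)
    (hz : ∀ i, z i ∈ S) (hzc : ∀ i, dist (z i) (c + patternVec i) < patternEps d)
    (hS : ∀ w ∈ S, dist w c < d + 40 → w = x ∨ w = y ∨ ∃ i, w = z i) :
    Special S (midpoint ℝ x y) := by
  have he := patternEps_le d
  have he0 := patternEps_pos d
  have hd0 : (0 : ℝ) ≤ d := Nat.cast_nonneg _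
  set m := midpoint ℝ x y with hm
  have hxy : dist x y < 2 * patternEps d := by
    have := dist_triangle_right x y c; linarith
  have hxm : dist x m < patternEps d := by
    rw [hm, dist_left_midpoint, Real.norm_ofNat]; linarith
  have hym : dist y m < patternEps d := by
    rw [hm, dist_right_midpoint, Real.norm_ofNat]; linarith
  have hmc : dist m c < patternEps d := by
    have h1 : m ∈ Metric.ball c (patternEps d) :=
      (convex_ball c (patternEps d)).segment_subset hxc hyc (midpoint_mem_segment x y)
    exact h1
  have hzm' : ∀ i, dist (z i - m) (patternVec i) < 2 * patternEps d := by
    intro i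
    have h1 : dist (z i - m) (patternVec i) = dist (z i) (m + patternVec i) := by
      rw [dist_eq_norm, dist_eq_norm]; congr 1; abel
    have h2 := dist_triangle (z i) (c + patternVec i) (m + patternVec i)
    rw [dist_add_right, dist_comm c] at h2
    have := hzc i
    rw [h1]; linarith
  -- The value 13 / 2 + i is the middle of the i-th shell, so an error below 1 / 4 keeps `z i`
  -- inside.
  have hzm : ∀ i, |dist (z i) m - (13 / 2 + i)| < 1 / 4 := by
    intro i
    have h1 := abs_norm_sub_norm_le (z i - m) (patternVec i)
    rw [← dist_eq_norm, ← dist_eq_norm, norm_patternVec] at h1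
    have := hzm' i
    linarith
  have hzl : ∀ i : Fin d, 6 + ((i : ℕ) : ℝ) ≤ dist (z i) m := fun i => by
    have := abs_lt.1 (hzm i); linarith
  have hzu : ∀ i : Fin d, dist (z i) m < 7 + ((i : ℕ) : ℝ) := fun i => by
    have := abs_lt.1 (hzm i); linarith
  have hzz : ∀ i j, i ≠ j → 1 ≤ dist (z i) (z j) := by
    intro i j hij
    have h1 := le_dist_patternVec hij
    have h2 := dist_triangle4_right (c + patternVec i) (c + patternVec j) (z i) (z j)
    have h3 := hzc i
    have h4 := hzc j
    rw [dist_add_left, dist_comm _ (z i), dist_comm _ (z j)] at h2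
    linarith
  have hmid : ∀ w ∈ S, dist w m < d + 30 → w = x ∨ w = y ∨ ∃ i, w = z i := by
    intro w hw hwm
    refine hS w hw ?_
    have := dist_triangle w m c
    linarith
  have hpair : IsolatedPair 6 S m x y := by
    refine ⟨hx, hy, hne, rfl, by linarith, fun w hw hwm => ?_⟩
    rcases hmid w hw (by linarith) with h | h | ⟨i, rfl⟩
    · exact Or.inl h
    · exact Or.inr h
    · have := hzl i
      have : (0 : ℝ) ≤ (i : ℕ) := Nat.cast_nonneg _
      linarith
  have hshell : ∀ i, ∀ w ∈ S, w ∈ shell i m → w = z i := by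
    intro i w hw hwi
    have hu := shell_upper hwi
    have hl := shell_lower hwi
    rcases hmid w hw (by linarith) with rfl | rfl | ⟨j, rfl⟩
    · linarith
    · linarith
    · have h1 := hzl j
      have h2 := hzu j
      have h3 := hwi.1
      have h4 := hwi.2
      have h5 : ((i : ℕ) : ℝ) < (j : ℕ) + 1 := by linarith
      have h6 : ((j : ℕ) : ℝ) < (i : ℕ) + 1 := by linarith
      have h7 : (i : ℕ) < j + 1 := by exact_mod_cast h5
      have h8 : (j : ℕ) < i + 1 := by exact_mod_cast h6
      rw [Fin.ext (by omega : (j : ℕ) = i)]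
  have hzs : ∀ i, z i ∈ shell i m := fun i => ⟨hzl i, hzu i⟩
  refine ⟨⟨x, hx, y, hy, hpair⟩, ?_, fun i => ⟨z i, hz i, hzs i, hshell i⟩, ?_⟩
  -- The points of a competing pair within d + 20 are among `x`, `y` and the `z i`. The `z i` are at
  -- distance at least 1 from each other and from `x`, `y`, so the pair can only be that of `x` and
  -- `y`.
  · rintro m' ⟨a, ha, b, hb, hp⟩ hm'
    by_contra! hlt
    have ha1 := hp.dist_lt
    have hb1 := hp.dist_right
    have hab : dist a b < 1 := by
      have := dist_triangle_right a b m'; linarith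
    have ham : dist a m < d + 30 := by
      have := dist_triangle a m' m; linarith
    have hbm : dist b m < d + 30 := by
      have := dist_triangle b m' m; linarith
    have hfar : ∀ i, ∀ w, dist w m < patternEps d → 1 ≤ dist (z i) w := by
      intro i w hw
      have h1 := hzl i
      have h2 := dist_triangle (z i) w m
      have : (0 : ℝ) ≤ (i : ℕ) := Nat.cast_nonneg _
      linarith
    have h0 := hp.ne
    refine hm' ?_
    rw [← hp.mid, hm]
    rcases hmid a ha ham with rfl | rfl | ⟨i, rfl⟩ <;> rcases hmid b hb hbm with rfl | rfl | ⟨j, rfl⟩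
    · exact absurd rfl h0
    · rfl
    · have := hfar j _ hxm
      rw [dist_comm] at hab
      linarith
    · exact midpoint_comm _ _
    · exact absurd rfl h0
    · have := hfar j _ hym
      rw [dist_comm] at hab
      linarith
    · have := hfar i _ hxm
      linarith
    · have := hfar i _ hym
      linarith
    · have := hzz i j (fun h => h0 (by rw [h]))
      linarith
  · refine linearIndependent_of_dist_patternVec fun i => ?_
    have h1 : frameVec S m i = z i - m := by
      refine pickVal_eq (f := fun z => z - m) (hz i) (hzs i) fun w hw hw' => ?_
      rw [hshell i w hw hw']
    rw [h1]
    exact hzm' i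

end Pattern

/-! ### Special centres are found with high probability -/

section PatternProbability

variable {d : ℕ} {r : ℝ≥0} {P : Measure (PointMeasure d)}

theorem IsPoissonLaw.measure_count_eq (h : IsPoissonLaw r P) {A : Set (Euc d)}
    (hA : MeasurableSet A) (hfin : volume A < ∞) (n : ℕ) :
    P (PointMeasure.count A ⁻¹' {(n : ℝ≥0∞)}) =
      poissonMeasure (r * (volume A).toNNReal) {n} := by
  rw [← Measure.map_apply (PointMeasure.measurable_count hA) (measurableSet_singleton _),
    h.map_count A hA hfin, Measure.map_apply (measurable_of_countable _) (measurableSet_singleton _)]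
  congr 1
  ext k
  simp

theorem poissonMeasure_singleton_ne_zero {l : ℝ≥0} {n : ℕ} (h : n = 0 ∨ 0 < l) :
    poissonMeasure l {n} ≠ 0 := by
  rw [poissonMeasure_singleton, Ne, ENNReal.ofReal_eq_zero, not_le]
  rcases h with rfl | h
  · simp only [pow_zero, Nat.factorial_zero]
    positivity
  · positivity

/-- The probability not to see a given pattern at any of `k` distant places decays exponentially
in `k`. -/
theorem IsPoissonLaw.exists_pattern_bound (h : IsPoissonLaw r P) (hr : 0 < r) {ι : Type*}
    [Fintype ι] {A : ι → Set (Euc d)} (hA : ∀ i, MeasurableSet (A i))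
    (hdisj : ∀ i j, i ≠ j → Disjoint (A i) (A j)) {ρ : ℝ} (hρ : ∀ i, A i ⊆ Metric.ball 0 ρ)
    (n : ι → ℕ) (hn : ∀ i, n i = 0 ∨ volume (A i) ≠ 0) :
    ∃ q : ℝ≥0∞, q < 1 ∧ ∀ (k : ℕ) (c : Fin k → Euc d), (∀ i j, i ≠ j → 2 * ρ ≤ dist (c i) (c j)) →
      P {μ | ∀ j, ¬ ∀ i, μ.toMeasure ((fun z => z - c j) ⁻¹' A i) = n i} ≤ q ^ k := by
  have := h.isProbabilityMeasure
  have hfin : ∀ i, volume (A i) < ∞ := fun i =>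
    (measure_mono (hρ i)).trans_lt measure_ball_lt_top
  set v : ι → ℝ≥0∞ := fun i => poissonMeasure (r * (volume (A i)).toNNReal) {n i} with hv
  have hv0 : ∏ i, v i ≠ 0 := by
    rw [Finset.prod_ne_zero_iff]
    intro i _
    refine poissonMeasure_singleton_ne_zero ((hn i).imp_right fun h0 => ?_)
    exact mul_pos hr (ENNReal.toNNReal_pos h0 (hfin i).ne)
  refine ⟨1 - ∏ i, v i, ENNReal.sub_lt_self ENNReal.one_ne_top one_ne_zero hv0, fun k c hc => ?_⟩
  let B : Fin k × ι → Set (Euc d) := fun p => (fun z => z - c p.1) ⁻¹' A p.2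
  have hBm : ∀ p, MeasurableSet (B p) := fun p => (measurable_id.sub_const _) (hA p.2)
  have hBv : ∀ p, volume (B p) = volume (A p.2) := fun p =>
    (measurePreserving_sub_right volume (c p.1)).measure_preimage (hA p.2).nullMeasurableSet
  -- Regions at the same place are disjoint by `hdisj`; those at different places lie in disjoint
  -- balls of radius `ρ`.
  have hBd : ∀ p p', p ≠ p' → Disjoint (B p) (B p') := by
    intro p p' hne
    rw [Set.disjoint_left]
    intro z hz hz'
    by_cases h1 : p.1 = p'.1
    · have h2 : p.2 ≠ p'.2 := fun h2 => hne (Prod.ext h1 h2)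
      have hz'' : z - c p.1 ∈ A p'.2 := by rw [h1]; exact hz'
      exact Set.disjoint_left.1 (hdisj _ _ h2) hz hz''
    · have h2 := hρ _ hz
      have h3 := hρ _ hz'
      rw [mem_ball_zero_iff, ← dist_eq_norm] at h2 h3
      have := dist_triangle_left (c p.1) (c p'.1) z
      have := hc _ _ h1
      linarith
  have hind := h.iIndepFun_count B hBm hBd
  let E : Fin k → Set (PointMeasure d) := fun j =>
    {μ | ∀ i, μ.toMeasure ((fun z => z - c j) ⁻¹' A i) = n i}
  have hE : ∀ j, E j = ⋂ i, PointMeasure.count (B (j, i)) ⁻¹' {(n i : ℝ≥0∞)} := by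
    intro j
    ext μ
    simp only [Set.mem_iInter]
    exact Iff.rfl
  have hEm : ∀ j, MeasurableSet (E j) := by
    intro j
    rw [hE]
    exact MeasurableSet.iInter fun i =>
      (PointMeasure.measurable_count (hBm _)) (measurableSet_singleton _)
  have hprod : ∀ s : Finset (Fin k), P (⋂ j ∈ s, E j) = ∏ _j ∈ s, ∏ i, v i := by
    intro s
    have h1 : ⋂ j ∈ s, E j = ⋂ p ∈ s ×ˢ (Finset.univ : Finset ι),
        PointMeasure.count (B p) ⁻¹' {(n p.2 : ℝ≥0∞)} := by
      ext μ
      simp only [hE, Set.mem_iInter, Finset.mem_product, Finset.mem_univ, and_true, Prod.forall]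
      exact ⟨fun h j i hj => h j hj i, fun h j hj i => h j i hj⟩
    rw [h1, hind.measure_inter_preimage_eq_mul _ fun p _ => measurableSet_singleton _,
      Finset.prod_product]
    refine Finset.prod_congr rfl fun j _ => Finset.prod_congr rfl fun i _ => ?_
    rw [h.measure_count_eq (hBm _) (by rw [hBv]; exact hfin i), hBv]
  have hEv : ∀ j, P (E j) = ∏ i, v i := by
    intro j
    have := hprod {j}
    simpa using this
  have hindE : iIndepSet E P := by
    rw [iIndepSet_iff_meas_biInter hEm]
    intro s
    rw [hprod]
    exact Finset.prod_congr rfl fun j _ => (hEv j).symm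
  have hset : {μ : PointMeasure d | ∀ j, ¬ ∀ i, μ.toMeasure ((fun z => z - c j) ⁻¹' A i) = n i} =
      ⋂ j, (E j)ᶜ := by
    ext μ
    simp only [Set.mem_iInter]
    exact Iff.rfl
  rw [hset]
  have h2 : P (⋂ j, (E j)ᶜ) = ∏ j, P (E j)ᶜ :=
    iIndep.meas_iInter (m := fun j => MeasurableSpace.generateFrom {E j}) hindE
      fun j => (MeasurableSpace.measurableSet_generateFrom (Set.mem_singleton _)).compl
  rw [h2]
  simp_rw [fun j => prob_compl_eq_one_sub (μ := P) (hEm j), hEv]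
  simp

/-- The regions of the test pattern. -/
def patternRegion (d : ℕ) : Option (Option (Fin d)) → Set (Euc d)
  | none => Metric.ball 0 (d + 40) \
      (Metric.ball 0 (patternEps d) ∪ ⋃ i, Metric.ball (patternVec i) (patternEps d))
  | some none => Metric.ball 0 (patternEps d)
  | some (some i) => Metric.ball (patternVec i) (patternEps d)

/-- The number of points in the regions of the test pattern. -/
def patternCount (d : ℕ) : Option (Option (Fin d)) → ℕ
  | none => 0
  | some none => 2
  | some (some _) => 1

theorem measurableSet_patternRegion (i : Option (Option (Fin d))) :
    MeasurableSet (patternRegion d i) := by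
  rcases i with _ | _ | i
  · exact measurableSet_ball.diff
      (measurableSet_ball.union (MeasurableSet.iUnion fun i => measurableSet_ball))
  · exact measurableSet_ball
  · exact measurableSet_ball

theorem patternRegion_subset (i : Option (Option (Fin d))) :
    patternRegion d i ⊆ Metric.ball 0 (d + 40) := by
  have he := patternEps_le d
  have hd0 : (0 : ℝ) ≤ d := Nat.cast_nonneg _
  rcases i with _ | _ | i
  · exact Set.sdiff_subset
  · exact Metric.ball_subset_ball (by linarith)
  · refine Metric.ball_subset_ball' ?_
    rw [dist_zero_right, norm_patternVec]
    have : ((i : ℕ) : ℝ) < d := by exact_mod_cast i.2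
    linarith

theorem disjoint_patternRegion (i j : Option (Option (Fin d))) (h : i ≠ j) :
    Disjoint (patternRegion d i) (patternRegion d j) := by
  have he := patternEps_le d
  have h0 : ∀ i : Fin d, Disjoint (Metric.ball (0 : Euc d) (patternEps d))
      (Metric.ball (patternVec i) (patternEps d)) := by
    intro i
    refine Metric.ball_disjoint_ball ?_
    rw [dist_zero_left, norm_patternVec]
    have : (0 : ℝ) ≤ (i : ℕ) := Nat.cast_nonneg _
    linarith
  have hn : ∀ i : Option (Fin d), Disjoint (patternRegion d none) (patternRegion d (some i)) := by
    intro i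
    refine Set.disjoint_left.2 fun z hz hz' => hz.2 ?_
    rcases i with _ | i
    · exact Or.inl hz'
    · exact Or.inr (Set.mem_iUnion.2 ⟨i, hz'⟩)
  rcases i with _ | _ | i <;> rcases j with _ | _ | j
  · exact absurd rfl h
  · exact hn _
  · exact hn _
  · exact (hn _).symm
  · exact absurd rfl h
  · exact h0 j
  · exact (hn _).symm
  · exact (h0 i).symm
  · refine Metric.ball_disjoint_ball ?_
    have := le_dist_patternVec (i := i) (j := j) (fun hij => h (by rw [hij]))
    linarith

theorem patternCount_eq_zero_or (i : Option (Option (Fin d))) :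
    patternCount d i = 0 ∨ volume (patternRegion d i) ≠ 0 := by
  rcases i with _ | _ | i
  · exact Or.inl rfl
  · exact Or.inr (Metric.measure_ball_pos volume _ (patternEps_pos d)).ne'
  · exact Or.inr (Metric.measure_ball_pos volume _ (patternEps_pos d)).ne'

theorem exists_special_of_patternCount {μ : PointMeasure d} (hμ : LocFin μ.supp) {c : Euc d}
    (h : ∀ i, μ.toMeasure ((fun z => z - c) ⁻¹' patternRegion d i) = patternCount d i) :
    ∃ m, Special μ.pts m ∧ dist m c < 1 := by
  rw [PointMeasure.pts_eq_supp hμ]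
  have hcard : ∀ i, (μ.supp ∩ (fun z => z - c) ⁻¹' patternRegion d i).encard =
      patternCount d i := by
    intro i
    have h1 := h i
    have hm : MeasurableSet ((fun z => z - c) ⁻¹' patternRegion d i) :=
      (measurable_id.sub_const c) (measurableSet_patternRegion i)
    rw [μ.toMeasure_eq, sumDirac_apply hm] at h1
    exact_mod_cast h1
  have h2 : (μ.supp ∩ (fun z => z - c) ⁻¹' patternRegion d (some none)).encard = 2 :=
    hcard (some none)
  obtain ⟨x, y, hxy, hset⟩ := Set.encard_eq_two.1 h2
  have h3 : ∀ i, ∃ z, μ.supp ∩ (fun z => z - c) ⁻¹' patternRegion d (some (some i)) = {z} :=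
    fun i => Set.encard_eq_one.1 (hcard (some (some i)))
  choose z hz using h3
  have h4 : μ.supp ∩ (fun z => z - c) ⁻¹' patternRegion d none = ∅ :=
    Set.encard_eq_zero.1 (hcard none)
  have hx : x ∈ μ.supp ∩ (fun z => z - c) ⁻¹' patternRegion d (some none) := by rw [hset]; simp
  have hy : y ∈ μ.supp ∩ (fun z => z - c) ⁻¹' patternRegion d (some none) := by rw [hset]; simp
  have hz' : ∀ i, z i ∈ μ.supp ∩ (fun z => z - c) ⁻¹' patternRegion d (some (some i)) :=
    fun i => by rw [hz]; simp
  have hb : ∀ {w : Euc d}, w - c ∈ Metric.ball (0 : Euc d) (patternEps d) →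
      dist w c < patternEps d := by
    intro w hw
    rwa [mem_ball_zero_iff, ← dist_eq_norm] at hw
  refine ⟨midpoint ℝ x y, special_of_pattern hx.1 hy.1 hxy (hb hx.2) (hb hy.2) (fun i => (hz' i).1)
    (fun i => ?_) fun w hw hwc => ?_, ?_⟩
  · have h5 : dist (z i - c) (patternVec i) < patternEps d := (hz' i).2
    rwa [dist_sub_eq_dist_add_left, add_comm] at h5
  · by_contra! hne
    have h5 : w ∈ μ.supp ∩ (fun z => z - c) ⁻¹' patternRegion d none := by
      refine ⟨hw, ?_, ?_⟩
      · rwa [mem_ball_zero_iff, ← dist_eq_norm]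
      · rintro (h6 | h6)
        · have : w ∈ ({x, y} : Set (Euc d)) := by rw [← hset]; exact ⟨hw, h6⟩
          rcases this with rfl | h7
          · exact hne.1 rfl
          · exact hne.2.1 h7
        · obtain ⟨i, hi⟩ := Set.mem_iUnion.1 h6
          have : w ∈ ({z i} : Set (Euc d)) := by rw [← hz]; exact ⟨hw, hi⟩
          exact hne.2.2 i this
    rw [h4] at h5
    exact h5
  · have h6 : midpoint ℝ x y ∈ Metric.ball c (patternEps d) :=
      (convex_ball c (patternEps d)).segment_subset (hb hx.2) (hb hy.2) (midpoint_mem_segment x y)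
    have := patternEps_le d
    rw [Metric.mem_ball] at h6
    linarith

/-- The pattern is tried at `k` places on a ray from `x`, with spacing 2(d + 40) so that its
translates are disjoint; any success gives a special centre closer to `x` than `R`. -/
theorem IsPoissonLaw.exists_special_bound (h : IsPoissonLaw r P) (hr : 0 < r) (hd : 1 ≤ d) :
    ∃ q : ℝ≥0∞, q < 1 ∧ ∀ (k : ℕ) (x : Euc d) (R : ℝ), 2 * (d + 40) * k + 1 ≤ R →
      P {μ | ∀ m, Special μ.pts m → R ≤ dist m x} ≤ q ^ k := by
  obtain ⟨q, hq, hP⟩ := h.exists_pattern_bound hr measurableSet_patternRegion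
    disjoint_patternRegion patternRegion_subset (patternCount d) patternCount_eq_zero_or
  refine ⟨q, hq, fun k x R hR => ?_⟩
  let e : Euc d := EuclideanSpace.single ⟨0, hd⟩ 1
  have he : ‖e‖ = 1 := by simp [e]
  let c : Fin k → Euc d := fun j => x + (2 * ((d : ℝ) + 40) * (j : ℕ)) • e
  have hc : ∀ i j, i ≠ j → 2 * ((d : ℝ) + 40) ≤ dist (c i) (c j) := by
    intro i j hij
    simp only [c]
    rw [dist_add_left, dist_eq_norm, ← sub_smul, norm_smul, he, mul_one, ← mul_sub, norm_mul,
      Real.norm_of_nonneg (by positivity)]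
    refine le_mul_of_one_le_right (by positivity) ?_
    rw [Real.norm_eq_abs]
    have h1 : (i : ℤ) - (j : ℤ) ≠ 0 := by
      intro h0
      exact hij (Fin.ext (by omega))
    exact_mod_cast Int.one_le_abs h1
  have hcx : ∀ j, dist (c j) x + 1 ≤ R := by
    intro j
    simp only [c]
    rw [dist_eq_norm, add_sub_cancel_left, norm_smul, he, mul_one,
      Real.norm_of_nonneg (by positivity)]
    have h1 : ((j : ℕ) : ℝ) ≤ k := by exact_mod_cast j.2.le
    have h2 : 2 * ((d : ℝ) + 40) * (j : ℕ) ≤ 2 * (d + 40) * k :=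
      mul_le_mul_of_nonneg_left h1 (by positivity)
    linarith
  refine le_trans (measure_mono_ae ?_) (hP k c hc)
  filter_upwards [h.ae_locFin] with μ hμ hno j hpat
  obtain ⟨m, hm, hmc⟩ := exists_special_of_patternCount hμ hpat
  have h1 := hno m hm
  have h2 := dist_triangle m (c j) x
  have h3 := hcx j
  linarith

/-- Almost surely there is a large sphere all of whose points are close to a special centre. -/
theorem IsPoissonLaw.ae_special_dense (h : IsPoissonLaw r P) (hr : 0 < r) (hd : 1 ≤ d) :
    ∀ᵐ μ ∂P, ∃ N : ℕ, 4 ≤ N ∧ ∀ x : Euc d, ‖x‖ = N →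
      ∃ m, Special μ.pts m ∧ dist m x < N / 10 := by
  obtain ⟨q, hq, hP⟩ := h.exists_special_bound hr hd
  -- The net has mesh 1 / 20: if a point of the sphere of radius N has no centre within N / 10, then
  -- some scaled net point has none within N / 20. The union bound costs a constant factor, and
  -- letting `k` tend to infinity shows that the exceptional event is null.
  obtain ⟨K, -, hKfin, hK⟩ := (isCompact_sphere (0 : Euc d) 1).finite_cover_balls
    (e := 1 / 20) (by norm_num)
  have hbad : ∀ k : ℕ, P {μ | ¬ ∃ N : ℕ, 4 ≤ N ∧ ∀ x : Euc d, ‖x‖ = N →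
      ∃ m, Special μ.pts m ∧ dist m x < N / 10} ≤ hKfin.toFinset.card * q ^ k := by
    intro k
    -- This makes N / 20 large enough for `k` trials around each net point.
    obtain ⟨N, hN⟩ := exists_nat_ge (20 * (2 * ((d : ℝ) + 40) * k + 1))
    have hNpos : (0 : ℝ) < N := by
      have : (0 : ℝ) ≤ 2 * ((d : ℝ) + 40) * k := by positivity
      linarith
    have hN4 : 4 ≤ N := by
      have : (0 : ℝ) ≤ 2 * ((d : ℝ) + 40) * k := by positivity
      have : (4 : ℝ) ≤ N := by linarith
      exact_mod_cast this
    have hsub : {μ : PointMeasure d | ¬ ∃ N : ℕ, 4 ≤ N ∧ ∀ x : Euc d, ‖x‖ = N →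
        ∃ m, Special μ.pts m ∧ dist m x < N / 10} ⊆
        ⋃ c ∈ hKfin.toFinset, {μ | ∀ m, Special μ.pts m → (N : ℝ) / 20 ≤ dist m ((N : ℝ) • c)} := by
      intro μ hμ
      rw [Set.mem_ofPred_eq] at hμ
      push Not at hμ
      obtain ⟨x, hx, hm⟩ := hμ N hN4
      have h1 : (N : ℝ)⁻¹ • x ∈ Metric.sphere (0 : Euc d) 1 := by
        rw [mem_sphere_zero_iff_norm, norm_smul, hx, norm_inv, Real.norm_of_nonneg hNpos.le,
          inv_mul_cancel₀ hNpos.ne']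
      obtain ⟨c, hc, hxc⟩ := Set.mem_iUnion₂.1 (hK h1)
      rw [Metric.mem_ball] at hxc
      refine Set.mem_iUnion₂.2 ⟨c, hKfin.mem_toFinset.2 hc, fun m hs => ?_⟩
      have h2 : dist x ((N : ℝ) • c) < N / 20 := by
        have h3 : x = (N : ℝ) • ((N : ℝ)⁻¹ • x) := by
          rw [smul_smul, mul_inv_cancel₀ hNpos.ne', one_smul]
        rw [h3, dist_smul₀, Real.norm_of_nonneg hNpos.le]
        calc (N : ℝ) * dist ((N : ℝ)⁻¹ • x) c < N * (1 / 20) := by gcongr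
          _ = N / 20 := by ring
      have h4 := hm m hs
      have h5 := dist_triangle_right m x ((N : ℝ) • c)
      linarith
    refine (measure_mono hsub).trans ((measure_biUnion_finset_le _ _).trans ?_)
    refine (Finset.sum_le_sum fun c _ => hP k _ _ ?_).trans_eq ?_
    · linarith
    · rw [Finset.sum_const, nsmul_eq_mul]
  have hlim : Tendsto (fun k : ℕ => (hKfin.toFinset.card : ℝ≥0∞) * q ^ k) atTop (𝓝 0) := by
    have := ENNReal.Tendsto.const_mul (a := (hKfin.toFinset.card : ℝ≥0∞))
      (ENNReal.tendsto_pow_atTop_nhds_zero_of_lt_one hq) (Or.inr (ENNReal.natCast_ne_top _))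
    rwa [mul_zero] at this
  exact le_antisymm (ge_of_tendsto' hlim hbad) zero_le

theorem IsPoissonLaw.ae_exists_special (h : IsPoissonLaw r P) (hr : 0 < r) (hd : 1 ≤ d) :
    ∀ᵐ μ ∂P, ∃ m, Special μ.pts m := by
  filter_upwards [h.ae_special_dense hr hd] with μ ⟨N, _, hN⟩
  obtain ⟨m, hm, -⟩ := hN (EuclideanSpace.single ⟨0, hd⟩ (N : ℝ)) (by simp)
  exact ⟨m, hm⟩

end PatternProbability

/-! ### Coding windows -/

section Windows

variable {d : ℕ}

theorem eball_natCast (n : ℕ) :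
    Metric.eball (0 : Euc d) (((n : ℕ∞) : ℝ≥0∞)) = Metric.ball 0 n := by
  ext z
  rw [Metric.mem_eball, Metric.mem_ball, ENat.toENNReal_coe, ← ENNReal.ofReal_natCast,
    edist_lt_ofReal]

theorem eball_top : Metric.eball (0 : Euc d) ((⊤ : ℕ∞) : ℝ≥0∞) = Set.univ := by
  ext z
  simp

namespace PointMeasure

theorem AgreeOnBall.mem_pts_iff {n : ℕ} {μ ν : PointMeasure d} (h : AgreeOnBall n μ ν) {z : Euc d}
    (hz : ‖z‖ < n) : z ∈ μ.pts ↔ z ∈ ν.pts := by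
  rw [AgreeOnBall, eball_natCast] at h
  have hA : ∀ A, A ⊆ Metric.ball (0 : Euc d) n → μ.toMeasure A = ν.toMeasure A := by
    intro A hA
    rw [← Measure.restrict_eq_self _ hA, h, Measure.restrict_eq_self _ hA]
  have hz' : z ∈ Metric.ball (0 : Euc d) n := by rwa [mem_ball_zero_iff]
  have h1 := hA {z} (Set.singleton_subset_iff.2 hz')
  have h2 := hA _ (annulus_subset_ball (floor_norm_lt hz'))
  simp only [pts, supp, Set.mem_ofPred_eq, h1, h2]

theorem agreeOnBall_ofSet {n : ℕ} {S T : Set (Euc d)} (hS : S.Countable) (hT : T.Countable)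
    (h : ∀ z, ‖z‖ < n → (z ∈ S ↔ z ∈ T)) : AgreeOnBall n (ofSet S) (ofSet T) := by
  rw [AgreeOnBall, eball_natCast, toMeasure_ofSet hS, toMeasure_ofSet hT]
  ext A hA
  rw [Measure.restrict_apply hA, Measure.restrict_apply hA, sumDirac_apply (hA.inter measurableSet_ball),
    sumDirac_apply (hA.inter measurableSet_ball)]
  congr 2
  ext z
  constructor
  · rintro ⟨h1, h2, h3⟩
    exact ⟨(h z (mem_ball_zero_iff.1 h3)).1 h1, h2, h3⟩
  · rintro ⟨h1, h2, h3⟩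
    exact ⟨(h z (mem_ball_zero_iff.1 h3)).2 h1, h2, h3⟩

theorem AgreeOnBall.eq_of_top {μ ν : PointMeasure d} (h : AgreeOnBall ⊤ μ ν) : μ = ν := by
  rw [AgreeOnBall, eball_top, Measure.restrict_univ, Measure.restrict_univ] at h
  exact ext_toMeasure h

end PointMeasure

/-- Where no finite radius works the window is ⊤, and agreement on all of space is equality, so the
window condition holds for every configuration. -/
theorem isFinitary_of_ae {P : Measure (PointMeasure d)} {φ : PointMeasure d → PointMeasure d}
    (h : ∀ᵐ μ ∂P, ∃ n : ℕ, ∀ ν, PointMeasure.AgreeOnBall n μ ν →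
      PointMeasure.AgreeOnBall 1 (φ μ) (φ ν)) : IsFinitary P φ := by
  classical
  refine ⟨fun μ => if h : ∃ n : ℕ, ∀ ν, PointMeasure.AgreeOnBall n μ ν →
      PointMeasure.AgreeOnBall 1 (φ μ) (φ ν) then (h.choose : ℕ∞) else ⊤, fun μ ν hμν => ?_, ?_⟩
  · by_cases hμ : ∃ n : ℕ, ∀ ν, PointMeasure.AgreeOnBall n μ ν →
      PointMeasure.AgreeOnBall 1 (φ μ) (φ ν)
    · dsimp only at hμν
      rw [dif_pos hμ] at hμν
      exact hμ.choose_spec ν hμν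
    · dsimp only at hμν
      rw [dif_neg hμ] at hμν
      rw [hμν.eq_of_top]
      exact rfl
  · filter_upwards [h] with μ hμ
    rw [dif_pos hμ]
    exact WithTop.coe_lt_top _

theorem isFinitaryFromPair_of_ae {PQ : Measure (PointMeasure d × PointMeasure d)}
    {ζ : PointMeasure d × PointMeasure d → PointMeasure d}
    (h : ∀ᵐ p ∂PQ, ∃ n : ℕ, ∀ q : PointMeasure d × PointMeasure d,
      PointMeasure.AgreeOnBall n p.1 q.1 → PointMeasure.AgreeOnBall n p.2 q.2 →
      PointMeasure.AgreeOnBall 1 (ζ p) (ζ q)) : IsFinitaryFromPair PQ ζ := by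
  classical
  refine ⟨fun p => if h : ∃ n : ℕ, ∀ q : PointMeasure d × PointMeasure d,
      PointMeasure.AgreeOnBall n p.1 q.1 → PointMeasure.AgreeOnBall n p.2 q.2 →
      PointMeasure.AgreeOnBall 1 (ζ p) (ζ q) then (h.choose : ℕ∞) else ⊤,
      fun p q hpq hpq' => ?_, ?_⟩
  · by_cases hp : ∃ n : ℕ, ∀ q : PointMeasure d × PointMeasure d,
      PointMeasure.AgreeOnBall n p.1 q.1 → PointMeasure.AgreeOnBall n p.2 q.2 →
      PointMeasure.AgreeOnBall 1 (ζ p) (ζ q)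
    · dsimp only at hpq hpq'
      rw [dif_pos hp] at hpq hpq'
      exact hp.choose_spec q hpq hpq'
    · dsimp only at hpq hpq'
      rw [dif_neg hp] at hpq hpq'
      rw [Prod.ext hpq.eq_of_top hpq'.eq_of_top]
      exact rfl
  · filter_upwards [h] with p hp
    rw [dif_pos hp]
    exact WithTop.coe_lt_top _

/-- All points of the sphere of radius `N` are close to a special centre. -/
def DenseSphere (S : Set (Euc d)) (N : ℕ) : Prop :=
  4 ≤ N ∧ ∀ x : Euc d, ‖x‖ = N → ∃ m, Special S m ∧ dist m x < N / 10

/-- The radius is d + 20 + 2: competing centres within d + 20 must be recognisable, and they are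
judged by balls of radius 2. -/
theorem Special.congr {S T : Set (Euc d)} {m : Euc d}
    (h : ∀ z, dist z m < d + 22 → (z ∈ S ↔ z ∈ T)) (hm : Special S m) : Special T m := by
  have hd0 : (0 : ℝ) ≤ d := Nat.cast_nonneg _
  refine ⟨hm.center.congr (by norm_num) fun z hz => h z (by linarith), fun m' hm' hne => ?_,
    hm.frame.congr fun z _ hz => h z (by linarith)⟩
  by_contra! hlt
  refine absurd (hm.separated m' (hm'.congr (by norm_num) fun z hz => (h z ?_).symm) hne)
    (not_le.2 hlt)
  have := dist_triangle z m' m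
  linarith

/-- If the cell left the ball, the segment from `m` to the outer point y would cross the sphere at
some x. A special centre within N / 10 of x is then closer to y than `m`, because `m` is farther
than N - 3 from x, and N - 3 > N / 10 once N ≥ 4. -/
theorem DenseSphere.cell_subset {S : Set (Euc d)} {N : ℕ} (h : DenseSphere S N) {m : Euc d}
    (hm : ‖m‖ < 3) : cell S m ⊆ Metric.ball 0 N := by
  intro y hy
  by_contra hyN
  rw [mem_ball_zero_iff, not_lt] at hyN
  have hN : (4 : ℝ) ≤ N := by exact_mod_cast h.1
  obtain ⟨x, hx, hxN⟩ := (convex_segment m y).isPreconnected.intermediate_value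
    (left_mem_segment ℝ m y) (right_mem_segment ℝ m y) continuous_norm.continuousOn
    (⟨by linarith, hyN⟩ : (N : ℝ) ∈ Set.Icc ‖m‖ ‖y‖)
  have hxN : ‖x‖ = N := hxN
  obtain ⟨m', hm', hd'⟩ := h.2 x hxN
  have h1 := dist_add_dist_of_mem_segment hx
  have h2 : (N : ℝ) - 3 < dist m x := by
    have h3 := norm_sub_norm_le x m
    rw [hxN, ← dist_eq_norm, dist_comm] at h3
    linarith
  have hne : m' ≠ m := by
    rintro rfl
    linarith
  have h3 := hy m' hm' hne
  have h4 := dist_triangle y x m'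
  rw [dist_comm y m, ← h1] at h3
  rw [dist_comm y x, dist_comm x m'] at h4
  linarith

variable {S T A B : Set (Euc d)} {N : ℕ} {m : Euc d}

/-- `S` and `T` agree on the window which determines the maps near the origin. -/
def AgreeNear (N : ℕ) (S T : Set (Euc d)) : Prop :=
  ∀ z, ‖z‖ < (2 * N + d + 30 : ℕ) → (z ∈ S ↔ z ∈ T)

theorem AgreeNear.symm (h : AgreeNear N S T) : AgreeNear N T S := fun z hz => (h z hz).symm

theorem AgreeNear.mem_iff (h : AgreeNear N S T) {z : Euc d} (hz : ‖z‖ < 2 * N + d + 30) :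
    z ∈ S ↔ z ∈ T := h z (by push_cast; exact hz)

/-- The window 2N + d + 30 is the sum of 2N + 8, the region of centres that matter, and d + 22, the
range on which being special depends. -/
theorem AgreeNear.mem_iff_of_dist (h : AgreeNear N S T) (hm : ‖m‖ < 2 * N + 8) {z : Euc d}
    (hz : dist z m < d + 22) : z ∈ S ↔ z ∈ T := by
  refine h.mem_iff ?_
  have := dist_triangle z m 0
  rw [dist_zero_right, dist_zero_right] at this
  linarith

theorem AgreeNear.special (h : AgreeNear N S T) (hm : ‖m‖ < 2 * N + 8) (hs : Special S m) :
    Special T m :=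
  hs.congr fun _ hz => h.mem_iff_of_dist hm hz

theorem AgreeNear.frameVec_eq (h : AgreeNear N S T) (hm : ‖m‖ < 2 * N + 8) :
    frameVec S m = frameVec T m :=
  frameVec_congr fun _ _ hz => h.mem_iff_of_dist hm (by linarith)

theorem AgreeNear.radius_eq (h : AgreeNear N S T) (hm : ‖m‖ < 2 * N + 8) :
    radius S m = radius T m := by
  refine pickVal_congr (fun z => and_congr_left fun hz => h.mem_iff_of_dist hm ?_) fun _ _ _ => rfl
  have hd0 : (0 : ℝ) ≤ d := Nat.cast_nonneg _
  linarith

theorem DenseSphere.congr (hN : DenseSphere S N) (h : AgreeNear N S T) : DenseSphere T N := by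
  refine ⟨hN.1, fun x hx => ?_⟩
  obtain ⟨m, hm, hd'⟩ := hN.2 x hx
  refine ⟨m, h.special ?_ hm, hd'⟩
  have h1 := dist_triangle m x 0
  rw [dist_zero_right, dist_zero_right, hx] at h1
  have : (0 : ℝ) ≤ N := Nat.cast_nonneg _
  linarith

/-- Competing centres outside the visible region are automatically farther from `y` than `m`. -/
theorem AgreeNear.mem_cell (h : AgreeNear N S T) {y : Euc d} (hy : ‖y‖ + dist y m < 2 * N + 8)
    (hc : y ∈ cell S m) : y ∈ cell T m := by
  intro m' hm' hne
  by_cases hlt : ‖m'‖ < 2 * N + 8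
  · exact hc m' (h.symm.special hlt hm') hne
  · have h1 := dist_triangle_left m' 0 y
    rw [dist_zero_right, dist_zero_right] at h1
    linarith

theorem DenseSphere.cell_subset_cell (hN : DenseSphere S N) (h : AgreeNear N S T) (hm : ‖m‖ < 3) :
    cell S m ⊆ cell T m := by
  intro y hy
  have h1 := hN.cell_subset hm hy
  rw [mem_ball_zero_iff] at h1
  refine h.mem_cell ?_ hy
  have h2 := dist_triangle_right y m 0
  rw [dist_zero_right, dist_zero_right] at h2
  linarith

theorem DenseSphere.cell_eq (hN : DenseSphere S N) (h : AgreeNear N S T) (hm : ‖m‖ < 3) :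
    cell S m = cell T m :=
  Set.Subset.antisymm (hN.cell_subset_cell h hm) ((hN.congr h).cell_subset_cell h.symm hm)

theorem lt_window (hm : ‖m‖ < 3) : ‖m‖ < 2 * N + 8 := by
  have : (0 : ℝ) ≤ N := Nat.cast_nonneg _
  linarith

theorem DenseSphere.locCell_eq (hN : DenseSphere S N) (h : AgreeNear N S T) (hm : ‖m‖ < 3) :
    locCell S m = locCell T m := by
  have h1 : Special S m ↔ Special T m := ⟨h.special (lt_window hm), h.symm.special (lt_window hm)⟩
  simp only [locCell, hN.cell_eq h hm, toWorld_congr (h.frameVec_eq (lt_window hm)), h1]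

variable {α : ℝ → ℕ → PointMeasure d} {β : (ℕ → PointMeasure d) → ℝ}

theorem DenseSphere.splitRadius_eq (hN : DenseSphere S N) (h : AgreeNear N S T) (hm : ‖m‖ < 3) :
    splitRadius α β S m = splitRadius α β T m := by
  rw [splitRadius, splitRadius, hN.locCell_eq h hm, h.radius_eq (lt_window hm)]

theorem mixSet_congr {D A A' B : Set (Euc d)} (h : A ∩ D = A' ∩ D) :
    mixSet D A B = mixSet D A' B := by
  rw [mixSet, mixSet, h]

theorem mergeSeq_congr {D A A' : Set (Euc d)} {z : ℕ → PointMeasure d} (h : A ∩ D = A' ∩ D) :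
    mergeSeq D A z = mergeSeq D A' z := by
  funext n
  cases n with
  | zero => rw [mergeSeq, mergeSeq, mixSet_congr h]
  | succ n => rfl

theorem DenseSphere.image_toLocal_subset (hN : DenseSphere S N) (h' : AgreeNear N A B)
    (hs : Special S m) (hm : ‖m‖ < 3) :
    toLocal S m '' A ∩ locCell S m ⊆ toLocal S m '' B ∩ locCell S m := by
  rintro _ ⟨⟨y, hy, rfl⟩, hD⟩
  refine ⟨⟨y, ?_, rfl⟩, hD⟩
  have hc := hD.2
  rw [hs.toWorld_toLocal] at hc
  have h1 := hN.cell_subset hm hc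
  rw [mem_ball_zero_iff] at h1
  refine (h'.mem_iff ?_).1 hy
  have : (0 : ℝ) ≤ d := Nat.cast_nonneg _
  have : (0 : ℝ) ≤ N := Nat.cast_nonneg _
  linarith

theorem DenseSphere.mergeRadius_eq (hN : DenseSphere S N) (h : AgreeNear N S T)
    (h' : AgreeNear N A B) (hs : Special S m) (hm : ‖m‖ < 3) :
    mergeRadius α β S A m = mergeRadius α β T B m := by
  rw [mergeRadius, mergeRadius, ← hN.locCell_eq h hm, ← h.radius_eq (lt_window hm),
    ← toLocal_congr (h.frameVec_eq (lt_window hm)), mergeSeq_congr (Set.Subset.antisymm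
      (hN.image_toLocal_subset h' hs hm) (hN.image_toLocal_subset h'.symm hs hm))]

/-- A point in the unit ball comes from a point of norm less than 2, whose centre, if any, has norm
less than 3; only those radii matter. -/
theorem AgreeNear.setRadius_subset (h : AgreeNear N S T) {ρ ρ' : Euc d → ℝ} (hρ : GoodRadii S ρ)
    (he : ∀ m, Special S m → ‖m‖ < 3 → ρ m = ρ' m) {x : Euc d} (hx : ‖x‖ < 1)
    (hxS : x ∈ setRadius S ρ) : x ∈ setRadius T ρ' := by
  have hd0 : (0 : ℝ) ≤ d := Nat.cast_nonneg _
  have hN0 : (0 : ℝ) ≤ N := Nat.cast_nonneg _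
  obtain ⟨z, hz, rfl⟩ := hxS
  have h1 : ‖z‖ < 2 := by
    have h2 := hρ.dist_movePt_lt hz
    have h3 := dist_triangle_left z 0 (movePt S ρ z)
    rw [dist_zero_right, dist_zero_right] at h3
    linarith
  have hzT : z ∈ T := (h.mem_iff (by linarith)).1 hz
  have hnear : ∀ m, dist z m < 1 / 2 → ‖m‖ < 3 := by
    intro m hm
    have h3 := dist_triangle_left m 0 z
    rw [dist_zero_right, dist_zero_right] at h3
    linarith
  refine ⟨z, hzT, ?_⟩
  rcases far_or_near S z with hf | ⟨m, hm, hzm⟩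
  · rw [movePt_of_far hf, movePt_of_far]
    intro m hm
    by_contra! hlt
    exact absurd (hf m (h.symm.special (lt_window (hnear m hlt)) hm)) (not_le.2 hlt)
  · have hm3 := hnear m hzm
    rw [hm.movePt_eq hz hzm, (h.special (lt_window hm3) hm).movePt_eq hzT hzm, he m hm hm3]

/-- Here the centre need not be near the origin. A special centre near the sphere of radius `N`
bounds the distance from `y` to its own centre by 3N / 2 + 1, so that centre is still in the visible
region. -/
theorem DenseSphere.extractSet_subset (hN : DenseSphere S N) (hd : 1 ≤ d) (h : AgreeNear N S T)
    {y : Euc d} (hy : ‖y‖ < 1) (hyS : y ∈ extractSet α S) : y ∈ extractSet α T := by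
  obtain ⟨m, hm, hc, hx⟩ := hyS
  have hN4 : (4 : ℝ) ≤ N := by exact_mod_cast hN.1
  have hbd : dist y m < 3 / 2 * N + 1 := by
    obtain ⟨m₀, hm₀, hd₀⟩ := hN.2 (EuclideanSpace.single ⟨0, hd⟩ (N : ℝ)) (by simp)
    have h1 := dist_triangle m₀ (EuclideanSpace.single ⟨0, hd⟩ (N : ℝ)) 0
    have h2 : dist (EuclideanSpace.single (⟨0, hd⟩ : Fin d) (N : ℝ)) 0 = N := by simp
    have h3 := dist_triangle_right y m₀ 0
    rw [dist_zero_right y] at h3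
    by_cases hne : m₀ = m
    · subst hne
      linarith
    · have := hc m₀ hm₀ hne
      linarith
  have hm' : ‖m‖ < 2 * N + 8 := by
    have h3 := dist_triangle_left m 0 y
    rw [dist_zero_right, dist_zero_right] at h3
    linarith
  refine ⟨m, h.special hm' hm, h.mem_cell (by linarith) hc, ?_⟩
  rwa [← toLocal_congr (h.frameVec_eq hm'), ← h.radius_eq hm']

end Windows

/-! ### Finitariness, and the conclusion -/

namespace IsRadiusCode

variable {d : ℕ} {r s : ℝ≥0} {P Q : Measure (PointMeasure d)} [IsProbabilityMeasure Q]
  {α : ℝ → ℕ → PointMeasure d} {β : (ℕ → PointMeasure d) → ℝ}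

theorem isFinitaryToPair (hc : IsRadiusCode Q α β) (h : IsPoissonLaw r P) (hr : 0 < r)
    (hd : 1 ≤ d) : IsFinitaryToPair P (splitMap α β) := by
  constructor
  · refine isFinitary_of_ae ?_
    filter_upwards [h.ae_special_dense hr hd] with μ ⟨N, hN⟩
    refine ⟨2 * N + d + 30, fun ν hν => ?_⟩
    have hN : DenseSphere μ.pts N := hN
    have ha : AgreeNear N μ.pts ν.pts := fun z hz => hν.mem_pts_iff hz
    have hg : ∀ ξ : PointMeasure d, GoodRadii ξ.pts (splitRadius α β ξ.pts) := fun ξ =>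
      goodRadii_splitRadius hc.encode_mem ξ.pts
    refine PointMeasure.agreeOnBall_ofSet (n := 1) (μ.locFin_pts.setRadius (hg μ)).countable
      (ν.locFin_pts.setRadius (hg ν)).countable fun z hz => ?_
    rw [Nat.cast_one] at hz
    exact ⟨ha.setRadius_subset (hg μ) (fun m _ hm => hN.splitRadius_eq ha hm) hz,
      ha.symm.setRadius_subset (hg ν) (fun m _ hm => (hN.congr ha).splitRadius_eq ha.symm hm) hz⟩
  · refine isFinitary_of_ae ?_
    filter_upwards [h.ae_special_dense hr hd] with μ ⟨N, hN⟩
    refine ⟨2 * N + d + 30, fun ν hν => ?_⟩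
    have hN : DenseSphere μ.pts N := hN
    have ha : AgreeNear N μ.pts ν.pts := fun z hz => hν.mem_pts_iff hz
    refine PointMeasure.agreeOnBall_ofSet (n := 1) (LocFin.extractSet α μ.locFin_pts).countable
      (LocFin.extractSet α ν.locFin_pts).countable fun z hz => ?_
    rw [Nat.cast_one] at hz
    exact ⟨hN.extractSet_subset hd ha hz, (hN.congr ha).extractSet_subset hd ha.symm hz⟩

theorem isFinitaryFromPair (hc : IsRadiusCode Q α β) (h : IsPoissonLaw r P) (hr : 0 < r)
    (hd : 1 ≤ d) : IsFinitaryFromPair (P.prod Q) (mergeMap α β) := by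
  refine isFinitaryFromPair_of_ae ?_
  filter_upwards [(Measure.quasiMeasurePreserving_fst (μ := P) (ν := Q)).ae
    (h.ae_special_dense hr hd)] with p ⟨N, hN⟩
  refine ⟨2 * N + d + 30, fun q h1 h2 => ?_⟩
  have hN : DenseSphere p.1.pts N := hN
  have ha : AgreeNear N p.1.pts q.1.pts := fun z hz => h1.mem_pts_iff hz
  have hb : AgreeNear N p.2.pts q.2.pts := fun z hz => h2.mem_pts_iff hz
  have hg : ∀ ξ : PointMeasure d × PointMeasure d,
      GoodRadii ξ.1.pts (mergeRadius α β ξ.1.pts ξ.2.pts) := fun ξ =>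
    goodRadii_mergeRadius hc.encode_mem ξ.1.pts ξ.2.pts
  refine PointMeasure.agreeOnBall_ofSet (n := 1) (p.1.locFin_pts.setRadius (hg p)).countable
    (q.1.locFin_pts.setRadius (hg q)).countable fun z hz => ?_
  rw [Nat.cast_one] at hz
  exact ⟨ha.setRadius_subset (hg p) (fun m hs hm => hN.mergeRadius_eq ha hb hs hm) hz,
    ha.symm.setRadius_subset (hg q)
      (fun m hs hm => (hN.congr ha).mergeRadius_eq ha.symm hb.symm hs hm) hz⟩

end IsRadiusCode

theorem proposition4 (d : ℕ) (hd : 1 ≤ d) (s : ℝ≥0) (hs : 0 < s) :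
    ∃ (ψ : PointMeasure d → PointMeasure d × PointMeasure d)
      (ζ : PointMeasure d × PointMeasure d → PointMeasure d),
      ∀ r : ℝ≥0, 0 < r →
        ∀ P Q : Measure (PointMeasure d), IsPoissonLaw r P → IsPoissonLaw s Q →
          IsFactorToPair r s P ψ ∧
          IsFinitaryToPair P ψ ∧
          IsAEBijectionWithInverse P (P.prod Q) ψ ζ ∧
          IsFactorFromPair r (P.prod Q) ζ ∧
          IsFinitaryFromPair (P.prod Q) ζ := by
  -- The maps must be fixed before `r`, `P` and `Q` are given. They are built from some Poisson law
  -- of intensity `s`, and uniqueness identifies it with any `Q` that appears later; without such a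
  -- law nothing is to be shown.
  by_cases hex : ∃ Q : Measure (PointMeasure d), IsPoissonLaw s Q
  · obtain ⟨Q₀, hQ₀⟩ := hex
    have := hQ₀.isProbabilityMeasure
    obtain ⟨α, β, hα, hβ, hmem, hmap, -, hinv, -⟩ := exists_radius_code hd hs hQ₀
    have hc : IsRadiusCode Q₀ α β := ⟨hα, hβ, hmem, hmap, hinv⟩
    refine ⟨splitMap α β, mergeMap α β, fun r hr P Q hP hQ => ?_⟩
    obtain rfl := hQ.unique hQ₀
    have hne := hP.ae_exists_special hr hd
    exact ⟨hc.isFactorToPair hP hQ hd hne, hc.isFinitaryToPair hP hr hd,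
      hc.isAEBijection hP hQ hd hne, hc.isFactorFromPair hP hQ hd, hc.isFinitaryFromPair hP hr hd⟩
  · exact ⟨fun μ => (μ, μ), Prod.fst, fun r hr P Q hP hQ => absurd ⟨Q, hQ⟩ hex⟩
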